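/- Let $A,B,C$ be finite-dimensional quantum systems with Hilbert spaces $\mathcal H_A,\mathcal H_B,\mathcal H_C$. A pure state $|\psi_{ABC}\rangle$ is a sum of triangle states (SOTS) if there are orthogonal decompositions $\mathcal H_X=\bigoplus_l(\mathcal H_{X_1}^l\otimes\mathcal H_{X_2}^l)\oplus\mathcal H_X^0$ for $X=A,B,C$ (with a common finite index set of $l$), a probability distribution $(p_l)$ and pure states $|\psi^l_{A_1B_2}\rangle\in\mathcal H^l_{A_1}\otimes\mathcal H^l_{B_2}$, $|\psi^l_{B_1C_2}\rangle\in\mathcal H^l_{B_1}\otimes\mathcal H^l_{C_2}$, $|\psi^l_{C_1A_2}\rangle\in\mathcal H^l_{C_1}\otimes\mathcal H^l_{A_2}$ such that $$|\psi_{ABC}\rangle=\sum_l\sqrt{p_l}\,|\psi^l_{A_1B_2}\rangle\otimes|\psi^l_{B_1C_2}\rangle\otimes|\psi^l_{C_1A_2}\rangle .$$ The Markov gap of a bipartite state $\rho_{AB}$ is $h(A:B)=S_R(A:B)-I(A:B)$, where $I(A:B)=S_A+S_B-S_{AB}$ is the mutual information ($S$ being the von Neumann entropy) and $S_R(A:B)=S_{A\bar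 A}(|\sqrt{\rho_{AB}}\rangle)$ is the reflected entropy, i.e. the entropy of $A\bar A$ in the canonical purification $|\sqrt{\rho_{AB}}\rangle\in\mathcal H_A\otimes\mathcal H_B\otimes\mathcal H_{\bar A}\otimes\mathcal H_{\bar B}$. The Markov gap of $|\psi_{ABC}\rangle$ is that of its marginal $\rho_{AB}=\mathrm{Tr}_C|\psi_{ABC}\rangle\langle\psi_{ABC}|$. A bipartite state $\rho_{AB}$ is entangled if it is not a finite convex combination of product states. It is distillable if its distillable entanglement is positive: for some rate $R>0$ there are finite-round LOCC channels $\Lambda_n$ and integers $m_n$, with $m_n\ge Rn$ for all large $n$, such that the fidelity of $\Lambda_n(\rho_{AB}^{\otimes n})$ with $m_n$ Bell pairs tends to $1$ as $n\to\infty$. It is bound entangled if it is entangled and not distillable. Theorem. (1) A pure state $|\psi_{ABC}\rangle$ is a SOTS if and only if its Markov gap is zero, $h(A:B)=0$. (2) If $|\psi_{ABC}\rangle$ is a SOTS and its marginal $\rho_{AB}$ is entangled, then $\rho_{AB}$ is distillable; in particular $\rho_{AB}$ is never bound entangled. (3) Every bound entangled state $\rho_{AB}$ has non-zero Markov gap,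 $h(A:B)>0$. -/

import Mathlib

open scoped Matrix Kronecker Topology ComplexOrder

noncomputable section

/-!
Finite-dimensional quantum systems are described by finite index sets of orthonormal bases: the
system with basis `a` has Hilbert space `ℂ^a`, and the composite of `a` and `b` has basis `a × b`.
-/

namespace Quantum

/-- Unit vectors, i.e. pure states. -/
def IsUnitVector {x : Type} [Fintype x] (ψ : x → ℂ) : Prop :=
  ∑ i, ‖ψ i‖ ^ 2 = 1

/-- The operator `|ψ⟩⟨ψ|`. -/
def ketBra {x : Type} (ψ : x → ℂ) : Matrix x x ℂ :=
  Matrix.vecMulVec ψ (star ψ)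

/-- Partial trace over the second tensor factor. -/
def traceRight {x y : Type} [Fintype y] (M : Matrix (x × y) (x × y) ℂ) : Matrix x x ℂ :=
  fun i j => ∑ k, M (i, k) (j, k)

/-- Partial trace over the first tensor factor. -/
def traceLeft {x y : Type} [Fintype x] (M : Matrix (x × y) (x × y) ℂ) : Matrix y y ℂ :=
  fun i j => ∑ k, M (k, i) (k, j)

/-- Density matrices. -/
def IsDensity {x : Type} [Fintype x] (ρ : Matrix x x ℂ) : Prop :=
  ρ.PosSemidef ∧ ρ.trace = 1

/-- The marginal `ρ_AB = Tr_C |ψ⟩⟨ψ|` of a tripartite pure state. -/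
def marginalAB {a b c : Type} [Fintype c] (ψ : (a × b) × c → ℂ) : Matrix (a × b) (a × b) ℂ :=
  traceRight (ketBra ψ)

/-! ### Separable and entangled states -/

/-- Separable operators: finite convex combinations of products of density matrices. -/
def IsSeparable {a b : Type} [Fintype a] [Fintype b] (ρ : Matrix (a × b) (a × b) ℂ) : Prop :=
  ∃ (N : ℕ) (p : Fin N → ℝ) (σ : Fin N → Matrix a a ℂ) (τ : Fin N → Matrix b b ℂ),
    (∀ k, 0 ≤ p k) ∧ ∑ k, p k = 1 ∧ (∀ k, IsDensity (σ k)) ∧ (∀ k, IsDensity (τ k)) ∧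
      ρ = ∑ k, (p k : ℂ) • (σ k ⊗ₖ τ k)

/-- Entangled states: density matrices that are not separable. -/
def IsEntangled {a b : Type} [Fintype a] [Fintype b] (ρ : Matrix (a × b) (a × b) ℂ) : Prop :=
  IsDensity ρ ∧ ¬ IsSeparable ρ

/-! ### Entropies and the Markov gap -/

/-- The von Neumann entropy `-Tr ρ log ρ` (natural logarithm) of a Hermitian matrix. -/
def entropy {x : Type} [Fintype x] [DecidableEq x] (ρ : Matrix x x ℂ) : ℝ :=
  open Classical in
  if h : ρ.IsHermitian then ∑ i, Real.negMulLog (h.eigenvalues i) else 0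

section

variable {a b : Type} [Fintype a] [DecidableEq a] [Fintype b] [DecidableEq b]

/-- The mutual information `I(A:B) = S_A + S_B - S_AB`. -/
def mutualInfo (ρ : Matrix (a × b) (a × b) ℂ) : ℝ :=
  entropy (traceRight ρ) + entropy (traceLeft ρ) - entropy ρ

/-- The canonical purification `|√ρ_AB⟩` of `ρ_AB`, a vector of `A ⊗ B ⊗ Ā ⊗ B̄`, with the tensor
factors ordered as `(A ⊗ Ā) ⊗ (B ⊗ B̄)`. -/
def canonicalPurification (ρ : Matrix (a × b) (a × b) ℂ) : (a × a) × (b × b) → ℂ :=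
  fun x => cfc Real.sqrt ρ (x.1.1, x.2.1) (x.1.2, x.2.2)

/-- The reflected entropy: the entropy of `A Ā` in the canonical purification. -/
def reflectedEntropy (ρ : Matrix (a × b) (a × b) ℂ) : ℝ :=
  entropy (traceRight (ketBra (canonicalPurification ρ)))

/-- The Markov gap `h(A:B) = S_R(A:B) - I(A:B)`. -/
def markovGap (ρ : Matrix (a × b) (a × b) ℂ) : ℝ :=
  reflectedEntropy ρ - mutualInfo ρ

end

/-! ### Sums of triangle states -/

/-- A decomposition of (a subspace of) `ℂ^a` as an orthogonal direct sum of tensor products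
`ℂ^(d₁ l) ⊗ ℂ^(d₂ l)`, given by isometric embeddings with mutually orthogonal ranges.  The
orthogonal complement of the sum of the ranges is the remaining summand `H⁰`. -/
def IsBlockDecomposition {a : Type} [Fintype a] {N : ℕ} (d₁ d₂ : Fin N → ℕ)
    (U : ∀ l, Matrix a (Fin (d₁ l) × Fin (d₂ l)) ℂ) : Prop :=
  (∀ l, (U l)ᴴ * U l = 1) ∧ ∀ l m, l ≠ m → (U l)ᴴ * U m = 0

/-- Sums of triangle states
`∑ l, √(p l) |ψ^l_{A₁B₂}⟩ ⊗ |ψ^l_{B₁C₂}⟩ ⊗ |ψ^l_{C₁A₂}⟩` with respect to decompositions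
`H_X = ⨁ l, (H^l_{X₁} ⊗ H^l_{X₂}) ⊕ H⁰_X` for `X = A, B, C`. -/
def IsSOTS {a b c : Type} [Fintype a] [Fintype b] [Fintype c] (ψ : (a × b) × c → ℂ) : Prop :=
  ∃ (N : ℕ) (p : Fin N → ℝ) (a₁ a₂ b₁ b₂ c₁ c₂ : Fin N → ℕ)
    (U : ∀ l, Matrix a (Fin (a₁ l) × Fin (a₂ l)) ℂ)
    (V : ∀ l, Matrix b (Fin (b₁ l) × Fin (b₂ l)) ℂ)
    (W : ∀ l, Matrix c (Fin (c₁ l) × Fin (c₂ l)) ℂ)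
    (ψAB : ∀ l, Fin (a₁ l) × Fin (b₂ l) → ℂ)
    (ψBC : ∀ l, Fin (b₁ l) × Fin (c₂ l) → ℂ)
    (ψCA : ∀ l, Fin (c₁ l) × Fin (a₂ l) → ℂ),
    (∀ l, 0 ≤ p l) ∧ ∑ l, p l = 1 ∧
    IsBlockDecomposition a₁ a₂ U ∧ IsBlockDecomposition b₁ b₂ V ∧ IsBlockDecomposition c₁ c₂ W ∧
    (∀ l, IsUnitVector (ψAB l)) ∧ (∀ l, IsUnitVector (ψBC l)) ∧ (∀ l, IsUnitVector (ψCA l)) ∧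
    ∀ i j k, ψ ((i, j), k) = ∑ l, (Real.sqrt (p l) : ℂ) *
      ∑ x : Fin (a₁ l) × Fin (a₂ l), ∑ y : Fin (b₁ l) × Fin (b₂ l), ∑ z : Fin (c₁ l) × Fin (c₂ l),
        U l i x * V l j y * W l k z *
          (ψAB l (x.1, y.2) * ψBC l (y.1, z.2) * ψCA l (z.1, x.2))

/-! ### Local operations, classical communication and distillation -/

/-- Finite-round LOCC channels from `A ⊗ B` to `aOut ⊗ bOut`.  A protocol stops, or one of the two
parties makes a local measurement with finitely many outcomes `k` and Kraus operators `K k`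
(the new local system may depend on `k`), announces `k`, and the parties go on with an LOCC
protocol that may depend on `k`. -/
inductive IsLOCC {aOut bOut : Type} :
    ∀ {a b : Type} [Fintype a] [DecidableEq a] [Fintype b] [DecidableEq b],
      (Matrix (a × b) (a × b) ℂ → Matrix (aOut × bOut) (aOut × bOut) ℂ) → Prop
  | stop_here [Fintype aOut] [DecidableEq aOut] [Fintype bOut] [DecidableEq bOut] :
      IsLOCC (a := aOut) (b := bOut) (fun ρ => ρ)
  | alice {a b : Type} [Fintype a] [DecidableEq a] [Fintype b] [DecidableEq b]
      {κ : Type} [Fintype κ] (a₁ : κ → Type) [∀ k, Fintype (a₁ k)] [∀ k, DecidableEq (a₁ k)]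
      (K : ∀ k, Matrix (a₁ k) a ℂ) (hK : ∑ k, (K k)ᴴ * K k = 1)
      (Λ : ∀ k, Matrix (a₁ k × b) (a₁ k × b) ℂ → Matrix (aOut × bOut) (aOut × bOut) ℂ)
      (hΛ : ∀ k, IsLOCC (Λ k)) :
      IsLOCC (a := a) (b := b) (fun ρ => ∑ k, Λ k
        ((K k ⊗ₖ (1 : Matrix b b ℂ)) * ρ * (K k ⊗ₖ (1 : Matrix b b ℂ))ᴴ))
  | bob {a b : Type} [Fintype a] [DecidableEq a] [Fintype b] [DecidableEq b]
      {κ : Type} [Fintype κ] (b₁ : κ → Type) [∀ k, Fintype (b₁ k)] [∀ k, DecidableEq (b₁ k)]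
      (K : ∀ k, Matrix (b₁ k) b ℂ) (hK : ∑ k, (K k)ᴴ * K k = 1)
      (Λ : ∀ k, Matrix (a × b₁ k) (a × b₁ k) ℂ → Matrix (aOut × bOut) (aOut × bOut) ℂ)
      (hΛ : ∀ k, IsLOCC (Λ k)) :
      IsLOCC (a := a) (b := b) (fun ρ => ∑ k, Λ k
        (((1 : Matrix a a ℂ) ⊗ₖ K k) * ρ * ((1 : Matrix a a ℂ) ⊗ₖ K k)ᴴ))

/-- `n` copies `ρ^{⊗ n}`, as a bipartite operator on `A^{⊗ n} ⊗ B^{⊗ n}`. -/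
def copies {a b : Type} (ρ : Matrix (a × b) (a × b) ℂ) (n : ℕ) :
    Matrix ((Fin n → a) × (Fin n → b)) ((Fin n → a) × (Fin n → b)) ℂ :=
  fun x y => ∏ i, ρ (x.1 i, x.2 i) (y.1 i, y.2 i)

/-- `m` Bell pairs `((|00⟩ + |11⟩) / √2)^{⊗ m}`, each party holding one qubit of every pair. -/
def bellPairs (m : ℕ) : (Fin m → Fin 2) × (Fin m → Fin 2) → ℂ :=
  fun x => ∏ i, if x.1 i = x.2 i then ((Real.sqrt 2)⁻¹ : ℂ) else 0

/-- The fidelity `⟨φ|σ|φ⟩` of `σ` with the pure state `φ`. -/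
def fidelityWith {x : Type} [Fintype x] (φ : x → ℂ) (σ : Matrix x x ℂ) : ℝ :=
  (star φ ⬝ᵥ (σ *ᵥ φ)).re

/-- `R` is an achievable rate of distilling Bell pairs: LOCC protocols turn `n` copies of `ρ` into
at least `R * n` Bell pairs, with a fidelity that tends to one as `n → ∞`. -/
def IsAchievableRate {a b : Type} [Fintype a] [DecidableEq a] [Fintype b] [DecidableEq b]
    (ρ : Matrix (a × b) (a × b) ℂ) (R : ℝ) : Prop :=
  ∃ (m : ℕ → ℕ)
    (Λ : ∀ n, Matrix ((Fin n → a) × (Fin n → b)) ((Fin n → a) × (Fin n → b)) ℂ →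
      Matrix ((Fin (m n) → Fin 2) × (Fin (m n) → Fin 2))
        ((Fin (m n) → Fin 2) × (Fin (m n) → Fin 2)) ℂ),
    (∀ n, IsLOCC (Λ n)) ∧
    (∀ᶠ n : ℕ in Filter.atTop, R * n ≤ m n) ∧
    Filter.Tendsto (fun n => fidelityWith (bellPairs (m n)) (Λ n (copies ρ n)))
      Filter.atTop (𝓝 1)

/-- Distillable states: the distillable entanglement, i.e. the supremum of the achievable rates,
is positive. -/
def IsDistillable {a b : Type} [Fintype a] [DecidableEq a] [Fintype b] [DecidableEq b]
    (ρ : Matrix (a × b) (a × b) ℂ) : Prop :=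
  ∃ R : ℝ, 0 < R ∧ IsAchievableRate ρ R

/-- Bound entangled states: entangled states that are not distillable. -/
def IsBoundEntangled {a b : Type} [Fintype a] [DecidableEq a] [Fintype b] [DecidableEq b]
    (ρ : Matrix (a × b) (a × b) ℂ) : Prop :=
  IsEntangled ρ ∧ ¬ IsDistillable ρ

end Quantum

end

/-!
The Markov gap of `ρ_AB` is the conditional mutual information `I(A : B̄ | B)` of its canonical
purification, so it is nonnegative by strong subadditivity, and the theorem is about the case of
equality.

**Strong subadditivity and equality.** For `T > 0` the functional
`X ↦ 2 Re Tr X ρ - Tr σ X X† - T Tr X† X ρ` is maximized by the solutions of the Sylvester equation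
`σ X + T X ρ = ρ`, and its maximum is the derivative in `T` of a function that interpolates between
the two parts `Tr ρ log σ` and `Tr ρ log ρ` of the relative entropy. Operators `X ⊗ 1` give the same
value on a bipartite system as `X` on the subsystem, so partial traces decrease the maximum, hence
the relative entropy (`data_processing`). If the Markov gap vanishes, then for every `T` the
maximizer for `A B` is, tensored with the identity, also one for `A B B̄`
(`markovGap_nonneg_and_sylvester`). Combining the resulting equations over different `T`, so that
the resolvents `x ↦ 1 / (x + T)` add up to `x ↦ x ^ (-1/2)` on a finite spectrum, gives the
factorization `ρ = √ρ_B Q √ρ_A`, where the realignment of the Hermitian operator `Q` is a partial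
isometry (`exists_factorization`).

**Zero gap implies triangle structure.** The factorization shows that the operators `X` on `A` for
which some `Y` on `B` satisfies `(X ⊗ 1) ρ = (1 ⊗ Y) ρ` form a *-algebra that is invariant under
`X ↦ ρ_A X ρ_A⁻¹` (`partnerAlgebra`, `IsFactorization.conjTranspose_mem`,
`IsFactorization.modular_mem`) and is large enough to contain, up to a factor `ρ_A`, all slices of
`ρ`. It has a system of matrix units on which the modular automorphism acts by scalars
(`IsModularAlgebra.exists_matrixUnits`). The simple summands of the algebra give the blocks, the
matrix units give the factors `A₁` and, through the partners `Y`, `B₂`, which share a pure state.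
The corner of `ρ` at a minimal projection is a product operator (`IsFactorization.corner_eq_kron`),
so what remains of `A` and of `B` is correlated only with two separate factors of `C`
(`isSOTS_of_markovGap_eq_zero`).

**Triangle structure implies zero gap.** After Schmidt decompositions all the states involved are
diagonal in explicit product bases (`IsTriangleMixture`), and the entropies can be compared term by
term (`IsTriangleMixture.markovGap_eq_zero`).

**Distillation.** If every state `ψ^l_{A₁B₂}` of positive weight has Schmidt rank one, then `ρ_AB`
is a mixture of product states. Otherwise local measurements that project on two Schmidt vectors and
equalize their coefficients produce a Bell pair with positive probability
(`IsTriangleMixture.filter_eq`). Doing this on each of many copies and keeping only successful pairs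
distills at a positive rate, with a failure probability bounded by a Chernoff estimate
(`isDistillable_of_filter`).

A bound entangled state with zero gap would, by purification, be the marginal of a sum of triangle
states, hence distillable; so its gap is positive.
-/

open scoped Matrix Kronecker Topology ComplexOrder

noncomputable section

namespace Quantum

open Matrix

set_option linter.unusedSectionVars false

/-! ### Spectral decompositions and entropies -/

section Entropy

variable {m n : Type} [Fintype m] [DecidableEq m] [Fintype n] [DecidableEq n]

/-- The spectral theorem as an equation between matrices, with the functional calculus expressed
through the same diagonalizing unitary. -/
lemma exists_spectral {M : Matrix n n ℂ} (hM : M.IsHermitian) :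
    ∃ (U : Matrix n n ℂ) (d : n → ℝ), Uᴴ * U = 1 ∧ U * Uᴴ = 1 ∧
      M = U * diagonal (fun i => (d i : ℂ)) * Uᴴ ∧
      ∀ f : ℝ → ℝ, cfc f M = U * diagonal (fun i => (f (d i) : ℂ)) * Uᴴ := by
  refine ⟨hM.eigenvectorUnitary, hM.eigenvalues, ?_, ?_, ?_, ?_⟩
  · exact Unitary.coe_star_mul_self hM.eigenvectorUnitary
  · exact Unitary.coe_mul_star_self hM.eigenvectorUnitary
  · conv_lhs => rw [hM.spectral_theorem, Unitary.conjStarAlgAut_apply]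
    rfl
  · intro f
    rw [hM.cfc_eq, Matrix.IsHermitian.cfc, Unitary.conjStarAlgAut_apply]
    rfl

lemma exists_spectral_nonneg {M : Matrix n n ℂ} (hM : M.PosSemidef) :
    ∃ (U : Matrix n n ℂ) (d : n → ℝ), Uᴴ * U = 1 ∧ U * Uᴴ = 1 ∧ (∀ i, 0 ≤ d i) ∧
      M = U * diagonal (fun i => (d i : ℂ)) * Uᴴ ∧
      ∀ f : ℝ → ℝ, cfc f M = U * diagonal (fun i => (f (d i) : ℂ)) * Uᴴ := by
  obtain ⟨U, d, h1, h2, h3, h4⟩ := exists_spectral hM.isHermitian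
  refine ⟨U, d, h1, h2, ?_, h3, h4⟩
  have h5 : Uᴴ * M * U = diagonal (fun i => (d i : ℂ)) := by
    rw [h3]
    calc Uᴴ * (U * diagonal (fun i => (d i : ℂ)) * Uᴴ) * U
        = (Uᴴ * U) * diagonal (fun i => (d i : ℂ)) * (Uᴴ * U) := by simp only [Matrix.mul_assoc]
      _ = _ := by rw [h1]; simp
  have h6 := hM.conjTranspose_mul_mul_same U
  rw [h5, posSemidef_diagonal_iff] at h6
  intro i
  exact_mod_cast h6 i

lemma entropy_eq_sum_roots {M : Matrix n n ℂ} (hM : M.IsHermitian) :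
    entropy M = (M.charpoly.roots.map (fun z => Real.negMulLog z.re)).sum := by
  rw [entropy, dif_pos hM, hM.roots_charpoly_eq_eigenvalues]
  simp

/-- Products in the two orders have the same nonzero spectrum, hence the same entropy. -/
lemma entropy_mul_comm (A : Matrix m n ℂ) (B : Matrix n m ℂ) (hAB : (A * B).IsHermitian)
    (hBA : (B * A).IsHermitian) : entropy (A * B) = entropy (B * A) := by
  rw [entropy_eq_sum_roots hAB, entropy_eq_sum_roots hBA]
  have h := congrArg (fun p => (p.roots.map (fun z : ℂ => Real.negMulLog z.re)).sum)
    (charpoly_mul_comm' A B)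
  have hA : (A * B).charpoly ≠ 0 := (charpoly_monic _).ne_zero
  have hB : (B * A).charpoly ≠ 0 := (charpoly_monic _).ne_zero
  have hX : ∀ k : ℕ, (Polynomial.X ^ k : Polynomial ℂ) ≠ 0 := fun k =>
    pow_ne_zero _ Polynomial.X_ne_zero
  simpa [Polynomial.roots_mul (mul_ne_zero (hX _) hA),
    Polynomial.roots_mul (mul_ne_zero (hX _) hB), Multiset.map_nsmul, Multiset.sum_nsmul] using h

lemma isHermitian_diagonal_ofReal (d : n → ℝ) :
    (diagonal (fun i => (d i : ℂ))).IsHermitian := by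
  rw [IsHermitian, diagonal_conjTranspose]
  congr 1
  ext i
  simp

lemma entropy_diagonal (d : n → ℝ) :
    entropy (diagonal (fun i => (d i : ℂ))) = ∑ i, Real.negMulLog (d i) := by
  rw [entropy_eq_sum_roots (isHermitian_diagonal_ofReal d), charpoly_diagonal,
    Polynomial.roots_prod]
  · simp
  · simp [Finset.prod_ne_zero_iff, Polynomial.X_sub_C_ne_zero]

lemma isHermitian_conj (V : Matrix m n ℂ) {D : Matrix n n ℂ} (hD : D.IsHermitian) :
    (V * D * Vᴴ).IsHermitian :=
  isHermitian_mul_mul_conjTranspose V hD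

/-- The entropy of a matrix with explicit spectral decomposition over an orthonormal family that
need not be complete. -/
lemma entropy_isometry_diagonal (V : Matrix m n ℂ) (hV : Vᴴ * V = 1) (d : n → ℝ) :
    entropy (V * diagonal (fun i => (d i : ℂ)) * Vᴴ) = ∑ i, Real.negMulLog (d i) := by
  have h : Vᴴ * (V * diagonal (fun i => (d i : ℂ))) = diagonal (fun i => (d i : ℂ)) := by
    rw [← Matrix.mul_assoc, hV, Matrix.one_mul]
  rw [entropy_mul_comm, h, entropy_diagonal]
  · exact isHermitian_conj V (isHermitian_diagonal_ofReal d)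
  · rw [h]
    exact isHermitian_diagonal_ofReal d

end Entropy

/-! ### Monotonicity of the relative entropy under partial traces, with its equality case -/

section Sylvester

variable {n I J : Type} [Fintype n] [DecidableEq n] [Fintype I] [DecidableEq I]
  [Fintype J] [DecidableEq J]

/-- The concave quadratic functional of `X` whose critical points are the solutions of the
Sylvester equation `σ X + T X ρ = ρ`. -/
def sylvesterFunctional (ρ σ X : Matrix n n ℂ) (T : ℝ) : ℝ :=
  2 * (X * ρ).trace.re - (σ * X * Xᴴ).trace.re - T * (Xᴴ * X * ρ).trace.re

/-- The maximum of `sylvesterFunctional`, in terms of the eigenvalues `r` of `ρ`, the eigenvalues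
`s` of `σ` and the overlaps `D` of their eigenvectors. -/
def sylvesterMax (D : Matrix J I ℂ) (r : I → ℝ) (s : J → ℝ) (T : ℝ) : ℝ :=
  ∑ j, ∑ i, ‖D j i‖ ^ 2 * (r i ^ 2 / (s j + T * r i))

/-- An antiderivative of `sylvesterMax` in the parameter `T`. -/
def sylvesterPotential (D : Matrix J I ℂ) (r : I → ℝ) (s : J → ℝ) (T : ℝ) : ℝ :=
  ∑ j, ∑ i, ‖D j i‖ ^ 2 * (r i * Real.log (s j + T * r i))

/-- Completion of the square in one matrix entry. If `c = 0` then both sides vanish, in accordance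
with the convention `r ^ 2 / 0 = 0`. -/
lemma complete_square (x d : ℂ) {r c : ℝ} (h : c = 0 → r = 0) :
    2 * (x * (r : ℂ) * star d).re - c * ‖x‖ ^ 2 =
      ‖d‖ ^ 2 * (r ^ 2 / c) - c * ‖x - ((r / c : ℝ) : ℂ) * d‖ ^ 2 := by
  rw [← Complex.normSq_eq_norm_sq, ← Complex.normSq_eq_norm_sq, ← Complex.normSq_eq_norm_sq]
  by_cases hc : c = 0
  · simp [hc, h hc]
  · simp only [Complex.normSq_apply, Complex.mul_re, Complex.sub_re, Complex.sub_im, Complex.mul_im,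
      Complex.ofReal_re, Complex.ofReal_im, Complex.star_def, Complex.conj_re, Complex.conj_im]
    field_simp
    ring

variable {U : Matrix n I ℂ} {V : Matrix n J ℂ} {r : I → ℝ} {s : J → ℝ}

/-- In the eigenbases of `ρ` and `σ` the functional is a sum over the matrix entries of `X`. -/
lemma sylvesterFunctional_eq_sum (hU : U * Uᴴ = 1) (hV : V * Vᴴ = 1) (X : Matrix n n ℂ)
    (T : ℝ) :
    sylvesterFunctional (U * diagonal (fun i => (r i : ℂ)) * Uᴴ)
        (V * diagonal (fun i => (s i : ℂ)) * Vᴴ) X T =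
      ∑ j, ∑ i, (2 * ((Vᴴ * X * U) j i * (r i : ℂ) * star ((Vᴴ * U) j i)).re -
        (s j + T * r i) * ‖(Vᴴ * X * U) j i‖ ^ 2) := by
  have h1 : (X * (U * diagonal (fun i => (r i : ℂ)) * Uᴴ)).trace =
      ∑ j, ∑ i, (Vᴴ * X * U) j i * (r i : ℂ) * star ((Vᴴ * U) j i) := by
    calc (X * (U * diagonal (fun i => (r i : ℂ)) * Uᴴ)).trace
        = ((V * Vᴴ) * (X * (U * diagonal (fun i => (r i : ℂ)) * Uᴴ))).trace := by
          rw [hV, Matrix.one_mul]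
      _ = ((Vᴴ * X * U) * diagonal (fun i => (r i : ℂ)) * (Vᴴ * U)ᴴ).trace := by
          rw [Matrix.mul_assoc, trace_mul_comm]
          simp only [Matrix.mul_assoc, conjTranspose_mul, conjTranspose_conjTranspose]
      _ = _ := by
          simp only [trace, diag_apply]
          refine Finset.sum_congr rfl fun j _ => ?_
          rw [Matrix.mul_apply]
          simp only [mul_diagonal, conjTranspose_apply]
  have h2 : ((V * diagonal (fun i => (s i : ℂ)) * Vᴴ) * X * Xᴴ).trace =
      ∑ j, ∑ i, ((s j * ‖(Vᴴ * X * U) j i‖ ^ 2 : ℝ) : ℂ) := by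
    calc ((V * diagonal (fun i => (s i : ℂ)) * Vᴴ) * X * Xᴴ).trace
        = (V * (diagonal (fun i => (s i : ℂ)) * Vᴴ * X * (U * Uᴴ) * Xᴴ)).trace := by
          rw [hU, Matrix.mul_one]
          simp only [Matrix.mul_assoc]
      _ = (diagonal (fun i => (s i : ℂ)) * ((Vᴴ * X * U) * (Vᴴ * X * U)ᴴ)).trace := by
          rw [trace_mul_comm]
          simp only [Matrix.mul_assoc, conjTranspose_mul, conjTranspose_conjTranspose]
      _ = _ := by
          simp only [trace, diag_apply, diagonal_mul]
          refine Finset.sum_congr rfl fun j _ => ?_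
          rw [Matrix.mul_apply, Finset.mul_sum]
          refine Finset.sum_congr rfl fun i _ => ?_
          rw [conjTranspose_apply, Complex.star_def, Complex.mul_conj, Complex.normSq_eq_norm_sq]
          push_cast
          ring
  have h3 : (Xᴴ * X * (U * diagonal (fun i => (r i : ℂ)) * Uᴴ)).trace =
      ∑ j, ∑ i, ((r i * ‖(Vᴴ * X * U) j i‖ ^ 2 : ℝ) : ℂ) := by
    calc (Xᴴ * X * (U * diagonal (fun i => (r i : ℂ)) * Uᴴ)).trace
        = (Xᴴ * (V * Vᴴ) * X * U * diagonal (fun i => (r i : ℂ)) * Uᴴ).trace := by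
          rw [hV, Matrix.mul_one]
          simp only [Matrix.mul_assoc]
      _ = ((Vᴴ * X * U)ᴴ * (Vᴴ * X * U) * diagonal (fun i => (r i : ℂ))).trace := by
          rw [trace_mul_comm]
          simp only [Matrix.mul_assoc, conjTranspose_mul, conjTranspose_conjTranspose]
      _ = _ := by
          simp only [trace, diag_apply, mul_diagonal]
          rw [Finset.sum_comm]
          refine Finset.sum_congr rfl fun j _ => ?_
          rw [Matrix.mul_apply, Finset.sum_mul]
          refine Finset.sum_congr rfl fun i _ => ?_
          rw [conjTranspose_apply, Complex.star_def, mul_comm (starRingEnd ℂ _), Complex.mul_conj,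
            Complex.normSq_eq_norm_sq]
          push_cast
          ring
  rw [sylvesterFunctional, h1, h2, h3]
  simp only [Complex.re_sum, Complex.ofReal_re, Finset.mul_sum, ← Finset.sum_sub_distrib]
  refine Finset.sum_congr rfl fun j _ => Finset.sum_congr rfl fun i _ => ?_
  ring

/-- The summands of `sylvesterMax` with vanishing denominator have vanishing numerator. -/
lemma sylvester_denominator_eq_zero (hr : ∀ i, 0 ≤ r i) (hs : ∀ j, 0 ≤ s j) {T : ℝ} (hT : 0 < T)
    (j : J) (i : I) (h : s j + T * r i = 0) : r i = 0 := by
  have h1 := mul_nonneg hT.le (hr i)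
  have h2 : T * r i = 0 := le_antisymm (by linarith [hs j]) h1
  rcases mul_eq_zero.mp h2 with h3 | h3
  · exact absurd h3 hT.ne'
  · exact h3

lemma sylvesterFunctional_eq_max_sub (hU : U * Uᴴ = 1) (hV : V * Vᴴ = 1) (hr : ∀ i, 0 ≤ r i)
    (hs : ∀ j, 0 ≤ s j) (X : Matrix n n ℂ) {T : ℝ} (hT : 0 < T) :
    sylvesterFunctional (U * diagonal (fun i => (r i : ℂ)) * Uᴴ)
        (V * diagonal (fun i => (s i : ℂ)) * Vᴴ) X T =
      sylvesterMax (Vᴴ * U) r s T - ∑ j, ∑ i, (s j + T * r i) *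
        ‖(Vᴴ * X * U) j i - ((r i / (s j + T * r i) : ℝ) : ℂ) * (Vᴴ * U) j i‖ ^ 2 := by
  rw [sylvesterFunctional_eq_sum hU hV, sylvesterMax, ← Finset.sum_sub_distrib]
  refine Finset.sum_congr rfl fun j _ => ?_
  rw [← Finset.sum_sub_distrib]
  exact Finset.sum_congr rfl fun i _ =>
    complete_square _ _ (sylvester_denominator_eq_zero hr hs hT j i)

lemma sylvester_denominator_nonneg (hr : ∀ i, 0 ≤ r i) (hs : ∀ j, 0 ≤ s j) {T : ℝ} (hT : 0 < T)
    (j : J) (i : I) : 0 ≤ s j + T * r i :=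
  add_nonneg (hs j) (mul_nonneg hT.le (hr i))

lemma sylvesterFunctional_le_max (hU : U * Uᴴ = 1) (hV : V * Vᴴ = 1) (hr : ∀ i, 0 ≤ r i)
    (hs : ∀ j, 0 ≤ s j) (X : Matrix n n ℂ) {T : ℝ} (hT : 0 < T) :
    sylvesterFunctional (U * diagonal (fun i => (r i : ℂ)) * Uᴴ)
        (V * diagonal (fun i => (s i : ℂ)) * Vᴴ) X T ≤ sylvesterMax (Vᴴ * U) r s T := by
  rw [sylvesterFunctional_eq_max_sub hU hV hr hs X hT]
  have : 0 ≤ ∑ j, ∑ i, (s j + T * r i) *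
        ‖(Vᴴ * X * U) j i - ((r i / (s j + T * r i) : ℝ) : ℂ) * (Vᴴ * U) j i‖ ^ 2 :=
    Finset.sum_nonneg fun j _ => Finset.sum_nonneg fun i _ =>
      mul_nonneg (sylvester_denominator_nonneg hr hs hT j i) (by positivity)
  linarith

/-- A maximizer of the functional solves the Sylvester equation. -/
lemma sylvester_eq_of_eq_max (hU : U * Uᴴ = 1) (hV : V * Vᴴ = 1) (hr : ∀ i, 0 ≤ r i)
    (hs : ∀ j, 0 ≤ s j) (X : Matrix n n ℂ) {T : ℝ} (hT : 0 < T)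
    (h : sylvesterFunctional (U * diagonal (fun i => (r i : ℂ)) * Uᴴ)
        (V * diagonal (fun i => (s i : ℂ)) * Vᴴ) X T = sylvesterMax (Vᴴ * U) r s T) :
    (V * diagonal (fun i => (s i : ℂ)) * Vᴴ) * X +
      (T : ℂ) • (X * (U * diagonal (fun i => (r i : ℂ)) * Uᴴ)) =
        U * diagonal (fun i => (r i : ℂ)) * Uᴴ := by
  rw [sylvesterFunctional_eq_max_sub hU hV hr hs X hT, sub_eq_self] at h
  have hnn : ∀ j i, 0 ≤ (s j + T * r i) *
      ‖(Vᴴ * X * U) j i - ((r i / (s j + T * r i) : ℝ) : ℂ) * (Vᴴ * U) j i‖ ^ 2 := fun j i =>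
    mul_nonneg (sylvester_denominator_nonneg hr hs hT j i) (by positivity)
  rw [Finset.sum_eq_zero_iff_of_nonneg fun j _ => Finset.sum_nonneg fun i _ => hnn j i] at h
  have key : diagonal (fun i => (s i : ℂ)) * (Vᴴ * X * U) +
      (T : ℂ) • ((Vᴴ * X * U) * diagonal (fun i => (r i : ℂ))) =
      (Vᴴ * U) * diagonal (fun i => (r i : ℂ)) := by
    ext j i
    have h1 := (Finset.sum_eq_zero_iff_of_nonneg fun i _ => hnn j i).mp (h j (Finset.mem_univ j)) i
      (Finset.mem_univ i)
    rw [Matrix.add_apply, Matrix.smul_apply, diagonal_mul, mul_diagonal, mul_diagonal, smul_eq_mul]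
    generalize (Vᴴ * X * U) j i = x at *
    generalize (Vᴴ * U) j i = d at *
    have h0 := sylvester_denominator_eq_zero hr hs hT j i
    rcases mul_eq_zero.mp h1 with h2 | h2
    · have h3 : s j = 0 := by rw [h0 h2] at h2; linarith
      simp [h3, h0 h2]
    · by_cases h4 : s j + T * r i = 0
      · have h3 : s j = 0 := by rw [h0 h4] at h4; linarith
        simp [h3, h0 h4]
      · rw [pow_eq_zero_iff two_ne_zero, norm_eq_zero, sub_eq_zero] at h2
        rw [h2]
        have h5 : (s j : ℂ) + T * r i ≠ 0 := by exact_mod_cast h4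
        push_cast
        linear_combination d * mul_div_cancel₀ (r i : ℂ) h5
  calc _ = V * (diagonal (fun i => (s i : ℂ)) * (Vᴴ * X * U) +
      (T : ℂ) • ((Vᴴ * X * U) * diagonal (fun i => (r i : ℂ)))) * Uᴴ := by
        rw [Matrix.mul_add, Matrix.add_mul, Matrix.mul_smul, Matrix.smul_mul]
        congr 1
        · calc _ = V * diagonal (fun i => (s i : ℂ)) * Vᴴ * X * (U * Uᴴ) := by
                rw [hU, Matrix.mul_one]
            _ = _ := by simp only [Matrix.mul_assoc]
        · calc _ = (T : ℂ) • ((V * Vᴴ) * X * (U * diagonal (fun i => (r i : ℂ)) * Uᴴ)) := by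
                rw [hV, Matrix.one_mul]
            _ = _ := by simp only [Matrix.mul_assoc]
    _ = (V * Vᴴ) * (U * diagonal (fun i => (r i : ℂ)) * Uᴴ) := by
        rw [key]; simp only [Matrix.mul_assoc]
    _ = _ := by rw [hV, Matrix.one_mul]

lemma exists_sylvester_max (hU : U * Uᴴ = 1) (hU' : Uᴴ * U = 1) (hV : V * Vᴴ = 1)
    (hV' : Vᴴ * V = 1) (hr : ∀ i, 0 ≤ r i) (hs : ∀ j, 0 ≤ s j) {T : ℝ} (hT : 0 < T) :
    ∃ X : Matrix n n ℂ, sylvesterFunctional (U * diagonal (fun i => (r i : ℂ)) * Uᴴ)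
        (V * diagonal (fun i => (s i : ℂ)) * Vᴴ) X T = sylvesterMax (Vᴴ * U) r s T := by
  -- all completed squares vanish at this matrix
  let Y : Matrix J I ℂ := fun j i => ((r i / (s j + T * r i) : ℝ) : ℂ) * (Vᴴ * U) j i
  refine ⟨V * Y * Uᴴ, ?_⟩
  have hY : Vᴴ * (V * Y * Uᴴ) * U = Y := by
    calc Vᴴ * (V * Y * Uᴴ) * U = (Vᴴ * V) * Y * (Uᴴ * U) := by simp only [Matrix.mul_assoc]
      _ = Y := by rw [hV', hU', Matrix.one_mul, Matrix.mul_one]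
  rw [sylvesterFunctional_eq_max_sub hU hV hr hs _ hT, hY]
  simp [Y]

end Sylvester

section Potential

variable {I J : Type} [Fintype I] [Fintype J] {D : Matrix J I ℂ} {r : I → ℝ} {s : J → ℝ}

lemma hasDerivAt_sylvesterPotential (hr : ∀ i, 0 ≤ r i) (hs : ∀ j, 0 ≤ s j) {T : ℝ} (hT : 0 < T) :
    HasDerivAt (sylvesterPotential D r s) (sylvesterMax D r s T) T := by
  unfold sylvesterPotential sylvesterMax
  refine HasDerivAt.fun_sum fun j _ => HasDerivAt.fun_sum fun i _ => HasDerivAt.const_mul _ ?_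
  by_cases h : r i = 0
  · simpa [h] using hasDerivAt_const T (0 : ℝ)
  · have hpos : s j + T * r i ≠ 0 :=
      (add_pos_of_nonneg_of_pos (hs j) (mul_pos hT (lt_of_le_of_ne (hr i) (Ne.symm h)))).ne'
    have h1 : HasDerivAt (fun T => s j + T * r i) (r i) T := by
      simpa using ((hasDerivAt_id T).mul_const (r i)).const_add (s j)
    refine ((h1.log hpos).const_mul (r i)).congr_deriv ?_
    ring

/-- As `T → 0` the potential tends to `Tr ρ log σ`, provided that the support of `σ` contains the
support of `ρ`. -/
lemma tendsto_sylvesterPotential_zero (hs : ∀ j, s j = 0 → ∀ i, ‖D j i‖ ^ 2 * r i = 0) :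
    Filter.Tendsto (sylvesterPotential D r s) (𝓝[>] 0)
      (𝓝 (∑ j, ∑ i, ‖D j i‖ ^ 2 * (r i * Real.log (s j)))) := by
  unfold sylvesterPotential
  refine tendsto_finsetSum _ fun j _ => tendsto_finsetSum _ fun i _ => ?_
  simp only [← mul_assoc]
  by_cases h : s j = 0
  · simp [hs j h i]
  · refine Filter.Tendsto.const_mul _ ?_
    have h1 : Filter.Tendsto (fun T => s j + T * r i) (𝓝[>] 0) (𝓝 (s j)) := by
      have : Continuous fun T : ℝ => s j + T * r i := by fun_prop
      simpa using (this.tendsto 0).mono_left nhdsWithin_le_nhds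
    exact h1.log h

/-- As `T → ∞` the potential diverges like `Tr ρ · log T`; the remainder tends to `Tr ρ log ρ`. -/
lemma tendsto_sylvesterPotential_atTop (hr : ∀ i, 0 ≤ r i) (hs : ∀ j, 0 ≤ s j)
    (hD : ∀ i, ∑ j, ‖D j i‖ ^ 2 = 1) :
    Filter.Tendsto (fun T => sylvesterPotential D r s T - (∑ i, r i) * Real.log T) Filter.atTop
      (𝓝 (∑ i, r i * Real.log (r i))) := by
  have h1 : ∀ f : I → ℝ, ∑ i, f i = ∑ j, ∑ i, ‖D j i‖ ^ 2 * f i := by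
    intro f
    rw [Finset.sum_comm]
    refine Finset.sum_congr rfl fun i _ => ?_
    rw [← Finset.sum_mul, hD i, one_mul]
  rw [h1 (fun i => r i * Real.log (r i))]
  have h2 : ∀ T, sylvesterPotential D r s T - (∑ i, r i) * Real.log T =
      ∑ j, ∑ i, ‖D j i‖ ^ 2 * (r i * (Real.log (s j + T * r i) - Real.log T)) := by
    intro T
    rw [Finset.sum_mul, h1 (fun i => r i * Real.log T), sylvesterPotential,
      ← Finset.sum_sub_distrib]
    refine Finset.sum_congr rfl fun j _ => ?_
    rw [← Finset.sum_sub_distrib]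
    exact Finset.sum_congr rfl fun i _ => by ring
  simp only [h2]
  refine tendsto_finsetSum _ fun j _ => tendsto_finsetSum _ fun i _ =>
    Filter.Tendsto.const_mul _ ?_
  by_cases h : r i = 0
  · simp [h]
  · have hpos : 0 < r i := lt_of_le_of_ne (hr i) (Ne.symm h)
    refine Filter.Tendsto.const_mul _ ?_
    have h3 : Filter.Tendsto (fun T : ℝ => s j / T + r i) Filter.atTop (𝓝 (r i)) := by
      simpa using (Filter.Tendsto.div_atTop (tendsto_const_nhds (x := s j))
        Filter.tendsto_id).add_const (r i)
    refine (h3.log h).congr' ?_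
    filter_upwards [Filter.eventually_gt_atTop 0] with T hT
    rw [← Real.log_div (add_pos_of_nonneg_of_pos (hs j) (mul_pos hT hpos)).ne' hT.ne']
    congr 1
    field_simp

/-- A function on `(0, ∞)` with nonnegative derivative increases from its limit at `0` to its
limit at `∞`; if the two limits agree then the derivative vanishes. -/
lemma limits_of_deriv_nonneg {g g' : ℝ → ℝ} {α β : ℝ}
    (hg : ∀ T, 0 < T → HasDerivAt g (g' T) T) (hg' : ∀ T, 0 < T → 0 ≤ g' T)
    (h0 : Filter.Tendsto g (𝓝[>] 0) (𝓝 α)) (h1 : Filter.Tendsto g Filter.atTop (𝓝 β)) :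
    α ≤ β ∧ (α = β → ∀ T, 0 < T → g' T = 0) := by
  have hmono : MonotoneOn g (Set.Ioi 0) := by
    refine monotoneOn_of_deriv_nonneg (convex_Ioi 0)
      (fun T hT => (hg T hT).continuousAt.continuousWithinAt) ?_ ?_
    · rw [interior_Ioi]
      exact fun T hT => (hg T hT).differentiableAt.differentiableWithinAt
    · rw [interior_Ioi]
      intro T hT
      rw [(hg T hT).deriv]
      exact hg' T hT
  have hα : ∀ T, 0 < T → α ≤ g T := by
    intro T hT
    refine le_of_tendsto h0 ?_
    filter_upwards [Ioo_mem_nhdsGT hT] with S hS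
    exact hmono hS.1 hT hS.2.le
  have hβ : ∀ T, 0 < T → g T ≤ β := by
    intro T hT
    refine ge_of_tendsto h1 ?_
    filter_upwards [Filter.eventually_ge_atTop T] with S hS
    exact hmono hT (lt_of_lt_of_le hT hS) hS
  refine ⟨(hα 1 one_pos).trans (hβ 1 one_pos), fun h T hT => ?_⟩
  have hc : g =ᶠ[𝓝 T] fun _ => α := by
    filter_upwards [Ioi_mem_nhds hT] with S hS
    exact le_antisymm ((hβ S hS).trans h.ge) (hα S hS)
  exact (hg T hT).unique ((hasDerivAt_const T α).congr_of_eventuallyEq hc)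

end Potential

section PartialTrace

variable {x y : Type} [Fintype x] [DecidableEq x] [Fintype y] [DecidableEq y]

lemma trace_traceRight (M : Matrix (x × y) (x × y) ℂ) : (traceRight M).trace = M.trace := by
  simp [trace, traceRight, Fintype.sum_prod_type]

lemma trace_traceLeft (M : Matrix (x × y) (x × y) ℂ) : (traceLeft M).trace = M.trace := by
  simp only [trace, traceLeft, diag_apply, Fintype.sum_prod_type]
  exact Finset.sum_comm

lemma traceRight_mul_kron (M : Matrix (x × y) (x × y) ℂ) (X : Matrix x x ℂ) :
    traceRight (M * (X ⊗ₖ (1 : Matrix y y ℂ))) = traceRight M * X := by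
  ext i j
  simp only [traceRight, Matrix.mul_apply, kroneckerMap_apply, Fintype.sum_prod_type, one_apply,
    mul_ite, mul_one, mul_zero, Finset.sum_ite_eq', Finset.mem_univ, if_true, Finset.sum_mul]
  exact Finset.sum_comm

lemma traceRight_kron_mul (M : Matrix (x × y) (x × y) ℂ) (X : Matrix x x ℂ) :
    traceRight ((X ⊗ₖ (1 : Matrix y y ℂ)) * M) = X * traceRight M := by
  ext i j
  simp only [traceRight, Matrix.mul_apply, kroneckerMap_apply, Fintype.sum_prod_type, one_apply,
    mul_ite, mul_one, mul_zero, ite_mul, zero_mul, Finset.sum_ite_eq, Finset.mem_univ, if_true,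
    Finset.mul_sum]
  exact Finset.sum_comm

lemma traceLeft_mul_kron (M : Matrix (x × y) (x × y) ℂ) (Y : Matrix y y ℂ) :
    traceLeft (M * ((1 : Matrix x x ℂ) ⊗ₖ Y)) = traceLeft M * Y := by
  ext i j
  simp only [traceLeft, Matrix.mul_apply, kroneckerMap_apply, Fintype.sum_prod_type, one_apply,
    ite_mul, one_mul, zero_mul, mul_ite, mul_zero, Finset.sum_mul]
  rw [Finset.sum_comm]
  conv_rhs => rw [Finset.sum_comm]
  rw [Finset.sum_comm]
  refine Finset.sum_congr rfl fun k _ => ?_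
  rw [Finset.sum_comm]
  simp

lemma traceLeft_kron_mul (M : Matrix (x × y) (x × y) ℂ) (Y : Matrix y y ℂ) :
    traceLeft (((1 : Matrix x x ℂ) ⊗ₖ Y) * M) = Y * traceLeft M := by
  ext i j
  simp only [traceLeft, Matrix.mul_apply, kroneckerMap_apply, Fintype.sum_prod_type, one_apply,
    ite_mul, one_mul, zero_mul, Finset.mul_sum]
  conv_rhs => rw [Finset.sum_comm]
  refine Finset.sum_congr rfl fun k _ => ?_
  rw [Finset.sum_comm]
  simp

/-- Operators `X ⊗ 1` cannot distinguish the functional of a bipartite system from that of its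
first subsystem. -/
lemma sylvesterFunctional_kron_one (ρ σ : Matrix (x × y) (x × y) ℂ) (X : Matrix x x ℂ) (T : ℝ) :
    sylvesterFunctional ρ σ (X ⊗ₖ (1 : Matrix y y ℂ)) T =
      sylvesterFunctional (traceRight ρ) (traceRight σ) X T := by
  have h1 : (X ⊗ₖ (1 : Matrix y y ℂ))ᴴ = Xᴴ ⊗ₖ (1 : Matrix y y ℂ) := by
    rw [conjTranspose_kronecker, conjTranspose_one]
  have h2 : ∀ A B : Matrix x x ℂ, (A ⊗ₖ (1 : Matrix y y ℂ)) * (B ⊗ₖ (1 : Matrix y y ℂ)) =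
      (A * B) ⊗ₖ (1 : Matrix y y ℂ) := fun A B => by rw [← mul_kronecker_mul, Matrix.one_mul]
  rw [sylvesterFunctional, sylvesterFunctional, h1, Matrix.mul_assoc σ, h2, h2,
    ← trace_traceRight, ← trace_traceRight (σ * _), ← trace_traceRight ((Xᴴ * X) ⊗ₖ _ * ρ),
    traceRight_mul_kron, traceRight_kron_mul, traceRight_kron_mul, Matrix.mul_assoc (traceRight σ)]

end PartialTrace

section DataProcessing

variable {x y I J I' J' : Type} [Fintype x] [DecidableEq x] [Fintype y] [DecidableEq y]
  [Fintype I] [DecidableEq I] [Fintype J] [DecidableEq J]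
  [Fintype I'] [DecidableEq I'] [Fintype J'] [DecidableEq J']

lemma sum_norm_sq_col {n I : Type} [Fintype n] [Fintype I] [DecidableEq I]
    {D : Matrix n I ℂ} (h : Dᴴ * D = 1) (i : I) : ∑ j, ‖D j i‖ ^ 2 = 1 := by
  have h1 := congrFun (congrFun h i) i
  rw [Matrix.mul_apply, one_apply_eq] at h1
  have h2 : ∀ j, Dᴴ i j * D j i = ((‖D j i‖ ^ 2 : ℝ) : ℂ) := fun j => by
    rw [conjTranspose_apply, Complex.star_def, mul_comm, Complex.mul_conj,
      Complex.normSq_eq_norm_sq]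
  simp only [h2] at h1
  exact_mod_cast h1

/-- The data processing inequality for partial traces, for operators given by their spectral
decompositions: `gap` is the relative entropy of `ρ` and `σ` minus that of their partial traces. In
the case of equality every maximizer for the subsystem stays one after tensoring with the
identity. -/
lemma data_processing {ρ σ : Matrix (x × y) (x × y) ℂ}
    {U : Matrix (x × y) I ℂ} {V : Matrix (x × y) J ℂ} {r : I → ℝ} {s : J → ℝ}
    {U' : Matrix x I' ℂ} {V' : Matrix x J' ℂ} {r' : I' → ℝ} {s' : J' → ℝ}
    (hU : U * Uᴴ = 1) (hU2 : Uᴴ * U = 1) (hV : V * Vᴴ = 1)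
    (hU' : U' * U'ᴴ = 1) (hU2' : U'ᴴ * U' = 1) (hV' : V' * V'ᴴ = 1) (hV2' : V'ᴴ * V' = 1)
    (hr : ∀ i, 0 ≤ r i) (hs : ∀ j, 0 ≤ s j) (hr' : ∀ i, 0 ≤ r' i) (hs' : ∀ j, 0 ≤ s' j)
    (hρ : ρ = U * diagonal (fun i => (r i : ℂ)) * Uᴴ)
    (hσ : σ = V * diagonal (fun i => (s i : ℂ)) * Vᴴ)
    (hρ' : traceRight ρ = U' * diagonal (fun i => (r' i : ℂ)) * U'ᴴ)
    (hσ' : traceRight σ = V' * diagonal (fun i => (s' i : ℂ)) * V'ᴴ)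
    (hsupp : ∀ j, s j = 0 → ∀ i, ‖(Vᴴ * U) j i‖ ^ 2 * r i = 0)
    (hsupp' : ∀ j, s' j = 0 → ∀ i, ‖(V'ᴴ * U') j i‖ ^ 2 * r' i = 0) :
    let gap := (∑ i, r i * Real.log (r i) - ∑ i, r' i * Real.log (r' i)) -
      (∑ j, ∑ i, ‖(Vᴴ * U) j i‖ ^ 2 * (r i * Real.log (s j)) -
        ∑ j, ∑ i, ‖(V'ᴴ * U') j i‖ ^ 2 * (r' i * Real.log (s' j)))
    0 ≤ gap ∧ (gap = 0 → ∀ T : ℝ, 0 < T → ∃ X : Matrix x x ℂ,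
      traceRight σ * X + (T : ℂ) • (X * traceRight ρ) = traceRight ρ ∧
      σ * (X ⊗ₖ (1 : Matrix y y ℂ)) + (T : ℂ) • ((X ⊗ₖ (1 : Matrix y y ℂ)) * ρ) = ρ) := by
  intro gap
  -- the maximizer for the subsystem, tensored with the identity, competes for the whole system
  have hle : ∀ T : ℝ, 0 < T → ∃ X : Matrix x x ℂ,
      sylvesterFunctional (traceRight ρ) (traceRight σ) X T = sylvesterMax (V'ᴴ * U') r' s' T ∧
      sylvesterFunctional ρ σ (X ⊗ₖ (1 : Matrix y y ℂ)) T = sylvesterMax (V'ᴴ * U') r' s' T ∧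
      sylvesterFunctional ρ σ (X ⊗ₖ (1 : Matrix y y ℂ)) T ≤ sylvesterMax (Vᴴ * U) r s T := by
    intro T hT
    obtain ⟨X, hX⟩ := exists_sylvester_max hU' hU2' hV' hV2' hr' hs' hT
    rw [← hρ', ← hσ'] at hX
    refine ⟨X, hX, ?_, ?_⟩
    · rw [sylvesterFunctional_kron_one, hX]
    · rw [hρ, hσ]
      exact sylvesterFunctional_le_max hU hV hr hs _ hT
  have hunit : ∀ i, ∑ j, ‖(Vᴴ * U) j i‖ ^ 2 = 1 := by
    refine sum_norm_sq_col ?_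
    rw [conjTranspose_mul, conjTranspose_conjTranspose, Matrix.mul_assoc, ← Matrix.mul_assoc V, hV,
      Matrix.one_mul, hU2]
  have hunit' : ∀ i, ∑ j, ‖(V'ᴴ * U') j i‖ ^ 2 = 1 := by
    refine sum_norm_sq_col ?_
    rw [conjTranspose_mul, conjTranspose_conjTranspose, Matrix.mul_assoc, ← Matrix.mul_assoc V',
      hV', Matrix.one_mul, hU2']
  -- the traces agree, so that the divergences at infinity of the two potentials cancel
  have htr : ∑ i, r i = ∑ i, r' i := by
    have h1 := trace_traceRight ρ
    have h2 : ∀ {m K : Type} [Fintype m] [DecidableEq m] [Fintype K] [DecidableEq K]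
        (W : Matrix m K ℂ) (d : K → ℝ), Wᴴ * W = 1 →
        (W * diagonal (fun i => (d i : ℂ)) * Wᴴ).trace = ((∑ i, d i : ℝ) : ℂ) := by
      intro m K _ _ _ _ W d hW
      rw [trace_mul_comm, ← Matrix.mul_assoc, hW, Matrix.one_mul, trace_diagonal]
      push_cast
      rfl
    rw [hρ', hρ, h2 U' r' hU2', h2 U r hU2] at h1
    exact_mod_cast h1.symm
  have h0 := (tendsto_sylvesterPotential_zero hsupp).sub (tendsto_sylvesterPotential_zero hsupp')
  have h1 := (tendsto_sylvesterPotential_atTop hr hs hunit).sub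
    (tendsto_sylvesterPotential_atTop hr' hs' hunit')
  simp only [htr, sub_sub_sub_cancel_right] at h1
  -- the difference of the two potentials is monotone, and its limits differ by `gap`
  obtain ⟨h2, h3⟩ := limits_of_deriv_nonneg
    (fun T hT => (hasDerivAt_sylvesterPotential (D := Vᴴ * U) hr hs hT).sub
      (hasDerivAt_sylvesterPotential (D := V'ᴴ * U') hr' hs' hT))
    (fun T hT => by
      obtain ⟨X, _, hX2, hX3⟩ := hle T hT
      exact sub_nonneg.mpr (hX2.ge.trans hX3)) h0 h1
  refine ⟨sub_nonneg.mpr h2, fun hgap T hT => ?_⟩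
  obtain ⟨X, hX1, hX2, _⟩ := hle T hT
  have h4 := h3 (sub_eq_zero.mp hgap).symm T hT
  refine ⟨X, ?_, ?_⟩
  · rw [hρ', hσ'] at hX1 ⊢
    exact sylvester_eq_of_eq_max hU' hV' hr' hs' X hT hX1
  · rw [← sub_eq_zero.mp h4, hρ, hσ] at hX2
    rw [hρ, hσ]
    exact sylvester_eq_of_eq_max hU hV hr hs _ hT hX2

end DataProcessing

/-! ### The Markov gap as a conditional mutual information -/

section CrossEntropy

variable {n m a I : Type} [Fintype n] [DecidableEq n] [Fintype m] [DecidableEq m]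
  [Fintype a] [DecidableEq a] [Fintype I] [DecidableEq I]

/-- The diagonal entries of `ρ` in the basis `V`, from a spectral decomposition of `ρ`. -/
lemma sum_norm_sq_mul_eq (V : Matrix n m ℂ) (U : Matrix n I ℂ) (r : I → ℝ) (j : m) :
    ((∑ i, ‖(Vᴴ * U) j i‖ ^ 2 * r i : ℝ) : ℂ) =
      (Vᴴ * (U * diagonal (fun i => (r i : ℂ)) * Uᴴ) * V) j j := by
  have h1 : Vᴴ * (U * diagonal (fun i => (r i : ℂ)) * Uᴴ) * V =
      ((Vᴴ * U) * diagonal (fun i => (r i : ℂ))) * (Vᴴ * U)ᴴ := by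
    simp only [conjTranspose_mul, conjTranspose_conjTranspose, Matrix.mul_assoc]
  rw [h1, Matrix.mul_apply]
  push_cast
  refine Finset.sum_congr rfl fun i _ => ?_
  rw [mul_diagonal, conjTranspose_apply, Complex.star_def, mul_right_comm, Complex.mul_conj,
    Complex.normSq_eq_norm_sq]
  push_cast
  ring

lemma sum_marginal_eq (e : n ≃ a × m) {ρ : Matrix n n ℂ} {U : Matrix n I ℂ} {r : I → ℝ}
    (hρ : ρ = U * diagonal (fun i => (r i : ℂ)) * Uᴴ) {W : Matrix m m ℂ} {s : m → ℝ}
    (hW : Wᴴ * W = 1)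
    (hs : traceLeft (ρ.submatrix e.symm e.symm) = W * diagonal (fun i => (s i : ℂ)) * Wᴴ) (y : m) :
    ∑ k, ∑ i, ‖((((1 : Matrix a a ℂ) ⊗ₖ W).submatrix e id)ᴴ * U) (k, y) i‖ ^ 2 * r i = s y := by
  have h1 : ((∑ k, ∑ i, ‖((((1 : Matrix a a ℂ) ⊗ₖ W).submatrix e id)ᴴ * U) (k, y) i‖ ^ 2 * r i : ℝ)
      : ℂ) = (s y : ℂ) := by
    rw [Complex.ofReal_sum]
    simp only [sum_norm_sq_mul_eq, ← hρ]
    have h2 : (((1 : Matrix a a ℂ) ⊗ₖ W).submatrix e id)ᴴ * ρ *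
        (((1 : Matrix a a ℂ) ⊗ₖ W).submatrix e id) =
        ((1 : Matrix a a ℂ) ⊗ₖ Wᴴ) * (ρ.submatrix e.symm e.symm * ((1 : Matrix a a ℂ) ⊗ₖ W)) := by
      have h3 : ρ = (ρ.submatrix e.symm e.symm).submatrix e e := by
        simp
      conv_lhs => rw [h3]
      rw [conjTranspose_submatrix, submatrix_mul_equiv, submatrix_mul_equiv, submatrix_id_id,
        conjTranspose_kronecker, conjTranspose_one, Matrix.mul_assoc]
    rw [h2]
    have h4 := traceLeft_kron_mul (ρ.submatrix e.symm e.symm * ((1 : Matrix a a ℂ) ⊗ₖ W)) Wᴴ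
    rw [traceLeft_mul_kron, hs] at h4
    have h5 : Wᴴ * (W * diagonal (fun i => (s i : ℂ)) * Wᴴ * W) =
        diagonal (fun i => (s i : ℂ)) := by
      rw [Matrix.mul_assoc _ Wᴴ W, hW, Matrix.mul_one, ← Matrix.mul_assoc, hW, Matrix.one_mul]
    have h6 := congrFun (congrFun (h4.trans h5) y) y
    rw [diagonal_apply_eq] at h6
    exact h6
  exact_mod_cast h1

/-- The cross entropy of `ρ` relative to `1 ⊗ τ`, with `τ` the marginal of `ρ`, is the entropy
of `τ`. -/
lemma cross_entropy_marginal (e : n ≃ a × m) {ρ : Matrix n n ℂ} {U : Matrix n I ℂ} {r : I → ℝ}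
    (hρ : ρ = U * diagonal (fun i => (r i : ℂ)) * Uᴴ) {W : Matrix m m ℂ} {s : m → ℝ}
    (hW : Wᴴ * W = 1)
    (hs : traceLeft (ρ.submatrix e.symm e.symm) = W * diagonal (fun i => (s i : ℂ)) * Wᴴ) :
    ∑ j : a × m, ∑ i, ‖((((1 : Matrix a a ℂ) ⊗ₖ W).submatrix e id)ᴴ * U) j i‖ ^ 2 *
      (r i * Real.log (s j.2)) = ∑ y, s y * Real.log (s y) := by
  rw [Fintype.sum_prod_type, Finset.sum_comm]
  refine Finset.sum_congr rfl fun y _ => ?_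
  have h := congrArg (· * Real.log (s y)) (sum_marginal_eq e hρ hW hs y)
  simpa only [Finset.sum_mul, mul_assoc] using h

/-- The support of a state is contained in the support of `1 ⊗ τ`, with `τ` its marginal. -/
lemma marginal_support (e : n ≃ a × m) {ρ : Matrix n n ℂ} {U : Matrix n I ℂ} {r : I → ℝ}
    (hr : ∀ i, 0 ≤ r i)
    (hρ : ρ = U * diagonal (fun i => (r i : ℂ)) * Uᴴ) {W : Matrix m m ℂ} {s : m → ℝ}
    (hW : Wᴴ * W = 1)
    (hs : traceLeft (ρ.submatrix e.symm e.symm) = W * diagonal (fun i => (s i : ℂ)) * Wᴴ)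
    (j : a × m) (hj : s j.2 = 0) (i : I) :
    ‖((((1 : Matrix a a ℂ) ⊗ₖ W).submatrix e id)ᴴ * U) j i‖ ^ 2 * r i = 0 := by
  have h1 := sum_marginal_eq e hρ hW hs j.2
  have hnn : ∀ k i, 0 ≤ ‖((((1 : Matrix a a ℂ) ⊗ₖ W).submatrix e id)ᴴ * U) (k, j.2) i‖ ^ 2 * r i :=
    fun k i => mul_nonneg (by positivity) (hr i)
  rw [hj, Finset.sum_eq_zero_iff_of_nonneg fun k _ => Finset.sum_nonneg fun i _ => hnn k i] at h1
  exact (Finset.sum_eq_zero_iff_of_nonneg fun i _ => hnn j.1 i).mp (h1 j.1 (Finset.mem_univ _)) i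
    (Finset.mem_univ i)

lemma one_kron_submatrix_spectral (e : n ≃ a × m) {W : Matrix m m ℂ} (s : m → ℝ)
    (hW : W * Wᴴ = 1) (hW' : Wᴴ * W = 1) :
    ((1 : Matrix a a ℂ) ⊗ₖ W).submatrix e id * (((1 : Matrix a a ℂ) ⊗ₖ W).submatrix e id)ᴴ = 1 ∧
    (((1 : Matrix a a ℂ) ⊗ₖ W).submatrix e id)ᴴ * ((1 : Matrix a a ℂ) ⊗ₖ W).submatrix e id = 1 ∧
    ((1 : Matrix a a ℂ) ⊗ₖ (W * diagonal (fun i => (s i : ℂ)) * Wᴴ)).submatrix e e =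
      ((1 : Matrix a a ℂ) ⊗ₖ W).submatrix e id * diagonal (fun j : a × m => ((s j.2 : ℝ) : ℂ)) *
        (((1 : Matrix a a ℂ) ⊗ₖ W).submatrix e id)ᴴ := by
  have h0 : diagonal (fun j : a × m => ((s j.2 : ℝ) : ℂ)) =
      (1 : Matrix a a ℂ) ⊗ₖ diagonal (fun i => (s i : ℂ)) := by
    rw [← diagonal_one, diagonal_kronecker_diagonal]
    simp
  have h1 : (diagonal (fun j : a × m => ((s j.2 : ℝ) : ℂ))) =
      (diagonal (fun j : a × m => ((s j.2 : ℝ) : ℂ))).submatrix (Equiv.refl _) (Equiv.refl _) := rfl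
  rw [h1, conjTranspose_submatrix, conjTranspose_kronecker, conjTranspose_one]
  have hid : (id : a × m → a × m) = Equiv.refl _ := rfl
  refine ⟨?_, ?_, ?_⟩
  · rw [hid, submatrix_mul_equiv, ← mul_kronecker_mul, hW, Matrix.one_mul, one_kronecker_one,
      submatrix_one_equiv]
  · rw [submatrix_mul_equiv, ← mul_kronecker_mul, hW', Matrix.one_mul, one_kronecker_one,
      submatrix_id_id]
  · rw [hid, submatrix_mul_equiv, submatrix_mul_equiv, h0, ← mul_kronecker_mul, ← mul_kronecker_mul,
      Matrix.one_mul, Matrix.one_mul]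

lemma entropy_eq_neg_sum {M : Matrix n n ℂ} {U : Matrix n I ℂ} {d : I → ℝ} (hU : Uᴴ * U = 1)
    (hM : M = U * diagonal (fun i => (d i : ℂ)) * Uᴴ) :
    entropy M = -∑ i, d i * Real.log (d i) := by
  rw [hM, entropy_isometry_diagonal U hU, ← Finset.sum_neg_distrib]
  simp [Real.negMulLog]

lemma entropy_transpose {M : Matrix n n ℂ} (hM : M.IsHermitian) : entropy Mᵀ = entropy M := by
  rw [entropy_eq_sum_roots hM, entropy_eq_sum_roots hM.transpose, charpoly_transpose]

end CrossEntropy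

section Realign

variable {a b : Type} [Fintype a] [DecidableEq a] [Fintype b] [DecidableEq b]

/-- The realignment of an operator on `A ⊗ B`, as a matrix from operators on `B` to operators on
`A`: its singular value decomposition is the operator Schmidt decomposition. -/
def realign (R : Matrix (a × b) (a × b) ℂ) : Matrix (a × a) (b × b) ℂ :=
  fun p q => R (p.1, q.1) (p.2, q.2)

/-- An operator on `A ⊗ B` as a map from `Ā` to `(A ⊗ B) ⊗ B̄`. -/
def foldRight (R : Matrix (a × b) (a × b) ℂ) : Matrix ((a × b) × b) a ℂ :=
  fun p k => R p.1 (k, p.2)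

lemma foldRight_conjTranspose_mul {R : Matrix (a × b) (a × b) ℂ} :
    (foldRight R)ᴴ * foldRight R = traceRight (Rᴴ * R) := by
  ext i j
  simp only [Matrix.mul_apply, conjTranspose_apply, foldRight, traceRight,
    Fintype.sum_prod_type_right]

lemma traceRight_foldRight {R : Matrix (a × b) (a × b) ℂ} :
    traceRight (foldRight R * (foldRight R)ᴴ) = R * Rᴴ := by
  ext i j
  simp only [Matrix.mul_apply, conjTranspose_apply, foldRight, traceRight,
    Fintype.sum_prod_type_right]

lemma kron_one_mul_foldRight (X R : Matrix (a × b) (a × b) ℂ) :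
    (X ⊗ₖ (1 : Matrix b b ℂ)) * foldRight R = foldRight (X * R) := by
  ext ⟨p, q⟩ k
  simp only [Matrix.mul_apply, kroneckerMap_apply, foldRight, one_apply, mul_ite, mul_one, mul_zero,
    ite_mul, zero_mul, Fintype.sum_prod_type_right (α₂ := b) (α₁ := a × b)]
  rw [Finset.sum_comm]
  simp

lemma foldRight_mul (G : Matrix (a × b) (a × b) ℂ) (Z : Matrix a a ℂ) (i j : a) (k l : b) :
    (foldRight G * Z) ((i, k), l) j =
      (((1 : Matrix a a ℂ) ⊗ₖ Zᵀ) * realign G) (i, j) (k, l) := by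
  simp only [Matrix.mul_apply, kroneckerMap_apply, foldRight, realign, one_apply,
    Fintype.sum_prod_type, transpose_apply, ite_mul, one_mul, zero_mul]
  rw [Finset.sum_comm]
  simp [mul_comm]

lemma kron_submatrix_mul_foldRight (K : Matrix (b × b) (b × b) ℂ)
    (G : Matrix (a × b) (a × b) ℂ) (i j : a) (k l : b) :
    (((1 : Matrix a a ℂ) ⊗ₖ Kᵀ).submatrix (Equiv.prodAssoc a b b) (Equiv.prodAssoc a b b) *
      foldRight G) ((i, k), l) j = (realign G * K) (i, j) (k, l) := by
  rw [Matrix.mul_apply, Matrix.mul_apply, Fintype.sum_prod_type, Fintype.sum_prod_type]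
  simp only [submatrix_apply, kroneckerMap_apply, foldRight, realign, one_apply,
    Fintype.sum_prod_type, transpose_apply, ite_mul, one_mul, zero_mul, Equiv.prodAssoc_apply]
  rw [Finset.sum_comm]
  refine Finset.sum_congr rfl fun x _ => ?_
  rw [Finset.sum_comm]
  refine Finset.sum_congr rfl fun y _ => ?_
  simp [mul_comm]

lemma traceLeft_foldRight (R : Matrix (a × b) (a × b) ℂ) :
    traceLeft ((foldRight R * (foldRight R)ᴴ).submatrix (Equiv.prodAssoc a b b).symm
      (Equiv.prodAssoc a b b).symm) = ((realign R)ᴴ * realign R)ᵀ := by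
  ext ⟨i, j⟩ ⟨k, l⟩
  simp only [Matrix.mul_apply, conjTranspose_apply, foldRight, realign, traceLeft, submatrix_apply,
    transpose_apply, Fintype.sum_prod_type, Equiv.prodAssoc_symm_apply]
  exact Finset.sum_congr rfl fun x _ => Finset.sum_congr rfl fun y _ => mul_comm _ _

lemma traceRight_ketBra_canonicalPurification (ρ : Matrix (a × b) (a × b) ℂ) :
    traceRight (ketBra (canonicalPurification ρ)) =
      realign (cfc Real.sqrt ρ) * (realign (cfc Real.sqrt ρ))ᴴ := rfl

lemma isHermitian_cfc_sqrt {n : Type} [Fintype n] [DecidableEq n] {ρ : Matrix n n ℂ}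
    (hρ : ρ.PosSemidef) (f : ℝ → ℝ) : (cfc f ρ).IsHermitian := by
  obtain ⟨U, d, -, -, -, -, h⟩ := exists_spectral_nonneg hρ
  rw [h f]
  exact isHermitian_conj U (isHermitian_diagonal_ofReal _)

lemma cfc_mul_cfc {n : Type} [Fintype n] [DecidableEq n] {ρ : Matrix n n ℂ}
    (hρ : ρ.IsHermitian) (f g : ℝ → ℝ) : cfc f ρ * cfc g ρ = cfc (fun x => f x * g x) ρ := by
  obtain ⟨U, d, h1, -, -, h⟩ := exists_spectral hρ
  rw [h f, h g, h]
  calc _ = U * diagonal (fun i => (f (d i) : ℂ)) * (Uᴴ * U) * diagonal (fun i => (g (d i) : ℂ)) * Uᴴ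
        := by simp only [Matrix.mul_assoc]
    _ = _ := by
      rw [h1, Matrix.mul_one, Matrix.mul_assoc U, diagonal_mul_diagonal]
      push_cast
      rfl

lemma cfc_congr_nonneg {n : Type} [Fintype n] [DecidableEq n] {ρ : Matrix n n ℂ}
    (hρ : ρ.PosSemidef) {f g : ℝ → ℝ} (h : ∀ x, 0 ≤ x → f x = g x) : cfc f ρ = cfc g ρ := by
  obtain ⟨U, d, -, -, hd, -, h'⟩ := exists_spectral_nonneg hρ
  rw [h' f, h' g]
  simp only [h _ (hd _)]

lemma cfc_sqrt_mul_self {n : Type} [Fintype n] [DecidableEq n] {ρ : Matrix n n ℂ}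
    (hρ : ρ.PosSemidef) : cfc Real.sqrt ρ * cfc Real.sqrt ρ = ρ := by
  rw [cfc_mul_cfc hρ.isHermitian,
    cfc_congr_nonneg hρ (g := fun x => x) (fun x hx => Real.mul_self_sqrt hx)]
  exact cfc_id' ℝ ρ hρ.isHermitian.isSelfAdjoint

lemma posSemidef_traceRight {x y : Type} [Fintype x] [DecidableEq x] [Fintype y] [DecidableEq y]
    {ρ : Matrix (x × y) (x × y) ℂ} (hρ : ρ.PosSemidef) : (traceRight ρ).PosSemidef := by
  have h : traceRight ρ = ∑ k, ρ.submatrix (fun i => (i, k)) (fun i => (i, k)) := by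
    ext i j
    simp [traceRight, Matrix.sum_apply]
  rw [h]
  exact posSemidef_sum _ fun k _ => hρ.submatrix _

lemma posSemidef_traceLeft {x y : Type} [Fintype x] [DecidableEq x] [Fintype y] [DecidableEq y]
    {ρ : Matrix (x × y) (x × y) ℂ} (hρ : ρ.PosSemidef) : (traceLeft ρ).PosSemidef := by
  have h : traceLeft ρ = ∑ k, ρ.submatrix (fun i => (k, i)) (fun i => (k, i)) := by
    ext i j
    simp [traceLeft, Matrix.sum_apply]
  rw [h]
  exact posSemidef_sum _ fun k _ => hρ.submatrix _

/-- The Markov gap is the conditional mutual information `I(A : B̄ | B)` of the canonical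
purification, hence nonnegative by strong subadditivity. If it vanishes, then the maximizers of
the variational problem for `A B` are maximizers for `A B B̄`; the two resulting Sylvester equations
are stated on `A B` and on the realigned operators. -/
theorem markovGap_nonneg_and_sylvester {ρ : Matrix (a × b) (a × b) ℂ} (hρ : ρ.PosSemidef) :
    0 ≤ markovGap ρ ∧ (markovGap ρ = 0 → ∀ T : ℝ, 0 < T → ∃ X : Matrix (a × b) (a × b) ℂ,
      ((1 : Matrix a a ℂ) ⊗ₖ traceLeft ρ) * X + (T : ℂ) • (X * ρ) = ρ ∧
      realign (X * cfc Real.sqrt ρ) * ((realign (cfc Real.sqrt ρ))ᴴ * realign (cfc Real.sqrt ρ)) +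
        (T : ℂ) • (((1 : Matrix a a ℂ) ⊗ₖ (traceRight ρ)ᵀ) * realign (X * cfc Real.sqrt ρ)) =
        ((1 : Matrix a a ℂ) ⊗ₖ (traceRight ρ)ᵀ) * realign (cfc Real.sqrt ρ)) := by
  set R := cfc Real.sqrt ρ with hR
  have hRh : Rᴴ = R := isHermitian_cfc_sqrt hρ _
  have hRR : R * R = ρ := cfc_sqrt_mul_self hρ
  -- the canonical purification as an operator `J` from `Ā` to `A B B̄`: `J Jᴴ` is the state of
  -- `A B B̄`, `Jᴴ J` that of `Ā`, and `Kᵀ` is the state of `B B̄`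
  set J := foldRight R with hJ
  set K := (realign R)ᴴ * realign R with hK
  have hJJ : Jᴴ * J = traceRight ρ := by rw [hJ, foldRight_conjTranspose_mul, hRh, hRR]
  have hρ1 : traceRight (J * Jᴴ) = ρ := by rw [hJ, traceRight_foldRight, hRh, hRR]
  have hKT : Kᵀ.PosSemidef := (posSemidef_conjTranspose_mul_self _).transpose
  obtain ⟨U, r, hU2, hU, hr, hUr, -⟩ :=
    exists_spectral_nonneg (posSemidef_self_mul_conjTranspose J)
  obtain ⟨U', r', hU2', hU', hr', hUr', -⟩ := exists_spectral_nonneg hρ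
  obtain ⟨W, s, hW2, hW, hs, hWs, -⟩ := exists_spectral_nonneg hKT
  obtain ⟨W', s', hW2', hW', hs', hWs', -⟩ := exists_spectral_nonneg (posSemidef_traceLeft hρ)
  obtain ⟨hV, hV2, hσ⟩ := one_kron_submatrix_spectral (Equiv.prodAssoc a b b) s hW hW2
  obtain ⟨hV', hV2', hσ'⟩ := one_kron_submatrix_spectral (Equiv.refl (a × b)) s' hW' hW2'
  rw [← hWs] at hσ
  rw [← hWs'] at hσ'
  have hmarg := (traceLeft_foldRight R).trans hWs
  have hσtr : traceRight (((1 : Matrix a a ℂ) ⊗ₖ Kᵀ).submatrix (Equiv.prodAssoc a b b)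
      (Equiv.prodAssoc a b b)) = (1 : Matrix a a ℂ) ⊗ₖ traceLeft ρ := by
    rw [← traceLeft_foldRight, ← hJ]
    ext ⟨i, j⟩ ⟨k, l⟩
    conv_rhs => rw [← hρ1]
    simp only [traceRight, traceLeft, submatrix_apply, kroneckerMap_apply, Equiv.prodAssoc_apply,
      Equiv.prodAssoc_symm_apply, Finset.mul_sum]
    exact Finset.sum_comm
  -- monotonicity of the relative entropy of `J Jᴴ` and `1 ⊗ Kᵀ` when `B̄` is traced out
  obtain ⟨hnn, heq⟩ := data_processing hU hU2 hV hU' hU2' hV' hV2' hr (fun j => hs j.2) hr'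
    (fun j => hs' j.2) hUr hσ (hρ1.trans hUr') (hσtr.trans hσ')
    (marginal_support _ hr hUr hW2 hmarg) (marginal_support (Equiv.refl (a × b)) hr' hUr' hW2' hWs')
  rw [cross_entropy_marginal _ hUr hW2 hmarg,
    cross_entropy_marginal (Equiv.refl (a × b)) hUr' hW2' hWs'] at hnn heq
  -- `A B B̄` has the entropy of `Ā`, and `A Ā` that of `B B̄`
  have hgap : markovGap ρ = (∑ i, r i * Real.log (r i) - ∑ i, r' i * Real.log (r' i)) -
      (∑ y, s y * Real.log (s y) - ∑ y, s' y * Real.log (s' y)) := by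
    have h1 : entropy (traceRight ρ) = -∑ i, r i * Real.log (r i) := by
      rw [← hJJ, ← entropy_eq_neg_sum hU2 hUr]
      exact entropy_mul_comm _ _ (isHermitian_conjTranspose_mul_self J)
        (isHermitian_mul_conjTranspose_self J)
    have h2 : reflectedEntropy ρ = -∑ y, s y * Real.log (s y) := by
      rw [reflectedEntropy, traceRight_ketBra_canonicalPurification, ← entropy_eq_neg_sum hW2 hWs,
        entropy_transpose (isHermitian_conjTranspose_mul_self _)]
      exact entropy_mul_comm _ _ (isHermitian_mul_conjTranspose_self _)
        (isHermitian_conjTranspose_mul_self _)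
    rw [markovGap, mutualInfo, h1, h2, entropy_eq_neg_sum hU2' hUr', entropy_eq_neg_sum hW2' hWs']
    ring
  rw [← hgap] at hnn heq
  refine ⟨hnn, fun h0 T hT => ?_⟩
  obtain ⟨X, hX1, hX2⟩ := heq h0 T hT
  rw [hσtr, hρ1] at hX1
  refine ⟨X, hX1, ?_⟩
  -- multiplication by `J` and reordering of the tensor factors gives the second equation
  have h3 := congrArg (· * J) hX2
  simp only [Matrix.add_mul, Matrix.smul_mul] at h3
  rw [Matrix.mul_assoc _ (X ⊗ₖ (1 : Matrix b b ℂ)) J, Matrix.mul_assoc _ (J * Jᴴ) J,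
    Matrix.mul_assoc J, hJJ, ← Matrix.mul_assoc (X ⊗ₖ (1 : Matrix b b ℂ)) J, hJ,
    kron_one_mul_foldRight] at h3
  ext ⟨i, j⟩ ⟨k, l⟩
  have h4 := congrFun (congrFun h3 ((i, k), l)) j
  rw [Matrix.add_apply, Matrix.smul_apply, kron_submatrix_mul_foldRight, foldRight_mul,
    foldRight_mul] at h4
  rw [Matrix.add_apply, Matrix.smul_apply]
  exact h4

end Realign

/-! ### Functional calculus of positive matrices -/

section FunctionalCalculus

variable {m n : Type} [Fintype m] [DecidableEq m] [Fintype n] [DecidableEq n]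

/-- The functional calculus may be computed from any spectral decomposition. -/
lemma cfc_eq_of_spectral {M : Matrix n n ℂ} {V : Matrix n m ℂ} {e : m → ℝ} (hV : V * Vᴴ = 1)
    (hV' : Vᴴ * V = 1) (hM : M = V * diagonal (fun i => (e i : ℂ)) * Vᴴ) (f : ℝ → ℝ) :
    cfc f M = V * diagonal (fun i => (f (e i) : ℂ)) * Vᴴ := by
  have hMh : M.IsHermitian := by
    rw [hM]
    exact isHermitian_conj V (isHermitian_diagonal_ofReal e)
  obtain ⟨U, d, hU, hU', hUM, hf⟩ := exists_spectral hMh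
  rw [hf f]
  -- the transition matrix intertwines the two diagonal forms of `M`, hence those of `f M`
  have h1 : diagonal (fun i => (d i : ℂ)) * (Uᴴ * V) =
      (Uᴴ * V) * diagonal (fun i => (e i : ℂ)) := by
    have h2 : Uᴴ * M * V = Uᴴ * M * V := rfl
    conv_lhs at h2 => rw [hUM]
    conv_rhs at h2 => rw [hM]
    calc _ = (Uᴴ * U) * diagonal (fun i => (d i : ℂ)) * Uᴴ * V := by
          rw [hU, Matrix.one_mul, Matrix.mul_assoc]
      _ = Uᴴ * (U * diagonal (fun i => (d i : ℂ)) * Uᴴ) * V := by simp only [Matrix.mul_assoc]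
      _ = _ := h2
      _ = Uᴴ * V * diagonal (fun i => (e i : ℂ)) * (Vᴴ * V) := by simp only [Matrix.mul_assoc]
      _ = _ := by rw [hV', Matrix.mul_one]
  have h3 : diagonal (fun i => (f (d i) : ℂ)) * (Uᴴ * V) =
      (Uᴴ * V) * diagonal (fun i => (f (e i) : ℂ)) := by
    ext i j
    have h4 := congrFun (congrFun h1 i) j
    rw [diagonal_mul, mul_diagonal] at h4 ⊢
    by_cases h5 : (Uᴴ * V) i j = 0
    · simp [h5]
    · rw [mul_comm, mul_right_inj' h5, Complex.ofReal_inj] at h4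
      rw [h4, mul_comm]
  calc _ = U * diagonal (fun i => (f (d i) : ℂ)) * (Uᴴ * (V * Vᴴ)) := by
        rw [hV, Matrix.mul_one]
    _ = U * (diagonal (fun i => (f (d i) : ℂ)) * (Uᴴ * V)) * Vᴴ := by
        simp only [Matrix.mul_assoc]
    _ = (U * Uᴴ) * V * diagonal (fun i => (f (e i) : ℂ)) * Vᴴ := by
        rw [h3]; simp only [Matrix.mul_assoc]
    _ = _ := by rw [hU', Matrix.one_mul]

/-- The positive square root. -/
def matSqrt (M : Matrix n n ℂ) : Matrix n n ℂ := cfc Real.sqrt M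

/-- The inverse of the positive square root on the support, extended by zero; this is what the
convention `0⁻¹ = 0` gives. -/
def matInvSqrt (M : Matrix n n ℂ) : Matrix n n ℂ := cfc (fun x => (Real.sqrt x)⁻¹) M

/-- The orthogonal projection onto the support of a Hermitian matrix. -/
def supportProj (M : Matrix n n ℂ) : Matrix n n ℂ := cfc (fun x : ℝ => if x = 0 then 0 else 1) M

variable {M : Matrix n n ℂ}

lemma cfc_mul_cfc_eq (hM : M.PosSemidef) {f g h : ℝ → ℝ} (H : ∀ x, 0 ≤ x → f x * g x = h x) :
    cfc f M * cfc g M = cfc h M := by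
  rw [cfc_mul_cfc hM.isHermitian, cfc_congr_nonneg hM H]

lemma sqrt_inv_mul_sqrt {x : ℝ} (hx : 0 ≤ x) :
    (Real.sqrt x)⁻¹ * Real.sqrt x = if x = 0 then 0 else 1 := by
  split_ifs with h
  · simp [h]
  · exact inv_mul_cancel₀ (Real.sqrt_ne_zero'.mpr (lt_of_le_of_ne hx (Ne.symm h)))

lemma conjTranspose_matSqrt (hM : M.PosSemidef) : (matSqrt M)ᴴ = matSqrt M :=
  isHermitian_cfc_sqrt hM _

lemma conjTranspose_matInvSqrt (hM : M.PosSemidef) : (matInvSqrt M)ᴴ = matInvSqrt M :=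
  isHermitian_cfc_sqrt hM _

lemma conjTranspose_supportProj (hM : M.PosSemidef) : (supportProj M)ᴴ = supportProj M :=
  isHermitian_cfc_sqrt hM _

lemma matSqrt_mul_self (hM : M.PosSemidef) : matSqrt M * matSqrt M = M := cfc_sqrt_mul_self hM

lemma matInvSqrt_mul_matSqrt (hM : M.PosSemidef) : matInvSqrt M * matSqrt M = supportProj M :=
  cfc_mul_cfc_eq hM fun _ hx => sqrt_inv_mul_sqrt hx

lemma matSqrt_mul_matInvSqrt (hM : M.PosSemidef) : matSqrt M * matInvSqrt M = supportProj M :=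
  cfc_mul_cfc_eq hM fun _ hx => by rw [mul_comm, sqrt_inv_mul_sqrt hx]

lemma supportProj_mul_matSqrt (hM : M.PosSemidef) : supportProj M * matSqrt M = matSqrt M :=
  cfc_mul_cfc_eq hM fun x _ => by by_cases h : x = 0 <;> simp [h]

lemma matSqrt_mul_supportProj (hM : M.PosSemidef) : matSqrt M * supportProj M = matSqrt M :=
  cfc_mul_cfc_eq hM fun x _ => by by_cases h : x = 0 <;> simp [h]

lemma supportProj_mul_matInvSqrt (hM : M.PosSemidef) :
    supportProj M * matInvSqrt M = matInvSqrt M :=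
  cfc_mul_cfc_eq hM fun x _ => by by_cases h : x = 0 <;> simp [h]

lemma matInvSqrt_mul_supportProj (hM : M.PosSemidef) :
    matInvSqrt M * supportProj M = matInvSqrt M :=
  cfc_mul_cfc_eq hM fun x _ => by by_cases h : x = 0 <;> simp [h]

lemma supportProj_mul_self (hM : M.PosSemidef) : supportProj M * supportProj M = supportProj M :=
  cfc_mul_cfc_eq hM fun x _ => by by_cases h : x = 0 <;> simp [h]

lemma supportProj_mul (hM : M.PosSemidef) : supportProj M * M = M := by
  calc supportProj M * M = supportProj M * matSqrt M * matSqrt M := by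
        rw [Matrix.mul_assoc, matSqrt_mul_self hM]
    _ = M := by rw [supportProj_mul_matSqrt hM, matSqrt_mul_self hM]

lemma mul_supportProj (hM : M.PosSemidef) : M * supportProj M = M := by
  calc M * supportProj M = matSqrt M * (matSqrt M * supportProj M) := by
        rw [← Matrix.mul_assoc, matSqrt_mul_self hM]
    _ = M := by rw [matSqrt_mul_supportProj hM, matSqrt_mul_self hM]

/-- If `M E = 0` then the support projection of `M` also annihilates `E`. -/
lemma supportProj_mul_eq_zero (hM : M.PosSemidef) {E : Matrix n m ℂ} (h : M * E = 0) :
    supportProj M * E = 0 := by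
  have h1 : supportProj M = matInvSqrt M * matInvSqrt M * M := by
    calc supportProj M = matInvSqrt M * (matInvSqrt M * matSqrt M * matSqrt M) := by
          rw [matInvSqrt_mul_matSqrt hM, supportProj_mul_matSqrt hM, matInvSqrt_mul_matSqrt hM]
      _ = _ := by rw [Matrix.mul_assoc (matInvSqrt M) (matSqrt M), matSqrt_mul_self hM,
          Matrix.mul_assoc]
  rw [h1, Matrix.mul_assoc, h, Matrix.mul_zero]

lemma mul_supportProj_conjTranspose_mul_self (A : Matrix m n ℂ) :
    A * supportProj (Aᴴ * A) = A := by
  have hp := posSemidef_conjTranspose_mul_self A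
  have h1 : A * (1 - supportProj (Aᴴ * A)) = 0 := by
    rw [← conjTranspose_mul_self_eq_zero, conjTranspose_mul, Matrix.mul_assoc,
      ← Matrix.mul_assoc Aᴴ, Matrix.mul_sub, Matrix.mul_one, mul_supportProj hp, sub_self,
      Matrix.mul_zero]
  rw [Matrix.mul_sub, Matrix.mul_one, sub_eq_zero] at h1
  exact h1.symm

lemma cfc_one_kron {k : Type} [Fintype k] [DecidableEq k] (hM : M.IsHermitian) (f : ℝ → ℝ) :
    cfc f ((1 : Matrix k k ℂ) ⊗ₖ M) = (1 : Matrix k k ℂ) ⊗ₖ cfc f M := by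
  obtain ⟨U, d, hU, hU', hM', hf⟩ := exists_spectral hM
  obtain ⟨h1, h2, h3⟩ := one_kron_submatrix_spectral (Equiv.refl (k × n)) d hU' hU
  obtain ⟨-, -, h4⟩ := one_kron_submatrix_spectral (Equiv.refl (k × n)) (fun i => f (d i)) hU' hU
  rw [← hM'] at h3
  rw [← hf] at h4
  exact (cfc_eq_of_spectral h1 h2 h3 f).trans h4.symm

lemma cfc_transpose (hM : M.IsHermitian) (f : ℝ → ℝ) : cfc f Mᵀ = (cfc f M)ᵀ := by
  obtain ⟨U, d, hU, hU', hM', hf⟩ := exists_spectral hM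
  have hUT : Uᴴᵀᴴ = Uᵀ := by
    ext i j
    simp
  have h : ∀ e : n → ℂ, (U * diagonal e * Uᴴ)ᵀ = Uᴴᵀ * diagonal e * Uᴴᵀᴴ := by
    intro e
    rw [transpose_mul, transpose_mul, diagonal_transpose, Matrix.mul_assoc, hUT]
  rw [hf, h]
  refine cfc_eq_of_spectral ?_ ?_ ((congrArg transpose hM').trans (h _)) f
  · rw [hUT, ← transpose_mul, hU', transpose_one]
  · rw [hUT, ← transpose_mul, hU, transpose_one]

/-- Functional calculus commutes with complex conjugation combined with a permutation of the
basis. -/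
lemma cfc_map_star_submatrix (hM : M.IsHermitian) (e : n ≃ n)
    (h : (M.map star).submatrix e e = M) (f : ℝ → ℝ) :
    ((cfc f M).map star).submatrix e e = cfc f M := by
  obtain ⟨U, d, hU, hU', hM', hf⟩ := exists_spectral hM
  let W : Matrix n n ℂ := (U.map star).submatrix e id
  have hW : ∀ g : n → ℝ, ((U * diagonal (fun i => (g i : ℂ)) * Uᴴ).map star).submatrix e e =
      W * diagonal (fun i => (g i : ℂ)) * Wᴴ := by
    intro g
    ext i j
    rw [submatrix_apply, map_apply, Matrix.mul_apply, Matrix.mul_apply, star_sum]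
    simp only [W, submatrix_apply, map_apply, mul_diagonal, conjTranspose_apply, star_mul', id,
      Complex.star_def, Complex.conj_ofReal]
  have hWW : W * Wᴴ = 1 := by
    have := hW (fun _ => 1)
    simp only [Complex.ofReal_one, diagonal_one, Matrix.mul_one, hU'] at this
    rw [← this]
    ext i j
    simp [one_apply]
  rw [hf, hW]
  conv_rhs => rw [← hf]
  refine (cfc_eq_of_spectral hWW (mul_eq_one_comm.mp hWW) ?_ f).symm
  rw [← hW, ← hM', h]

end FunctionalCalculus

/-! ### Interpolation by resolvents -/

/-- Combinations of the functions `x ↦ 1 / (x + t)`, `t > 0`, take arbitrary values on finite sets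
of positive numbers. -/
lemma exists_resolvent_interpolation (Λ : Finset ℝ) (hΛ : ∀ x ∈ Λ, 0 < x) (g : ℝ → ℝ) :
    ∃ c : {t : ℝ // 0 < t} →₀ ℝ, ∀ x ∈ Λ, c.sum (fun t k => k / (x + t)) = g x := by
  let v : {t : ℝ // 0 < t} → (Λ → ℝ) := fun t x => 1 / (x + t)
  -- otherwise some nonzero functional `φ` would vanish on all the resolvents
  have hspan : Submodule.span ℝ (Set.range v) = ⊤ := by
    by_contra hne
    obtain ⟨φ, hφ0, hφ⟩ := Submodule.exists_le_ker_of_lt_top _ (lt_top_iff_ne_top.mpr hne)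
    let d : Λ → ℝ := fun x => φ (Pi.single x 1)
    have hφd : ∀ f : Λ → ℝ, φ f = ∑ x, f x * d x := by
      intro f
      rw [LinearMap.pi_apply_eq_sum_univ φ f]
      refine Finset.sum_congr rfl fun x _ => ?_
      rw [smul_eq_mul]
      congr 2
      ext y
      simp [Pi.single_apply, eq_comm]
    -- clearing denominators turns the vanishing of `φ` on all resolvents into a polynomial identity
    let p : Polynomial ℝ := ∑ x : Λ, Polynomial.C (d x) *
      ∏ y ∈ Finset.univ.erase x, (Polynomial.X + Polynomial.C (y : ℝ))
    have hp : p = 0 := by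
      refine Polynomial.eq_zero_of_infinite_isRoot p ((Set.Ioi_infinite (0 : ℝ)).mono ?_)
      intro t ht
      have h1 : φ (v ⟨t, ht⟩) = 0 := hφ (Submodule.subset_span ⟨_, rfl⟩)
      rw [hφd] at h1
      have h2 : p.eval t = (∏ y : Λ, (t + y)) * ∑ x : Λ, v ⟨t, ht⟩ x * d x := by
        rw [Finset.mul_sum]
        simp only [p, Polynomial.eval_finsetSum, Polynomial.eval_mul, Polynomial.eval_C,
          Polynomial.eval_prod, Polynomial.eval_add, Polynomial.eval_X]
        refine Finset.sum_congr rfl fun x _ => ?_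
        rw [← Finset.mul_prod_erase Finset.univ (fun y : Λ => t + (y : ℝ)) (Finset.mem_univ x)]
        have h3 : (x : ℝ) + t ≠ 0 := (add_pos (hΛ x x.2) ht).ne'
        simp only [v]
        field_simp
        ring
      rw [Set.mem_ofPred_eq, Polynomial.IsRoot.def, h2, h1, mul_zero]
    refine hφ0 (LinearMap.ext fun f => ?_)
    rw [hφd, LinearMap.zero_apply]
    refine Finset.sum_eq_zero fun x _ => ?_
    -- at `-x` all summands but the one of `x` vanish
    have h4 : p.eval (-(x : ℝ)) = 0 := by rw [hp, Polynomial.eval_zero]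
    simp only [p, Polynomial.eval_finsetSum, Polynomial.eval_mul, Polynomial.eval_C,
      Polynomial.eval_prod, Polynomial.eval_add, Polynomial.eval_X] at h4
    rw [Finset.sum_eq_single x] at h4
    · rcases mul_eq_zero.mp h4 with h5 | h5
      · rw [h5, mul_zero]
      · rw [Finset.prod_eq_zero_iff] at h5
        obtain ⟨y, hy, hy'⟩ := h5
        refine absurd (Subtype.ext ?_) (Finset.ne_of_mem_erase hy)
        linarith
    · intro y _ hyx
      refine mul_eq_zero_of_right _ (Finset.prod_eq_zero (Finset.mem_erase.mpr
        ⟨hyx.symm, Finset.mem_univ x⟩) (by ring))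
    · simp
  have hg : (fun x : Λ => g x) ∈ Submodule.span ℝ (Set.range v) := by
    rw [hspan]; exact Submodule.mem_top
  obtain ⟨c, hc⟩ := Finsupp.mem_span_range_iff_exists_finsupp.mp hg
  refine ⟨c, fun x hx => ?_⟩
  have h := congrFun hc ⟨x, hx⟩
  rw [← h, Finsupp.sum, Finsupp.sum, Finset.sum_apply]
  refine Finset.sum_congr rfl fun t _ => ?_
  simp only [v, Pi.smul_apply, smul_eq_mul]
  ring

section Resolvent

variable {m n : Type} [Fintype m] [DecidableEq m] [Fintype n] [DecidableEq n]

/-- A combination of solutions of the Sylvester equations `S G + t G T = Z T` that interpolates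
`x ↦ x ^ (-1/2)` on the ratios of eigenvalues of `S` and `T` solves `√S H = Z √T`. -/
lemma exists_sqrt_mul_sum_eq {S : Matrix m m ℂ} {T : Matrix n n ℂ} (hS : S.PosSemidef)
    (hT : T.PosSemidef) {Z : Matrix m n ℂ} (hZ : supportProj S * Z = Z) :
    ∃ Λ : Finset ℝ, (∀ x ∈ Λ, 0 < x) ∧ ∀ c : {t : ℝ // 0 < t} →₀ ℝ,
      (∀ x ∈ Λ, c.sum (fun t k => k / (x + t)) = (Real.sqrt x)⁻¹) →
      ∀ G : {t : ℝ // 0 < t} → Matrix m n ℂ,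
        (∀ t, S * G t + ((t : ℝ) : ℂ) • (G t * T) = Z * T) →
        matSqrt S * c.sum (fun t k => (k : ℂ) • G t) = Z * matSqrt T := by
  obtain ⟨U, s, hU, hU', hs, hUS, hfS⟩ := exists_spectral_nonneg hS
  obtain ⟨V, τ, hV, hV', hτ, hVT, hfT⟩ := exists_spectral_nonneg hT
  refine ⟨(Finset.univ.image fun p : m × n => s p.1 / τ p.2).filter (0 < ·), by simp, ?_⟩
  intro c hc G hG
  -- in the eigenbases of `S` and `T` the equations are scalar equations for the matrix entries
  have hZ' : ∀ j i, s j = 0 → (Uᴴ * Z * V) j i = 0 := by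
    intro j i hj
    have h1 : Uᴴ * Z * V = diagonal (fun i => ((if s i = 0 then 0 else 1 : ℝ) : ℂ)) *
        (Uᴴ * Z * V) := by
      conv_lhs => rw [← hZ, supportProj, hfS]
      calc _ = (Uᴴ * U) * (diagonal (fun i => ((if s i = 0 then 0 else 1 : ℝ) : ℂ)) *
            (Uᴴ * Z * V)) := by simp only [Matrix.mul_assoc]
        _ = _ := by rw [hU, Matrix.one_mul]
    rw [h1, diagonal_mul]
    simp [hj]
  have hG' : ∀ (t : {t : ℝ // 0 < t}) j i, (s j + t * τ i : ℂ) * (Uᴴ * G t * V) j i =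
      (Uᴴ * Z * V) j i * τ i := by
    intro t j i
    have h1 : diagonal (fun i => (s i : ℂ)) * (Uᴴ * G t * V) +
        ((t : ℝ) : ℂ) • ((Uᴴ * G t * V) * diagonal (fun i => (τ i : ℂ))) =
        (Uᴴ * Z * V) * diagonal (fun i => (τ i : ℂ)) := by
      have h2 := congrArg (fun Y => Uᴴ * Y * V) (hG t)
      simp only [Matrix.mul_add, Matrix.add_mul, Matrix.mul_smul, Matrix.smul_mul] at h2
      rw [hUS, hVT] at h2
      have h3 : ∀ Y : Matrix m n ℂ, Uᴴ * (Y * (V * diagonal (fun i => (τ i : ℂ)) * Vᴴ)) * V =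
          Uᴴ * Y * V * diagonal (fun i => (τ i : ℂ)) := by
        intro Y
        calc _ = Uᴴ * Y * V * diagonal (fun i => (τ i : ℂ)) * (Vᴴ * V) := by
              simp only [Matrix.mul_assoc]
          _ = _ := by rw [hV, Matrix.mul_one]
      have h4 : Uᴴ * (U * diagonal (fun i => (s i : ℂ)) * Uᴴ * G t) * V =
          diagonal (fun i => (s i : ℂ)) * (Uᴴ * G t * V) := by
        calc _ = (Uᴴ * U) * (diagonal (fun i => (s i : ℂ)) * (Uᴴ * G t * V)) := by
              simp only [Matrix.mul_assoc]
          _ = _ := by rw [hU, Matrix.one_mul]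
      rw [h3, h3, h4] at h2
      exact h2
    have h5 := congrFun (congrFun h1 j) i
    rw [Matrix.add_apply, Matrix.smul_apply, diagonal_mul, mul_diagonal, mul_diagonal,
      smul_eq_mul] at h5
    rw [← h5]
    ring
  have key : diagonal (fun i => (Real.sqrt (s i) : ℂ)) *
      (Uᴴ * c.sum (fun t k => (k : ℂ) • G t) * V) =
      (Uᴴ * Z * V) * diagonal (fun i => (Real.sqrt (τ i) : ℂ)) := by
    ext j i
    rw [diagonal_mul, mul_diagonal]
    have h1 : (Uᴴ * c.sum (fun t k => (k : ℂ) • G t) * V) j i =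
        c.sum (fun t k => (k : ℂ) * (Uᴴ * G t * V) j i) := by
      rw [Finsupp.sum, Finsupp.sum, Matrix.mul_sum, Matrix.sum_mul, Matrix.sum_apply]
      simp only [Matrix.mul_smul, Matrix.smul_mul, Matrix.smul_apply, smul_eq_mul]
    rw [h1]
    by_cases hj : s j = 0
    · rw [hj, hZ' j i hj]
      simp
    have hjpos : 0 < s j := lt_of_le_of_ne (hs j) (Ne.symm hj)
    by_cases hi : τ i = 0
    · rw [hi, Finsupp.sum, Finset.sum_eq_zero]
      · simp
      · intro t _
        have h2 := hG' t j i
        rw [hi] at h2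
        have h3 : (s j : ℂ) ≠ 0 := by exact_mod_cast hj
        simp only [Complex.ofReal_zero, mul_zero, add_zero, mul_eq_zero, h3, false_or] at h2
        rw [h2, mul_zero]
    have hipos : 0 < τ i := lt_of_le_of_ne (hτ i) (Ne.symm hi)
    -- each entry of a solution is the resolvent of the ratio of eigenvalues
    have h4 : ∀ t : {t : ℝ // 0 < t}, (Uᴴ * G t * V) j i =
        (Uᴴ * Z * V) j i * ((1 / (s j / τ i + t) : ℝ) : ℂ) := by
      intro t
      have h5 : (s j + t * τ i : ℂ) ≠ 0 := by
        have := add_pos hjpos (mul_pos t.2 hipos)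
        exact_mod_cast this.ne'
      have h6 : (τ i : ℂ) ≠ 0 := by exact_mod_cast hi
      have h7 : ((1 / (s j / τ i + t) : ℝ) : ℂ) = τ i / (s j + t * τ i) := by
        push_cast
        have h8 : (s j / τ i + (t : ℝ) : ℂ) ≠ 0 := by
          have := add_pos (div_pos hjpos hipos) t.2
          exact_mod_cast this.ne'
        field_simp
      rw [h7, ← mul_div_assoc, eq_div_iff h5, mul_comm, hG' t j i]
    have h9 : c.sum (fun t k => (k : ℂ) * (Uᴴ * G t * V) j i) =
        (Uᴴ * Z * V) j i * ((Real.sqrt (s j / τ i))⁻¹ : ℝ) := by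
      rw [← hc (s j / τ i) (by
        simp only [Finset.mem_filter, Finset.mem_image, Finset.mem_univ, true_and]
        exact ⟨⟨(j, i), rfl⟩, div_pos hjpos hipos⟩)]
      rw [Finsupp.sum, Finsupp.sum, Complex.ofReal_sum, Finset.mul_sum]
      refine Finset.sum_congr rfl fun t _ => ?_
      rw [h4 t]
      push_cast
      ring
    rw [h9, Real.sqrt_div (hs j)]
    have h10 : (Real.sqrt (s j) : ℂ) ≠ 0 := by exact_mod_cast (Real.sqrt_pos.mpr hjpos).ne'
    have h11 : (Real.sqrt (τ i) : ℂ) ≠ 0 := by exact_mod_cast (Real.sqrt_pos.mpr hipos).ne'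
    push_cast
    field_simp
  rw [matSqrt, matSqrt, hfS, hfT]
  generalize c.sum (fun t k => (k : ℂ) • G t) = H at key ⊢
  calc _ = U * (diagonal (fun i => (Real.sqrt (s i) : ℂ)) * (Uᴴ * H * V)) * Vᴴ := by
        conv_lhs => rw [← Matrix.mul_one H, ← hV']
        simp only [Matrix.mul_assoc]
    _ = (U * Uᴴ) * Z * (V * diagonal (fun i => (Real.sqrt (τ i) : ℂ)) * Vᴴ) := by
        rw [key]; simp only [Matrix.mul_assoc]
    _ = _ := by rw [hU', Matrix.one_mul]

end Resolvent

/-! ### The factorization of states with vanishing Markov gap -/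

section Factorization

variable {a b : Type} [Fintype a] [DecidableEq a] [Fintype b] [DecidableEq b]

lemma conjTranspose_kron_one (X : Matrix a a ℂ) :
    (X ⊗ₖ (1 : Matrix b b ℂ))ᴴ = Xᴴ ⊗ₖ (1 : Matrix b b ℂ) := by
  rw [conjTranspose_kronecker, conjTranspose_one]

lemma conjTranspose_one_kron (Y : Matrix b b ℂ) :
    ((1 : Matrix a a ℂ) ⊗ₖ Y)ᴴ = (1 : Matrix a a ℂ) ⊗ₖ Yᴴ := by
  rw [conjTranspose_kronecker, conjTranspose_one]

lemma kron_one_mul_kron_one (X X' : Matrix a a ℂ) :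
    (X ⊗ₖ (1 : Matrix b b ℂ)) * (X' ⊗ₖ (1 : Matrix b b ℂ)) = (X * X') ⊗ₖ (1 : Matrix b b ℂ) := by
  rw [← mul_kronecker_mul, Matrix.one_mul]

lemma one_kron_mul_one_kron (Y Y' : Matrix b b ℂ) :
    ((1 : Matrix a a ℂ) ⊗ₖ Y) * ((1 : Matrix a a ℂ) ⊗ₖ Y') = (1 : Matrix a a ℂ) ⊗ₖ (Y * Y') := by
  rw [← mul_kronecker_mul, Matrix.one_mul]

lemma kron_one_comm_one_kron (X : Matrix a a ℂ) (Y : Matrix b b ℂ) :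
    (X ⊗ₖ (1 : Matrix b b ℂ)) * ((1 : Matrix a a ℂ) ⊗ₖ Y) =
      ((1 : Matrix a a ℂ) ⊗ₖ Y) * (X ⊗ₖ (1 : Matrix b b ℂ)) := by
  rw [← mul_kronecker_mul, ← mul_kronecker_mul, Matrix.one_mul, Matrix.one_mul, Matrix.mul_one,
    Matrix.mul_one]

lemma realign_injective : Function.Injective (realign (a := a) (b := b)) := by
  intro Q Q' h
  ext ⟨i, k⟩ ⟨j, l⟩
  exact congrFun (congrFun h (i, j)) (k, l)

/-- Operators on `A` multiplying from the right act on the second index of the rows of the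
realignment. -/
lemma realign_mul_kron_one (Q : Matrix (a × b) (a × b) ℂ) (X : Matrix a a ℂ) :
    realign (Q * (X ⊗ₖ (1 : Matrix b b ℂ))) = ((1 : Matrix a a ℂ) ⊗ₖ Xᵀ) * realign Q := by
  ext ⟨i, j⟩ ⟨k, l⟩
  simp only [Matrix.mul_apply, kroneckerMap_apply, realign, one_apply,
    Fintype.sum_prod_type, transpose_apply, ite_mul, one_mul, zero_mul, mul_ite, mul_zero, mul_one]
  conv_rhs => rw [Finset.sum_comm]
  simp [mul_comm]

lemma realign_mul_one_kron (Q : Matrix (a × b) (a × b) ℂ) (Y : Matrix b b ℂ) :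
    realign (Q * ((1 : Matrix a a ℂ) ⊗ₖ Y)) = realign Q * ((1 : Matrix b b ℂ) ⊗ₖ Y) := by
  ext ⟨i, j⟩ ⟨k, l⟩
  simp only [Matrix.mul_apply, kroneckerMap_apply, realign, one_apply,
    Fintype.sum_prod_type, ite_mul, one_mul, zero_mul, mul_ite, mul_zero]
  rw [Finset.sum_comm]
  conv_rhs => rw [Finset.sum_comm]
  simp

lemma realign_conjTranspose (Q : Matrix (a × b) (a × b) ℂ) :
    realign Qᴴ = ((realign Q).map star).submatrix (Equiv.prodComm a a) (Equiv.prodComm b b) := rfl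

variable {ρ : Matrix (a × b) (a × b) ℂ}

/-- For positive `M`, if `Tr E† M E = 0` then `√M` annihilates `E`. -/
lemma mul_eq_zero_of_conj_trace {n m : Type} [Fintype n] [DecidableEq n] [Fintype m]
    {M : Matrix n n ℂ} (hM : M.PosSemidef) {E : Matrix n m ℂ} (h : (Eᴴ * M * E).trace = 0) :
    matSqrt M * E = 0 := by
  rw [← trace_conjTranspose_mul_self_eq_zero_iff, conjTranspose_mul, conjTranspose_matSqrt hM,
    Matrix.mul_assoc, ← Matrix.mul_assoc (matSqrt M), matSqrt_mul_self hM, ← Matrix.mul_assoc]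
  exact h

lemma matSqrt_mul_supportProj_traceRight (hρ : ρ.PosSemidef) :
    matSqrt ρ * (supportProj (traceRight ρ) ⊗ₖ (1 : Matrix b b ℂ)) = matSqrt ρ := by
  have hA := posSemidef_traceRight hρ
  have h : matSqrt ρ * ((1 - supportProj (traceRight ρ)) ⊗ₖ (1 : Matrix b b ℂ)) = 0 := by
    refine mul_eq_zero_of_conj_trace hρ ?_
    rw [← trace_traceRight, traceRight_mul_kron, conjTranspose_kron_one, traceRight_kron_mul,
      Matrix.mul_assoc, Matrix.mul_sub, mul_supportProj hA]
    simp
  have h2 : (1 - supportProj (traceRight ρ)) ⊗ₖ (1 : Matrix b b ℂ) =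
      1 - supportProj (traceRight ρ) ⊗ₖ (1 : Matrix b b ℂ) := by
    rw [eq_sub_iff_add_eq, ← add_kronecker, sub_add_cancel, one_kronecker_one]
  rw [h2, Matrix.mul_sub, Matrix.mul_one, sub_eq_zero] at h
  exact h.symm

lemma matSqrt_mul_supportProj_traceLeft (hρ : ρ.PosSemidef) :
    matSqrt ρ * ((1 : Matrix a a ℂ) ⊗ₖ supportProj (traceLeft ρ)) = matSqrt ρ := by
  have hB := posSemidef_traceLeft hρ
  have h : matSqrt ρ * ((1 : Matrix a a ℂ) ⊗ₖ (1 - supportProj (traceLeft ρ))) = 0 := by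
    refine mul_eq_zero_of_conj_trace hρ ?_
    rw [← trace_traceLeft, traceLeft_mul_kron, conjTranspose_one_kron, traceLeft_kron_mul,
      Matrix.mul_assoc, Matrix.mul_sub, mul_supportProj hB]
    simp
  have h2 : (1 : Matrix a a ℂ) ⊗ₖ (1 - supportProj (traceLeft ρ)) =
      1 - (1 : Matrix a a ℂ) ⊗ₖ supportProj (traceLeft ρ) := by
    rw [eq_sub_iff_add_eq, ← kronecker_add, sub_add_cancel, one_kronecker_one]
  rw [h2, Matrix.mul_sub, Matrix.mul_one, sub_eq_zero] at h
  exact h.symm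

lemma posSemidef_one_kron {n k : Type} [Fintype n] [DecidableEq n] [Fintype k] [DecidableEq k]
    {M : Matrix n n ℂ} (hM : M.PosSemidef) : ((1 : Matrix k k ℂ) ⊗ₖ M).PosSemidef :=
  PosSemidef.one.kronecker hM

/-- For vanishing Markov gap, `ρ = √ρ_B Q √ρ_A`, where `Q` is the partial isometry in the polar
decomposition of the realignment of `√ρ`. This is the equation obtained from the two Sylvester
equations by applying `x ↦ x ^ (-1/2)` instead of the resolvents. -/
theorem exists_factorization (hρ : ρ.PosSemidef) (hgap : markovGap ρ = 0) :
    ∃ Q : Matrix (a × b) (a × b) ℂ, Qᴴ = Q ∧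
      ρ = ((1 : Matrix a a ℂ) ⊗ₖ matSqrt (traceLeft ρ)) * Q *
        (matSqrt (traceRight ρ) ⊗ₖ (1 : Matrix b b ℂ)) ∧
      realign Q * (realign Q)ᴴ * realign Q = realign Q ∧
      Q * (supportProj (traceRight ρ) ⊗ₖ (1 : Matrix b b ℂ)) = Q ∧
      Q * ((1 : Matrix a a ℂ) ⊗ₖ supportProj (traceLeft ρ)) = Q := by
  have hA := posSemidef_traceRight hρ
  have hB := posSemidef_traceLeft hρ
  set R := matSqrt ρ with hR
  have hRh : Rᴴ = R := conjTranspose_matSqrt hρ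
  have hRR : R * R = ρ := matSqrt_mul_self hρ
  have hRA : R * (supportProj (traceRight ρ) ⊗ₖ (1 : Matrix b b ℂ)) = R :=
    matSqrt_mul_supportProj_traceRight hρ
  have hRB : R * ((1 : Matrix a a ℂ) ⊗ₖ supportProj (traceLeft ρ)) = R :=
    matSqrt_mul_supportProj_traceLeft hρ
  set K := (realign R)ᴴ * realign R with hK
  have hKp : K.PosSemidef := posSemidef_conjTranspose_mul_self _
  set N := (1 : Matrix a a ℂ) ⊗ₖ (traceRight ρ)ᵀ with hN
  have hNp : N.PosSemidef := posSemidef_one_kron hA.transpose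
  have hSp : ((1 : Matrix a a ℂ) ⊗ₖ traceLeft ρ).PosSemidef := posSemidef_one_kron hB
  have hNsupp : supportProj N = (1 : Matrix a a ℂ) ⊗ₖ (supportProj (traceRight ρ))ᵀ := by
    rw [supportProj, cfc_one_kron hA.transpose.isHermitian, cfc_transpose hA.isHermitian]
    rfl
  have hNsqrt : matSqrt N = (1 : Matrix a a ℂ) ⊗ₖ (matSqrt (traceRight ρ))ᵀ := by
    rw [matSqrt, cfc_one_kron hA.transpose.isHermitian, cfc_transpose hA.isHermitian]
    rfl
  have hKR : realign R * supportProj K = realign R := mul_supportProj_conjTranspose_mul_self _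
  have hNR : supportProj N * realign R = realign R := by
    rw [hNsupp, ← realign_mul_kron_one, hRA]
  -- solutions of the Sylvester equations, and the interpolating combination of them
  have hsyl := (markovGap_nonneg_and_sylvester hρ).2 hgap
  choose! X hX1 hX2 using hsyl
  change ∀ T, 0 < T → realign (X T * R) * K + (T : ℂ) • (N * realign (X T * R)) =
    N * realign R at hX2
  obtain ⟨Λ₁, hΛ₁, h1⟩ := exists_sqrt_mul_sum_eq hSp hρ (Z := R) (by
    have h := congrArg conjTranspose hRB
    rw [conjTranspose_mul, hRh, conjTranspose_one_kron, conjTranspose_supportProj hB] at h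
    rw [supportProj, cfc_one_kron hB.isHermitian]
    exact h)
  obtain ⟨Λ₂, hΛ₂, h2⟩ := exists_sqrt_mul_sum_eq hKp hNp (Z := (realign R)ᴴ) (by
    rw [← conjTranspose_supportProj hKp, ← conjTranspose_mul, hKR])
  obtain ⟨c, hc⟩ := exists_resolvent_interpolation (Λ₁ ∪ Λ₂)
    (fun x hx => (Finset.mem_union.mp hx).elim (hΛ₁ x) (hΛ₂ x)) fun x => (Real.sqrt x)⁻¹
  let H : Matrix (a × b) (a × b) ℂ :=
    c.sum fun t k => (k : ℂ) • (X t * R)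
  have hH1 : ((1 : Matrix a a ℂ) ⊗ₖ matSqrt (traceLeft ρ)) * H = ρ := by
    have h3 := h1 c (fun x hx => hc x (Finset.mem_union_left _ hx)) (fun t => X t * R) (fun t => by
      have h4 := congrArg (· * R) (hX1 t t.2)
      simp only [Matrix.add_mul, Matrix.smul_mul] at h4
      rw [Matrix.mul_assoc, Matrix.mul_assoc (X t)] at h4
      have h5 : ρ * R = R * ρ := by rw [← hRR, Matrix.mul_assoc]
      rw [h5, ← Matrix.mul_assoc (X t)] at h4
      exact h4)
    rw [matSqrt, cfc_one_kron hB.isHermitian] at h3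
    rw [← hR, hRR] at h3
    exact h3
  have hHr : realign H = c.sum fun t k => (k : ℂ) • realign (X t * R) := by
    ext p q
    rw [Finsupp.sum, Matrix.sum_apply]
    simp only [realign, H, Finsupp.sum, Matrix.sum_apply, Matrix.smul_apply]
  have hH2 : realign H * matSqrt K = matSqrt N * realign R := by
    have h3 := h2 c (fun x hx => hc x (Finset.mem_union_right _ hx))
      (fun t => (realign (X t * R))ᴴ) (fun t => by
        have h4 := congrArg conjTranspose (hX2 t t.2)
        rw [conjTranspose_add, conjTranspose_smul, conjTranspose_mul _ K, conjTranspose_mul N,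
          conjTranspose_mul N, hKp.isHermitian.eq, hNp.isHermitian.eq, Complex.star_def,
          Complex.conj_ofReal] at h4
        exact h4)
    have h5 : (c.sum fun t k => (k : ℂ) • (realign (X t * R))ᴴ) = (realign H)ᴴ := by
      rw [hHr, Finsupp.sum, Finsupp.sum, conjTranspose_sum]
      simp only [conjTranspose_smul, Complex.star_def, Complex.conj_ofReal]
    rw [h5] at h3
    have h6 := congrArg conjTranspose h3
    rw [conjTranspose_mul, conjTranspose_mul, conjTranspose_conjTranspose,
      conjTranspose_conjTranspose, conjTranspose_matSqrt hKp, conjTranspose_matSqrt hNp] at h6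
    exact h6
  -- the support of `K` carries `realign H`, so `√K` can be cancelled in `hH2`
  have hH3 : realign H * supportProj K = realign H := by
    have h3 : ∀ t : {t : ℝ // 0 < t},
        realign (X t * R) * (1 - supportProj K) = 0 := by
      intro t
      have h4 := congrArg (· * (1 - supportProj K)) (hX2 t t.2)
      have h5 : K * (1 - supportProj K) = 0 := by
        rw [Matrix.mul_sub, Matrix.mul_one, mul_supportProj hKp, sub_self]
      have h6 : realign R * (1 - supportProj K) = 0 := by
        rw [Matrix.mul_sub, Matrix.mul_one, hKR, sub_self]
      simp only [Matrix.add_mul, Matrix.smul_mul] at h4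
      rw [Matrix.mul_assoc, h5, Matrix.mul_zero, zero_add, Matrix.mul_assoc N, Matrix.mul_assoc N,
        h6, Matrix.mul_zero, smul_eq_zero] at h4
      have h7 := supportProj_mul_eq_zero hNp
        (h4.resolve_left (by exact_mod_cast t.2.ne'))
      rw [← Matrix.mul_assoc, hNsupp, ← realign_mul_kron_one, Matrix.mul_assoc, hRA] at h7
      exact h7
    have h8 : realign H * (1 - supportProj K) = 0 := by
      rw [hHr, Finsupp.sum, Matrix.sum_mul]
      refine Finset.sum_eq_zero fun t _ => ?_
      rw [Matrix.smul_mul, h3 t, smul_zero]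
    rw [Matrix.mul_sub, Matrix.mul_one, sub_eq_zero] at h8
    exact h8.symm
  -- the partial isometry of the polar decomposition of the realignment of `√ρ`
  let q : Matrix (a × a) (b × b) ℂ := realign R * matInvSqrt K
  let Q : Matrix (a × b) (a × b) ℂ := fun i j => q (i.1, j.1) (i.2, j.2)
  have hq : realign Q = q := rfl
  refine ⟨Q, ?_, ?_, ?_, ?_, ?_⟩
  · -- `R` is Hermitian: its realignment is fixed by conjugation combined with swaps of the indices,
    -- and so is everything obtained from it by functional calculus
    apply realign_injective
    rw [realign_conjTranspose, hq]
    have h3 : ((realign R).map star).submatrix (Equiv.prodComm a a) (Equiv.prodComm b b) =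
        realign R := by rw [← realign_conjTranspose, hRh]
    have hmul : ∀ {k l m : Type} [Fintype l] (A : Matrix k l ℂ) (B : Matrix l m ℂ),
        (A * B).map star = A.map star * B.map star := by
      intro k l m _ A B
      ext i j
      simp [Matrix.mul_apply]
    have h4 : (K.map star).submatrix (Equiv.prodComm b b) (Equiv.prodComm b b) = K := by
      conv_rhs => rw [hK, ← h3]
      rw [hK, hmul, conjTranspose_submatrix, submatrix_mul_equiv]
      rfl
    have h5 := cfc_map_star_submatrix hKp.isHermitian _ h4 fun x => (Real.sqrt x)⁻¹
    change ((realign R * matInvSqrt K).map star).submatrix _ _ = realign R * matInvSqrt K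
    rw [hmul, ← submatrix_mul_equiv _ _ _ (Equiv.prodComm b b), h3]
    congr 1
  · -- `H = Q √ρ_A`
    have h3 : realign H = realign (Q * (matSqrt (traceRight ρ) ⊗ₖ (1 : Matrix b b ℂ))) := by
      rw [realign_mul_kron_one, ← hNsqrt, hq]
      calc realign H = realign H * (matSqrt K * matInvSqrt K) := by
            rw [matSqrt_mul_matInvSqrt hKp, hH3]
        _ = _ := by rw [← Matrix.mul_assoc, hH2, Matrix.mul_assoc]
    rw [Matrix.mul_assoc, ← realign_injective h3, hH1]
  · rw [hq]
    calc q * qᴴ * q = realign R * matInvSqrt K * (matInvSqrt K * (K * matInvSqrt K)) := by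
          simp only [q]
          rw [conjTranspose_mul, conjTranspose_matInvSqrt hKp, hK]
          simp only [Matrix.mul_assoc]
      _ = realign R * matInvSqrt K * (matInvSqrt K * matSqrt K * (matSqrt K * matInvSqrt K)) := by
          rw [Matrix.mul_assoc (matInvSqrt K) (matSqrt K), ← Matrix.mul_assoc (matSqrt K),
            matSqrt_mul_self hKp]
      _ = q := by
          rw [matInvSqrt_mul_matSqrt hKp, matSqrt_mul_matInvSqrt hKp, supportProj_mul_self hKp,
            Matrix.mul_assoc, matInvSqrt_mul_supportProj hKp]
  · apply realign_injective
    rw [realign_mul_kron_one, ← hNsupp, hq, ← Matrix.mul_assoc, hNR]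
  · apply realign_injective
    rw [realign_mul_one_kron, hq]
    have h3 : K * ((1 : Matrix b b ℂ) ⊗ₖ supportProj (traceLeft ρ)) = K := by
      rw [hK, Matrix.mul_assoc, ← realign_mul_one_kron, hRB]
    have h4 : matInvSqrt K = matInvSqrt K * (matInvSqrt K * matInvSqrt K) * K := by
      conv_lhs => rw [← matInvSqrt_mul_supportProj hKp, ← supportProj_mul_self hKp]
      rw [← matInvSqrt_mul_matSqrt hKp, Matrix.mul_assoc (matInvSqrt K) (matInvSqrt K * _) K]
      congr 1
      rw [Matrix.mul_assoc (matInvSqrt K), ← Matrix.mul_assoc (matSqrt K),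
        matSqrt_mul_matInvSqrt hKp, supportProj_mul_matSqrt hKp]
      calc matInvSqrt K * matSqrt K = matInvSqrt K * (supportProj K * matSqrt K) := by
            rw [supportProj_mul_matSqrt hKp]
        _ = _ := by
            rw [← matInvSqrt_mul_matSqrt hKp, Matrix.mul_assoc (matInvSqrt K) (matSqrt K),
              matSqrt_mul_self hKp, Matrix.mul_assoc]
    change realign R * matInvSqrt K * _ = realign R * matInvSqrt K
    rw [h4, Matrix.mul_assoc, Matrix.mul_assoc _ K, h3]

end Factorization

/-! ### The algebra of operators on `A` that can be moved to `B` -/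

section PartnerAlgebra

variable {a b : Type} [Fintype a] [DecidableEq a] [Fintype b] [DecidableEq b]

lemma traceRight_one_kron_comm (M : Matrix (a × b) (a × b) ℂ) (Y : Matrix b b ℂ) :
    traceRight (((1 : Matrix a a ℂ) ⊗ₖ Y) * M) = traceRight (M * ((1 : Matrix a a ℂ) ⊗ₖ Y)) := by
  ext i j
  simp only [traceRight, Matrix.mul_apply, kroneckerMap_apply, Fintype.sum_prod_type_right,
    one_apply, ite_mul, one_mul, zero_mul, mul_ite, mul_zero, Finset.sum_ite_eq,
    Finset.sum_ite_eq', Finset.mem_univ, if_true]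
  rw [Finset.sum_comm]
  exact Finset.sum_congr rfl fun _ _ => Finset.sum_congr rfl fun _ _ => mul_comm _ _

lemma traceLeft_kron_one_comm (M : Matrix (a × b) (a × b) ℂ) (X : Matrix a a ℂ) :
    traceLeft ((X ⊗ₖ (1 : Matrix b b ℂ)) * M) = traceLeft (M * (X ⊗ₖ (1 : Matrix b b ℂ))) := by
  ext i j
  simp only [traceLeft, Matrix.mul_apply, kroneckerMap_apply, Fintype.sum_prod_type,
    one_apply, ite_mul, zero_mul, mul_ite, mul_zero, mul_one, Finset.sum_ite_eq,
    Finset.sum_ite_eq', Finset.mem_univ, if_true]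
  rw [Finset.sum_comm]
  exact Finset.sum_congr rfl fun _ _ => Finset.sum_congr rfl fun _ _ => mul_comm _ _

lemma conjTranspose_traceRight (M : Matrix (a × b) (a × b) ℂ) :
    (traceRight M)ᴴ = traceRight Mᴴ := by
  ext i j
  simp [traceRight, conjTranspose_apply]

lemma conjTranspose_traceLeft (M : Matrix (a × b) (a × b) ℂ) :
    (traceLeft M)ᴴ = traceLeft Mᴴ := by
  ext i j
  simp [traceLeft, conjTranspose_apply]

/-- The `A`-slices `Tr_B Q (1 ⊗ Z)` of an operator on `A ⊗ B`. As a map from operators on `B` to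
operators on `A`, `Z ↦ sliceA Q Z` is the realignment of `Q`, up to a transposition of `Z`. -/
def sliceA (Q : Matrix (a × b) (a × b) ℂ) (Z : Matrix b b ℂ) : Matrix a a ℂ :=
  traceRight (Q * ((1 : Matrix a a ℂ) ⊗ₖ Z))

/-- The `B`-slices `Tr_A Q (X ⊗ 1)` of an operator on `A ⊗ B`. For Hermitian `Q` this is the adjoint
of `sliceA Q`. -/
def sliceB (Q : Matrix (a × b) (a × b) ℂ) (X : Matrix a a ℂ) : Matrix b b ℂ :=
  traceLeft (Q * (X ⊗ₖ (1 : Matrix b b ℂ)))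

/-- The factorization `ρ = √ρ_B Q √ρ_A` through a Hermitian operator whose realignment is a partial
isometry. -/
structure IsFactorization (ρ Q : Matrix (a × b) (a × b) ℂ) : Prop where
  posSemidef : ρ.PosSemidef
  hermitian : Qᴴ = Q
  eq_left : ρ = ((1 : Matrix a a ℂ) ⊗ₖ matSqrt (traceLeft ρ)) * Q *
        (matSqrt (traceRight ρ) ⊗ₖ (1 : Matrix b b ℂ))
  partialIsometry : realign Q * (realign Q)ᴴ * realign Q = realign Q
  mul_supportA : Q * (supportProj (traceRight ρ) ⊗ₖ (1 : Matrix b b ℂ)) = Q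
  mul_supportB : Q * ((1 : Matrix a a ℂ) ⊗ₖ supportProj (traceLeft ρ)) = Q

variable {ρ Q : Matrix (a × b) (a × b) ℂ}

/-- `sliceA Q` and `sliceB Q` are adjoint to each other for the Hilbert–Schmidt inner product. -/
lemma trace_conjTranspose_sliceB_mul (hQ : Qᴴ = Q) (X : Matrix a a ℂ) (W : Matrix b b ℂ) :
    ((sliceB Q X)ᴴ * W).trace = (Xᴴ * sliceA Q W).trace := by
  rw [sliceB, conjTranspose_traceLeft, conjTranspose_mul, conjTranspose_kron_one, hQ, sliceA,
    ← traceLeft_mul_kron, trace_traceLeft, ← traceRight_kron_mul, trace_traceRight,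
    Matrix.mul_assoc]

lemma conjTranspose_sliceA (hQ : Qᴴ = Q) (W : Matrix b b ℂ) :
    (sliceA Q W)ᴴ = sliceA Q Wᴴ := by
  rw [sliceA, conjTranspose_traceRight, conjTranspose_mul, conjTranspose_one_kron, hQ,
    traceRight_one_kron_comm, sliceA]

lemma conjTranspose_sliceB (hQ : Qᴴ = Q) (X : Matrix a a ℂ) :
    (sliceB Q X)ᴴ = sliceB Q Xᴴ := by
  rw [sliceB, conjTranspose_traceLeft, conjTranspose_mul, conjTranspose_kron_one, hQ,
    traceLeft_kron_one_comm, sliceB]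

lemma sliceA_apply (Q : Matrix (a × b) (a × b) ℂ) (Z : Matrix b b ℂ) (i j : a) :
    sliceA Q Z i j = (realign Q *ᵥ fun q => Z q.2 q.1) (i, j) := by
  simp only [sliceA, traceRight, Matrix.mul_apply, kroneckerMap_apply, Fintype.sum_prod_type_right,
    one_apply, ite_mul, one_mul, zero_mul, mul_ite, mul_zero,
    Finset.sum_ite_eq', Finset.mem_univ, if_true, mulVec, dotProduct, realign]
  exact Finset.sum_comm

lemma sliceB_apply (hQ : Qᴴ = Q) (X : Matrix a a ℂ) (k l : b) :
    sliceB Q X l k = ((realign Q)ᴴ *ᵥ fun p => X p.1 p.2) (k, l) := by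
  have h : ∀ p q, Q p q = star (Q q p) := fun p q => by
    conv_lhs => rw [← hQ, conjTranspose_apply]
  simp only [sliceB, traceLeft, Matrix.mul_apply, kroneckerMap_apply, Fintype.sum_prod_type,
    one_apply, mul_ite, mul_zero, mul_one, conjTranspose_apply,
    Finset.sum_ite_eq', Finset.mem_univ, if_true, mulVec, dotProduct, realign]
  rw [Finset.sum_comm]
  exact Finset.sum_congr rfl fun _ _ => Finset.sum_congr rfl fun _ _ => by rw [h]

lemma sliceA_sliceB_sliceA (h : IsFactorization ρ Q) (Z : Matrix b b ℂ) :
    sliceA Q (sliceB Q (sliceA Q Z)) = sliceA Q Z := by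
  ext i j
  rw [sliceA_apply]
  simp only [sliceB_apply h.hermitian]
  simp only [sliceA_apply]
  rw [mulVec_mulVec, mulVec_mulVec, h.partialIsometry]

lemma sliceB_sliceA_sliceB (h : IsFactorization ρ Q) (X : Matrix a a ℂ) :
    sliceB Q (sliceA Q (sliceB Q X)) = sliceB Q X := by
  have h1 := congrArg conjTranspose h.partialIsometry
  rw [conjTranspose_mul, conjTranspose_mul, conjTranspose_conjTranspose, ← Matrix.mul_assoc] at h1
  ext l k
  rw [sliceB_apply h.hermitian, sliceB_apply h.hermitian]
  simp only [sliceA_apply]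
  simp only [sliceB_apply h.hermitian]
  rw [mulVec_mulVec, mulVec_mulVec, h1]

namespace IsFactorization

variable (h : IsFactorization ρ Q)
include h

lemma eq_right : ρ = (matSqrt (traceRight ρ) ⊗ₖ (1 : Matrix b b ℂ)) * Q *
    ((1 : Matrix a a ℂ) ⊗ₖ matSqrt (traceLeft ρ)) := by
  have h1 := congrArg conjTranspose h.eq_left
  rw [h.posSemidef.isHermitian.eq, conjTranspose_mul, conjTranspose_mul, h.hermitian,
    conjTranspose_kron_one, conjTranspose_one_kron,
    conjTranspose_matSqrt (posSemidef_traceRight h.posSemidef),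
    conjTranspose_matSqrt (posSemidef_traceLeft h.posSemidef), ← Matrix.mul_assoc] at h1
  exact h1

lemma supportA_mul : (supportProj (traceRight ρ) ⊗ₖ (1 : Matrix b b ℂ)) * Q = Q := by
  have h1 := congrArg conjTranspose h.mul_supportA
  rwa [conjTranspose_mul, h.hermitian, conjTranspose_kron_one,
    conjTranspose_supportProj (posSemidef_traceRight h.posSemidef)] at h1

lemma supportB_mul : ((1 : Matrix a a ℂ) ⊗ₖ supportProj (traceLeft ρ)) * Q = Q := by
  have h1 := congrArg conjTranspose h.mul_supportB
  rwa [conjTranspose_mul, h.hermitian, conjTranspose_one_kron,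
    conjTranspose_supportProj (posSemidef_traceLeft h.posSemidef)] at h1

lemma sliceA_mul_support (W : Matrix b b ℂ) :
    sliceA Q W * supportProj (traceRight ρ) = sliceA Q W := by
  rw [sliceA, ← traceRight_mul_kron, Matrix.mul_assoc, ← kron_one_comm_one_kron,
    ← Matrix.mul_assoc, h.mul_supportA]

lemma support_mul_sliceA (W : Matrix b b ℂ) :
    supportProj (traceRight ρ) * sliceA Q W = sliceA Q W := by
  rw [sliceA, ← traceRight_kron_mul, ← Matrix.mul_assoc, h.supportA_mul]

lemma sliceB_mul_support (X : Matrix a a ℂ) :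
    sliceB Q X * supportProj (traceLeft ρ) = sliceB Q X := by
  rw [sliceB, ← traceLeft_mul_kron, Matrix.mul_assoc, kron_one_comm_one_kron,
    ← Matrix.mul_assoc, h.mul_supportB]

lemma support_mul_sliceB (X : Matrix a a ℂ) :
    supportProj (traceLeft ρ) * sliceB Q X = sliceB Q X := by
  rw [sliceB, ← traceLeft_kron_mul, ← Matrix.mul_assoc, h.supportB_mul]

lemma sliceA_support_mul (W : Matrix b b ℂ) :
    sliceA Q (supportProj (traceLeft ρ) * W) = sliceA Q W := by
  rw [sliceA, ← one_kron_mul_one_kron, ← Matrix.mul_assoc, h.mul_supportB, sliceA]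

lemma sliceA_state_left (Z : Matrix b b ℂ) :
    sliceA ρ Z = sliceA Q (Z * matSqrt (traceLeft ρ)) * matSqrt (traceRight ρ) := by
  conv_lhs => rw [h.eq_left, sliceA]
  rw [Matrix.mul_assoc, kron_one_comm_one_kron, ← Matrix.mul_assoc, traceRight_mul_kron,
    Matrix.mul_assoc, traceRight_one_kron_comm, Matrix.mul_assoc, one_kron_mul_one_kron, sliceA]

lemma sliceA_state_right (Z : Matrix b b ℂ) :
    sliceA ρ Z = matSqrt (traceRight ρ) * sliceA Q (matSqrt (traceLeft ρ) * Z) := by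
  conv_lhs => rw [h.eq_right, sliceA]
  rw [Matrix.mul_assoc, one_kron_mul_one_kron, Matrix.mul_assoc, traceRight_kron_mul, sliceA]

lemma sliceB_state_left (X : Matrix a a ℂ) :
    sliceB ρ X = matSqrt (traceLeft ρ) * sliceB Q (matSqrt (traceRight ρ) * X) := by
  conv_lhs => rw [h.eq_left, sliceB]
  rw [Matrix.mul_assoc, kron_one_mul_kron_one, Matrix.mul_assoc, traceLeft_kron_mul, sliceB]

lemma sliceB_state_right (X : Matrix a a ℂ) :
    sliceB ρ X = sliceB Q (X * matSqrt (traceRight ρ)) * matSqrt (traceLeft ρ) := by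
  conv_lhs => rw [h.eq_right, sliceB]
  rw [Matrix.mul_assoc, ← kron_one_comm_one_kron, ← Matrix.mul_assoc, traceLeft_mul_kron,
    Matrix.mul_assoc, traceLeft_kron_one_comm, Matrix.mul_assoc, kron_one_mul_kron_one, sliceB]

/-- The two factorizations `√ρ_B Q √ρ_A` and `√ρ_A Q √ρ_B` of `ρ`, compared on slices. -/
lemma invSqrt_mul_sliceA (Z : Matrix b b ℂ) :
    matInvSqrt (traceRight ρ) * sliceA Q (Z * matSqrt (traceLeft ρ)) =
      sliceA Q (matSqrt (traceLeft ρ) * Z) * matInvSqrt (traceRight ρ) := by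
  have hA := posSemidef_traceRight h.posSemidef
  have h1 := congrArg (fun Y => matInvSqrt (traceRight ρ) * Y * matInvSqrt (traceRight ρ))
    ((h.sliceA_state_left Z).symm.trans (h.sliceA_state_right Z))
  rw [Matrix.mul_assoc, Matrix.mul_assoc _ (matSqrt _) (matInvSqrt _), matSqrt_mul_matInvSqrt hA,
    h.sliceA_mul_support, ← Matrix.mul_assoc, matInvSqrt_mul_matSqrt hA, h.support_mul_sliceA] at h1
  exact h1

lemma invSqrt_mul_sliceB (X : Matrix a a ℂ) :
    matInvSqrt (traceLeft ρ) * sliceB Q (X * matSqrt (traceRight ρ)) =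
      sliceB Q (matSqrt (traceRight ρ) * X) * matInvSqrt (traceLeft ρ) := by
  have hB := posSemidef_traceLeft h.posSemidef
  have h1 := congrArg (fun Y => matInvSqrt (traceLeft ρ) * Y * matInvSqrt (traceLeft ρ))
    ((h.sliceB_state_right X).symm.trans (h.sliceB_state_left X))
  rw [Matrix.mul_assoc, Matrix.mul_assoc _ (matSqrt _) (matInvSqrt _), matSqrt_mul_matInvSqrt hB,
    h.sliceB_mul_support, ← Matrix.mul_assoc, matInvSqrt_mul_matSqrt hB, h.support_mul_sliceB] at h1
  exact h1

end IsFactorization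

/-- The operator on `B` that reproduces the action of `X` on `ρ`, for `X` in the partner algebra. It
is obtained from the `B`-marginal of `(X ⊗ 1) ρ` by the pseudo-inverse of `ρ_B`. -/
def partner (ρ : Matrix (a × b) (a × b) ℂ) (X : Matrix a a ℂ) : Matrix b b ℂ :=
  sliceB ρ X * (matInvSqrt (traceLeft ρ) * matInvSqrt (traceLeft ρ))

/-- The operators `X` on the support of `ρ_A` such that `(X ⊗ 1) ρ = (1 ⊗ Y) ρ` for some operator
`Y` on `B`. -/
def partnerAlgebra (ρ : Matrix (a × b) (a × b) ℂ) : Submodule ℂ (Matrix a a ℂ) where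
  carrier := {X | supportProj (traceRight ρ) * X = X ∧ X * supportProj (traceRight ρ) = X ∧
    ∃ Y : Matrix b b ℂ, (X ⊗ₖ (1 : Matrix b b ℂ)) * ρ = ((1 : Matrix a a ℂ) ⊗ₖ Y) * ρ}
  add_mem' := by
    rintro X X' ⟨h1, h2, Y, h3⟩ ⟨h1', h2', Y', h3'⟩
    refine ⟨by rw [Matrix.mul_add, h1, h1'], by rw [Matrix.add_mul, h2, h2'], Y + Y', ?_⟩
    rw [add_kronecker, kronecker_add, Matrix.add_mul, Matrix.add_mul, h3, h3']
  zero_mem' := ⟨by simp, by simp, 0, by simp⟩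
  smul_mem' := by
    rintro c X ⟨h1, h2, Y, h3⟩
    refine ⟨by rw [Matrix.mul_smul, h1], by rw [Matrix.smul_mul, h2], c • Y, ?_⟩
    rw [smul_kronecker, kronecker_smul, Matrix.smul_mul, Matrix.smul_mul, h3]

lemma supportProj_traceRight_mul (hρ : ρ.PosSemidef) :
    (supportProj (traceRight ρ) ⊗ₖ (1 : Matrix b b ℂ)) * ρ = ρ := by
  have h1 := congrArg conjTranspose (matSqrt_mul_supportProj_traceRight hρ)
  rw [conjTranspose_mul, conjTranspose_kron_one, conjTranspose_matSqrt hρ,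
    conjTranspose_supportProj (posSemidef_traceRight hρ)] at h1
  calc _ = (supportProj (traceRight ρ) ⊗ₖ (1 : Matrix b b ℂ)) * matSqrt ρ * matSqrt ρ := by
        rw [Matrix.mul_assoc, matSqrt_mul_self hρ]
    _ = ρ := by rw [h1, matSqrt_mul_self hρ]

lemma supportProj_traceLeft_mul (hρ : ρ.PosSemidef) :
    ((1 : Matrix a a ℂ) ⊗ₖ supportProj (traceLeft ρ)) * ρ = ρ := by
  have h1 := congrArg conjTranspose (matSqrt_mul_supportProj_traceLeft hρ)
  rw [conjTranspose_mul, conjTranspose_one_kron, conjTranspose_matSqrt hρ,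
    conjTranspose_supportProj (posSemidef_traceLeft hρ)] at h1
  calc _ = ((1 : Matrix a a ℂ) ⊗ₖ supportProj (traceLeft ρ)) * matSqrt ρ * matSqrt ρ := by
        rw [Matrix.mul_assoc, matSqrt_mul_self hρ]
    _ = ρ := by rw [h1, matSqrt_mul_self hρ]

lemma supportProj_mem_partnerAlgebra (hρ : ρ.PosSemidef) :
    supportProj (traceRight ρ) ∈ partnerAlgebra ρ := by
  have hA := posSemidef_traceRight hρ
  refine ⟨supportProj_mul_self hA, supportProj_mul_self hA, 1, ?_⟩
  rw [supportProj_traceRight_mul hρ, one_kronecker_one, Matrix.one_mul]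

lemma mul_mem_partnerAlgebra {X X' : Matrix a a ℂ} (hX : X ∈ partnerAlgebra ρ)
    (hX' : X' ∈ partnerAlgebra ρ) : X * X' ∈ partnerAlgebra ρ := by
  obtain ⟨h1, h2, Y, h3⟩ := hX
  obtain ⟨h1', h2', Y', h3'⟩ := hX'
  refine ⟨by rw [← Matrix.mul_assoc, h1], by rw [Matrix.mul_assoc, h2'], Y' * Y, ?_⟩
  rw [← kron_one_mul_kron_one, Matrix.mul_assoc, h3', ← Matrix.mul_assoc, kron_one_comm_one_kron,
    Matrix.mul_assoc, h3, ← Matrix.mul_assoc, one_kron_mul_one_kron]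

lemma partner_eq (hρ : ρ.PosSemidef) {X : Matrix a a ℂ} {Y : Matrix b b ℂ}
    (h : (X ⊗ₖ (1 : Matrix b b ℂ)) * ρ = ((1 : Matrix a a ℂ) ⊗ₖ Y) * ρ) :
    partner ρ X = Y * supportProj (traceLeft ρ) := by
  have hB := posSemidef_traceLeft hρ
  rw [partner, sliceB, ← traceLeft_kron_one_comm, h, traceLeft_kron_mul, Matrix.mul_assoc]
  congr 1
  calc _ = matSqrt (traceLeft ρ) * (matSqrt (traceLeft ρ) * matInvSqrt (traceLeft ρ)) *
        matInvSqrt (traceLeft ρ) := by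
        conv_lhs => rw [← Matrix.mul_assoc]
        congr 1
        rw [← Matrix.mul_assoc, matSqrt_mul_self hB]
    _ = _ := by
        rw [matSqrt_mul_matInvSqrt hB, matSqrt_mul_supportProj hB, matSqrt_mul_matInvSqrt hB]

lemma partner_spec (hρ : ρ.PosSemidef) {X : Matrix a a ℂ} (hX : X ∈ partnerAlgebra ρ) :
    (X ⊗ₖ (1 : Matrix b b ℂ)) * ρ = ((1 : Matrix a a ℂ) ⊗ₖ partner ρ X) * ρ := by
  obtain ⟨-, -, Y, h3⟩ := hX
  rw [partner_eq hρ h3, ← one_kron_mul_one_kron, Matrix.mul_assoc, supportProj_traceLeft_mul hρ, h3]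

/-- Moving operators from `A` to `B` reverses products. -/
lemma partner_mul (hρ : ρ.PosSemidef) {X X' : Matrix a a ℂ} (hX : X ∈ partnerAlgebra ρ)
    (hX' : X' ∈ partnerAlgebra ρ) : partner ρ (X * X') = partner ρ X' * partner ρ X := by
  have hB := posSemidef_traceLeft hρ
  have h1 : ((X * X') ⊗ₖ (1 : Matrix b b ℂ)) * ρ =
      ((1 : Matrix a a ℂ) ⊗ₖ (partner ρ X' * partner ρ X)) * ρ := by
    rw [← kron_one_mul_kron_one, Matrix.mul_assoc, partner_spec hρ hX', ← Matrix.mul_assoc,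
      kron_one_comm_one_kron, Matrix.mul_assoc, partner_spec hρ hX, ← Matrix.mul_assoc,
      one_kron_mul_one_kron]
  rw [partner_eq hρ h1, Matrix.mul_assoc]
  congr 1
  rw [partner, Matrix.mul_assoc, Matrix.mul_assoc, matInvSqrt_mul_supportProj hB]

lemma partner_smul (c : ℂ) (X : Matrix a a ℂ) : partner ρ (c • X) = c • partner ρ X := by
  rw [partner, partner, sliceB, sliceB, smul_kronecker, Matrix.mul_smul]
  have : traceLeft (c • (ρ * (X ⊗ₖ (1 : Matrix b b ℂ)))) =
      c • traceLeft (ρ * (X ⊗ₖ (1 : Matrix b b ℂ))) := by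
    ext i j
    simp [traceLeft, Finset.mul_sum]
  rw [this, Matrix.smul_mul]

namespace IsFactorization

variable (h : IsFactorization ρ Q)
include h

lemma partner_eq_sliceB (X : Matrix a a ℂ) :
    partner ρ X = sliceB Q (X * matSqrt (traceRight ρ)) * matInvSqrt (traceLeft ρ) := by
  have hB := posSemidef_traceLeft h.posSemidef
  rw [partner, h.sliceB_state_right, Matrix.mul_assoc, ← Matrix.mul_assoc (matSqrt _),
    matSqrt_mul_matInvSqrt hB, supportProj_mul_matInvSqrt hB]

omit h in
lemma trace_sandwich {n : Type} [Fintype n] {s M X : Matrix n n ℂ} (hs : s * s = M) :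
    (M * (Xᴴ * X)).trace = (s * Xᴴ * (X * s)).trace := by
  rw [trace_mul_comm (s * Xᴴ), Matrix.mul_assoc, ← Matrix.mul_assoc s, hs, trace_mul_comm X,
    Matrix.mul_assoc]

/-- The Hilbert–Schmidt distance between `X √ρ` and `Y √ρ`, with `Y` the candidate partner of `X`,
is the distance of `X √ρ_A` to the range of the partial isometry. -/
lemma trace_partner_defect (X : Matrix a a ℂ) :
    (((X ⊗ₖ (1 : Matrix b b ℂ)) * matSqrt ρ - ((1 : Matrix a a ℂ) ⊗ₖ partner ρ X) * matSqrt ρ)ᴴ *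
      ((X ⊗ₖ (1 : Matrix b b ℂ)) * matSqrt ρ -
        ((1 : Matrix a a ℂ) ⊗ₖ partner ρ X) * matSqrt ρ)).trace =
    ((X * matSqrt (traceRight ρ))ᴴ * (X * matSqrt (traceRight ρ) -
      sliceA Q (sliceB Q (X * matSqrt (traceRight ρ))))).trace := by
  have hρ := h.posSemidef
  have hA := posSemidef_traceRight hρ
  have hB := posSemidef_traceLeft hρ
  set Y := partner ρ X with hY
  set R := matSqrt ρ
  set x := X * matSqrt (traceRight ρ) with hx
  have hRh : Rᴴ = R := conjTranspose_matSqrt hρ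
  have hRR : R * R = ρ := matSqrt_mul_self hρ
  have hcyc : ∀ P M : Matrix (a × b) (a × b) ℂ, (R * P * (M * R)).trace = (ρ * (P * M)).trace := by
    intro P M
    rw [trace_mul_comm, Matrix.mul_assoc, ← Matrix.mul_assoc R, hRR, trace_mul_comm,
      Matrix.mul_assoc]
  have hYs : Y * matSqrt (traceLeft ρ) = sliceB Q x := by
    rw [hY, h.partner_eq_sliceB, Matrix.mul_assoc, matInvSqrt_mul_matSqrt hB, h.sliceB_mul_support]
  have hYB : sliceB ρ X = Y * traceLeft ρ := by
    rw [h.sliceB_state_right, ← hx, ← hYs, Matrix.mul_assoc, matSqrt_mul_self hB]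
  -- the four inner products of `(X ⊗ 1) √ρ` and `(1 ⊗ Y) √ρ`
  have e1 : (ρ * ((Xᴴ ⊗ₖ (1 : Matrix b b ℂ)) * (X ⊗ₖ (1 : Matrix b b ℂ)))).trace =
      (xᴴ * x).trace := by
    rw [kron_one_mul_kron_one, ← trace_traceRight, traceRight_mul_kron, hx, conjTranspose_mul,
      conjTranspose_matSqrt hA, trace_sandwich (matSqrt_mul_self hA)]
  have e2 : (ρ * (((1 : Matrix a a ℂ) ⊗ₖ Yᴴ) * ((1 : Matrix a a ℂ) ⊗ₖ Y))).trace =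
      ((sliceB Q x)ᴴ * sliceB Q x).trace := by
    rw [one_kron_mul_one_kron, ← trace_traceLeft, traceLeft_mul_kron, ← hYs, conjTranspose_mul,
      conjTranspose_matSqrt hB, trace_sandwich (matSqrt_mul_self hB)]
  have e3 : (ρ * (((1 : Matrix a a ℂ) ⊗ₖ Yᴴ) * (X ⊗ₖ (1 : Matrix b b ℂ)))).trace =
      ((sliceB Q x)ᴴ * sliceB Q x).trace := by
    rw [← kron_one_comm_one_kron, ← Matrix.mul_assoc, ← trace_traceLeft, traceLeft_mul_kron,
      ← sliceB, hYB, ← hYs, trace_mul_comm _ (Y * matSqrt _), conjTranspose_mul,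
      conjTranspose_matSqrt hB, Matrix.mul_assoc, Matrix.mul_assoc, ← Matrix.mul_assoc (matSqrt _),
      matSqrt_mul_self hB]
  have e4 : (ρ * ((Xᴴ ⊗ₖ (1 : Matrix b b ℂ)) * ((1 : Matrix a a ℂ) ⊗ₖ Y))).trace =
      ((sliceB Q x)ᴴ * sliceB Q x).trace := by
    have h1 := congrArg star e3
    rw [← trace_conjTranspose, ← trace_conjTranspose] at h1
    simp only [conjTranspose_mul, conjTranspose_one_kron, conjTranspose_kron_one,
      conjTranspose_conjTranspose, hρ.isHermitian.eq] at h1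
    rw [trace_mul_comm] at h1
    exact h1
  rw [conjTranspose_sub, conjTranspose_mul, conjTranspose_mul, hRh, conjTranspose_kron_one,
    conjTranspose_one_kron, Matrix.sub_mul, Matrix.mul_sub, Matrix.mul_sub]
  simp only [hcyc, e1, e2, e3, e4, Matrix.mul_sub, trace_sub]
  rw [trace_conjTranspose_sliceB_mul h.hermitian]
  ring

/-- Together with `exists_mul_sqrt_eq`: an operator `X` on the support of `ρ_A` is in the partner
algebra if and only if `X √ρ_A` is in the range of the partial isometry `sliceA Q`. -/
lemma mem_of_mul_sqrt_eq {X : Matrix a a ℂ} (h1 : supportProj (traceRight ρ) * X = X)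
    (h2 : X * supportProj (traceRight ρ) = X) {W : Matrix b b ℂ}
    (hW : X * matSqrt (traceRight ρ) = sliceA Q W) : X ∈ partnerAlgebra ρ := by
  refine ⟨h1, h2, partner ρ X, ?_⟩
  have h3 := h.trace_partner_defect X
  rw [hW, sliceA_sliceB_sliceA h, sub_self, Matrix.mul_zero, trace_zero,
    trace_conjTranspose_mul_self_eq_zero_iff, sub_eq_zero] at h3
  have h4 := congrArg (· * matSqrt ρ) h3
  simp only [Matrix.mul_assoc, matSqrt_mul_self h.posSemidef] at h4
  exact h4

/-- The defect of `X √ρ_A` from the range of `sliceA Q` vanishes for `X` in the partner algebra. -/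
lemma exists_mul_sqrt_eq {X : Matrix a a ℂ} (hX : X ∈ partnerAlgebra ρ) :
    ∃ W : Matrix b b ℂ, X * matSqrt (traceRight ρ) = sliceA Q W := by
  have hρ := h.posSemidef
  set x := X * matSqrt (traceRight ρ) with hx
  refine ⟨sliceB Q x, ?_⟩
  have h1 := h.trace_partner_defect X
  have h2 : (X ⊗ₖ (1 : Matrix b b ℂ)) * matSqrt ρ -
      ((1 : Matrix a a ℂ) ⊗ₖ partner ρ X) * matSqrt ρ = 0 := by
    rw [← Matrix.sub_mul, ← self_mul_conjTranspose_eq_zero, conjTranspose_mul,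
      conjTranspose_matSqrt hρ, Matrix.mul_assoc, ← Matrix.mul_assoc (matSqrt ρ),
      matSqrt_mul_self hρ, ← Matrix.mul_assoc, Matrix.sub_mul, partner_spec hρ hX, sub_self,
      Matrix.zero_mul]
  rw [h2, Matrix.mul_zero, trace_zero, ← hx] at h1
  set y := x - sliceA Q (sliceB Q x) with hy
  have hlin : sliceB Q y = sliceB Q x - sliceB Q (sliceA Q (sliceB Q x)) := by
    have hsub : ∀ u v : Matrix a a ℂ, sliceB Q (u - v) = sliceB Q u - sliceB Q v := by
      intro u v
      have hadd : ∀ u v : Matrix a a ℂ, sliceB Q (u + v) = sliceB Q u + sliceB Q v := by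
        intro u v
        ext i j
        simp [sliceB, traceLeft, add_kronecker, Matrix.mul_add, Finset.sum_add_distrib]
      rw [eq_sub_iff_add_eq, ← hadd, sub_add_cancel]
    rw [hy, hsub]
  rw [sliceB_sliceA_sliceB h, sub_self] at hlin
  -- `y` is orthogonal to the range of `sliceA Q`, and by `h1` also to `x`, hence to itself
  have h3 : (yᴴ * sliceA Q (sliceB Q x)).trace = 0 := by
    rw [← trace_conjTranspose_sliceB_mul h.hermitian, hlin, conjTranspose_zero, Matrix.zero_mul,
      trace_zero]
  have h4 : ((sliceA Q (sliceB Q x))ᴴ * y).trace = 0 := by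
    have h5 := congrArg star h3
    rw [← trace_conjTranspose, conjTranspose_mul, conjTranspose_conjTranspose, star_zero] at h5
    exact h5
  have h6 : (yᴴ * y).trace = 0 := by
    conv_lhs => rw [hy, conjTranspose_sub, Matrix.sub_mul, trace_sub, ← hy, ← h1, h4, sub_zero]
  rw [trace_conjTranspose_mul_self_eq_zero_iff, hy, sub_eq_zero] at h6
  exact h6

/-- The partner algebra is the range of `sliceA Q` multiplied by `ρ_A ^ (-1/2)` from the right; by
`exists_eq_invSqrt_mul_sliceA` it is also the range multiplied from the left. The range is closed
under adjoints, and therefore so is the partner algebra. -/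
lemma sliceA_mul_invSqrt_mem (W : Matrix b b ℂ) :
    sliceA Q W * matInvSqrt (traceRight ρ) ∈ partnerAlgebra ρ := by
  have hA := posSemidef_traceRight h.posSemidef
  refine h.mem_of_mul_sqrt_eq (W := W) ?_ ?_ ?_
  · rw [← Matrix.mul_assoc, h.support_mul_sliceA]
  · rw [Matrix.mul_assoc, matInvSqrt_mul_supportProj hA]
  · rw [Matrix.mul_assoc, matInvSqrt_mul_matSqrt hA, h.sliceA_mul_support]

lemma exists_eq_invSqrt_mul_sliceA {X : Matrix a a ℂ} (hX : X ∈ partnerAlgebra ρ) :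
    ∃ W : Matrix b b ℂ, X = matInvSqrt (traceRight ρ) * sliceA Q W := by
  have hA := posSemidef_traceRight h.posSemidef
  have hB := posSemidef_traceLeft h.posSemidef
  obtain ⟨W, hW⟩ := h.exists_mul_sqrt_eq hX
  refine ⟨matInvSqrt (traceLeft ρ) * W * matSqrt (traceLeft ρ), ?_⟩
  rw [h.invSqrt_mul_sliceA, ← Matrix.mul_assoc, matSqrt_mul_matInvSqrt hB, h.sliceA_support_mul,
    ← hW, Matrix.mul_assoc, matSqrt_mul_matInvSqrt hA, hX.2.1]

lemma conjTranspose_mem {X : Matrix a a ℂ} (hX : X ∈ partnerAlgebra ρ) :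
    Xᴴ ∈ partnerAlgebra ρ := by
  obtain ⟨W, hW⟩ := h.exists_eq_invSqrt_mul_sliceA hX
  rw [hW, conjTranspose_mul, conjTranspose_sliceA h.hermitian,
    conjTranspose_matInvSqrt (posSemidef_traceRight h.posSemidef)]
  exact h.sliceA_mul_invSqrt_mem _

lemma half_modular_mem {X : Matrix a a ℂ} (hX : X ∈ partnerAlgebra ρ) :
    matSqrt (traceRight ρ) * X * matInvSqrt (traceRight ρ) ∈ partnerAlgebra ρ := by
  obtain ⟨W, hW⟩ := h.exists_eq_invSqrt_mul_sliceA hX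
  rw [hW, ← Matrix.mul_assoc, matSqrt_mul_matInvSqrt (posSemidef_traceRight h.posSemidef),
    h.support_mul_sliceA]
  exact h.sliceA_mul_invSqrt_mem _

/-- The partner algebra is invariant under `X ↦ ρ_A X ρ_A⁻¹`. -/
lemma modular_mem {X : Matrix a a ℂ} (hX : X ∈ partnerAlgebra ρ) :
    traceRight ρ * X * (matInvSqrt (traceRight ρ) * matInvSqrt (traceRight ρ)) ∈
      partnerAlgebra ρ := by
  have h1 := h.half_modular_mem (h.half_modular_mem hX)
  have h2 : matSqrt (traceRight ρ) * (matSqrt (traceRight ρ) * X * matInvSqrt (traceRight ρ)) *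
      matInvSqrt (traceRight ρ) = traceRight ρ * X *
        (matInvSqrt (traceRight ρ) * matInvSqrt (traceRight ρ)) := by
    rw [← Matrix.mul_assoc (matSqrt _), ← Matrix.mul_assoc (matSqrt _),
      matSqrt_mul_self (posSemidef_traceRight h.posSemidef), Matrix.mul_assoc _ (matInvSqrt _)]
  rwa [h2] at h1

/-- The `A`-slices of `ρ` are elements of the partner algebra multiplied by `ρ_A`. -/
lemma exists_sliceA_eq (Z : Matrix b b ℂ) :
    ∃ X ∈ partnerAlgebra ρ, sliceA ρ Z = X * traceRight ρ := by
  have hA := posSemidef_traceRight h.posSemidef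
  refine ⟨_, h.sliceA_mul_invSqrt_mem (Z * matSqrt (traceLeft ρ)), ?_⟩
  rw [h.sliceA_state_left, Matrix.mul_assoc]
  congr 1
  calc matSqrt (traceRight ρ) = matInvSqrt (traceRight ρ) * matSqrt (traceRight ρ) *
        matSqrt (traceRight ρ) := by
        rw [matInvSqrt_mul_matSqrt hA, supportProj_mul_matSqrt hA]
    _ = _ := by rw [Matrix.mul_assoc, matSqrt_mul_self hA]

/-- Moving operators from `A` to `B` respects adjoints up to the modular automorphism. -/
lemma conjTranspose_partner {X : Matrix a a ℂ} (hX : X ∈ partnerAlgebra ρ) :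
    (partner ρ X)ᴴ = partner ρ (traceRight ρ * Xᴴ *
      (matInvSqrt (traceRight ρ) * matInvSqrt (traceRight ρ))) := by
  have hA := posSemidef_traceRight h.posSemidef
  have hB := posSemidef_traceLeft h.posSemidef
  rw [h.partner_eq_sliceB, h.partner_eq_sliceB, conjTranspose_mul, conjTranspose_sliceB h.hermitian,
    conjTranspose_matInvSqrt hB, conjTranspose_mul, conjTranspose_matSqrt hA]
  have h1 : traceRight ρ * Xᴴ * (matInvSqrt (traceRight ρ) * matInvSqrt (traceRight ρ)) *
      matSqrt (traceRight ρ) =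
      matSqrt (traceRight ρ) * (matSqrt (traceRight ρ) * Xᴴ * matInvSqrt (traceRight ρ)) := by
    rw [Matrix.mul_assoc _ (matInvSqrt _ * _), Matrix.mul_assoc (matInvSqrt _),
      matInvSqrt_mul_matSqrt hA, matInvSqrt_mul_supportProj hA, ← Matrix.mul_assoc (matSqrt _),
      ← Matrix.mul_assoc (matSqrt _), matSqrt_mul_self hA]
  have h2 : Xᴴ * supportProj (traceRight ρ) = Xᴴ := by
    have h3 := congrArg conjTranspose hX.1
    rwa [conjTranspose_mul, conjTranspose_supportProj hA] at h3
  rw [h1, ← h.invSqrt_mul_sliceB, Matrix.mul_assoc _ (matInvSqrt _), matInvSqrt_mul_matSqrt hA,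
    Matrix.mul_assoc, h2]

end IsFactorization

end PartnerAlgebra

/-! ### Matrix units adapted to a positive matrix -/

section MinimalProjections

variable {n : Type} [Fintype n] [DecidableEq n]

/-- The rank drops strictly if the kernel grows. -/
lemma rank_mul_lt {N k : Matrix n n ℂ} {v : n → ℂ} (h0 : (N * k) *ᵥ v = 0) (h1 : k *ᵥ v ≠ 0) :
    (N * k).rank < k.rank := by
  have hlt : LinearMap.ker k.mulVecLin < LinearMap.ker (N * k).mulVecLin := by
    refine lt_of_le_of_ne ?_ ?_
    · intro w hw
      rw [LinearMap.mem_ker, mulVecLin_apply] at hw ⊢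
      rw [← mulVec_mulVec, hw, mulVec_zero]
    · intro heq
      have : v ∈ LinearMap.ker (N * k).mulVecLin := h0
      rw [← heq] at this
      exact h1 this
  have h2 := Submodule.finrank_lt_finrank_of_lt hlt
  have h3 := k.mulVecLin.finrank_range_add_finrank_ker
  have h4 := (N * k).mulVecLin.finrank_range_add_finrank_ker
  rw [Matrix.rank, Matrix.rank]
  omega

/-- A nonzero space of matrices closed under products and adjoints contains a minimal projection. -/
lemma exists_minimal_projection (𝒜 : Submodule ℂ (Matrix n n ℂ))
    (hmul : ∀ X ∈ 𝒜, ∀ Y ∈ 𝒜, X * Y ∈ 𝒜) (hstar : ∀ X ∈ 𝒜, Xᴴ ∈ 𝒜) (hne : ∃ X ∈ 𝒜, X ≠ 0) :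
    ∃ e ∈ 𝒜, eᴴ = e ∧ e * e = e ∧ e ≠ 0 ∧ ∀ X ∈ 𝒜, ∃ c : ℂ, e * X * e = c • e := by
  -- Cartesian decomposition into Hermitian elements
  have hcart : ∀ X ∈ 𝒜, ∃ H ∈ 𝒜, ∃ H' ∈ 𝒜, Hᴴ = H ∧ H'ᴴ = H' ∧ X = H + Complex.I • H' := by
    intro X hX
    refine ⟨(1 / 2 : ℂ) • (X + Xᴴ), 𝒜.smul_mem _ (𝒜.add_mem hX (hstar X hX)),
      (-Complex.I / 2) • (X - Xᴴ), 𝒜.smul_mem _ (𝒜.sub_mem hX (hstar X hX)), ?_, ?_, ?_⟩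
    · rw [conjTranspose_smul, conjTranspose_add, conjTranspose_conjTranspose, add_comm]
      simp
    · rw [conjTranspose_smul, conjTranspose_sub, conjTranspose_conjTranspose, ← neg_sub X Xᴴ,
        smul_neg, ← neg_smul]
      congr 1
      simp
      ring
    · rw [smul_smul]
      have : Complex.I * (-Complex.I / 2) = 1 / 2 := by
        rw [mul_div_assoc', mul_neg, Complex.I_mul_I, neg_neg]
      rw [this, ← smul_add, add_add_sub_cancel, ← two_smul ℂ X, smul_smul]
      norm_num
  -- a nonzero Hermitian element `k` of smallest rank is a multiple of a projection
  have hex : ∃ r : ℕ, ∃ k ∈ 𝒜, kᴴ = k ∧ k ≠ 0 ∧ k.rank = r := by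
    obtain ⟨X, hX, hX0⟩ := hne
    obtain ⟨H, hH, H', hH', h1, h2, h3⟩ := hcart X hX
    by_cases h : H = 0
    · refine ⟨_, H', hH', h2, fun h' => hX0 ?_, rfl⟩
      rw [h3, h, h', smul_zero, add_zero]
    · exact ⟨_, H, hH, h1, h, rfl⟩
  classical
  obtain ⟨k, hk, hkh, hk0, hkr⟩ := Nat.find_spec hex
  have hmin : ∀ H ∈ 𝒜, Hᴴ = H → H.rank < k.rank → H = 0 := by
    intro H hH hHh hlt
    by_contra h0
    rw [hkr] at hlt
    exact Nat.find_min hex hlt ⟨H, hH, hHh, h0, rfl⟩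
  obtain ⟨v, t, ht, hv, htv⟩ := IsHermitian.exists_eigenvector_of_ne_zero (A := k) hkh hk0
  have htC : (t : ℂ) ≠ 0 := by exact_mod_cast ht
  have hk2 : k * k = (t : ℂ) • k := by
    -- `k ^ 2 - t k` has smaller rank than `k`, as it also annihilates the eigenvector `v`
    have h1 : (k - (t : ℂ) • 1) * k = 0 := by
      have h2 : (k - (t : ℂ) • 1) * k = k * k - (t : ℂ) • k := by
        rw [Matrix.sub_mul, Matrix.smul_mul, Matrix.one_mul]
      refine hmin _ ?_ ?_ (rank_mul_lt (v := v) ?_ ?_)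
      · rw [h2]
        exact 𝒜.sub_mem (hmul k hk k hk) (𝒜.smul_mem _ hk)
      · rw [h2, conjTranspose_sub, conjTranspose_smul, conjTranspose_mul, hkh, Complex.star_def,
          Complex.conj_ofReal]
      · rw [h2, sub_mulVec, ← mulVec_mulVec, htv, smul_mulVec, htv]
        have : k *ᵥ (t • v) = t • (k *ᵥ v) := mulVec_smul k t v
        rw [this, htv]
        ext i
        simp
      · rw [htv]
        exact smul_ne_zero ht hv
    rw [Matrix.sub_mul, Matrix.smul_mul, Matrix.one_mul, sub_eq_zero] at h1
    exact h1
  obtain ⟨e, he⟩ : ∃ e, e = (t : ℂ)⁻¹ • k := ⟨_, rfl⟩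
  have hkerr : e.rank ≤ k.rank := by
    have : e = ((t : ℂ)⁻¹ • (1 : Matrix n n ℂ)) * k := by
      rw [he, Matrix.smul_mul, Matrix.one_mul]
    rw [this]
    exact rank_mul_le_right _ _
  have heA : e ∈ 𝒜 := he ▸ 𝒜.smul_mem _ hk
  have heh : eᴴ = e := by
    rw [he, conjTranspose_smul, hkh, star_inv₀, Complex.star_def, Complex.conj_ofReal]
  have hee : e * e = e := by
    rw [he, Matrix.smul_mul, Matrix.mul_smul, hk2, smul_smul, smul_smul, mul_assoc,
      inv_mul_cancel₀ htC, mul_one]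
  have he0 : e ≠ 0 := he ▸ smul_ne_zero (inv_ne_zero htC) hk0
  have hherm : ∀ H ∈ 𝒜, Hᴴ = H → ∃ c : ℂ, e * H * e = c • e := by
    intro H hH hHh
    by_cases h0 : e * H * e = 0
    · exact ⟨0, by rw [h0, zero_smul]⟩
    have hMh : (e * H * e)ᴴ = e * H * e := by
      rw [conjTranspose_mul, conjTranspose_mul, heh, hHh, Matrix.mul_assoc]
    have hMA : e * H * e ∈ 𝒜 := hmul _ (hmul _ heA _ hH) _ heA
    obtain ⟨w, s, hs, hw, hsw⟩ := IsHermitian.exists_eigenvector_of_ne_zero (A := e * H * e) hMh h0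
    refine ⟨(s : ℂ), ?_⟩
    -- `e H e - s e` has smaller rank than `e`, as it also annihilates the eigenvector `w`
    have hew : e *ᵥ w = w := by
      have h1 : e *ᵥ (s • w) = s • w := by
        rw [← hsw, mulVec_mulVec]
        congr 1
        rw [← Matrix.mul_assoc, ← Matrix.mul_assoc, hee]
      have h2 : e *ᵥ (s • w) = s • (e *ᵥ w) := mulVec_smul e s w
      rw [h2] at h1
      exact smul_right_injective _ hs h1
    have h3 : (e * H - (s : ℂ) • 1) * e = e * H * e - (s : ℂ) • e := by
      rw [Matrix.sub_mul, Matrix.smul_mul, Matrix.one_mul]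
    have h4 : (e * H - (s : ℂ) • 1) * e = 0 := by
      refine hmin _ ?_ ?_ (lt_of_lt_of_le (rank_mul_lt (v := w) ?_ ?_) hkerr)
      · rw [h3]
        exact 𝒜.sub_mem hMA (𝒜.smul_mem _ heA)
      · rw [h3, conjTranspose_sub, hMh, conjTranspose_smul, heh, Complex.star_def,
          Complex.conj_ofReal]
      · rw [h3, sub_mulVec, hsw, smul_mulVec, hew]
        ext i
        simp
      · rw [hew]
        exact hw
    rw [h3, sub_eq_zero] at h4
    exact h4
  refine ⟨e, heA, heh, hee, he0, fun X hX => ?_⟩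
  obtain ⟨H, hH, H', hH', h1, h2, h3⟩ := hcart X hX
  obtain ⟨c, hc⟩ := hherm H hH h1
  obtain ⟨c', hc'⟩ := hherm H' hH' h2
  refine ⟨c + Complex.I * c', ?_⟩
  rw [h3, Matrix.mul_add, Matrix.add_mul, Matrix.mul_smul, Matrix.smul_mul, hc, hc', smul_smul,
    add_smul]

/-- A *-algebra `𝒩` of matrices with unit `P`, on which the positive matrix `S` with support `P`
and pseudo-inverse `S'` acts by modular automorphisms `X ↦ S X S'`. -/
structure IsModularAlgebra (𝒩 : Submodule ℂ (Matrix n n ℂ)) (S S' P : Matrix n n ℂ) : Prop where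
  posSemidef : S.PosSemidef
  mul_inv : S * S' = P
  inv_mul : S' * S = P
  unit_mem : P ∈ 𝒩
  unit_mul : ∀ X ∈ 𝒩, P * X = X
  mul_unit : ∀ X ∈ 𝒩, X * P = X
  mul_mem : ∀ X ∈ 𝒩, ∀ Y ∈ 𝒩, X * Y ∈ 𝒩
  star_mem : ∀ X ∈ 𝒩, Xᴴ ∈ 𝒩
  modular_mem : ∀ X ∈ 𝒩, S * X * S' ∈ 𝒩

namespace IsModularAlgebra

variable {𝒩 : Submodule ℂ (Matrix n n ℂ)} {S S' P : Matrix n n ℂ}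

variable (h : IsModularAlgebra 𝒩 S S' P)
include h

/-- The trace against `S` is faithful on `𝒩`. -/
lemma eq_zero_of_trace {X : Matrix n n ℂ} (hX : X ∈ 𝒩) (h0 : (S * (Xᴴ * X)).trace = 0) :
    X = 0 := by
  have h1 : matSqrt S * Xᴴ = 0 := by
    refine mul_eq_zero_of_conj_trace h.posSemidef ?_
    rw [conjTranspose_conjTranspose, Matrix.mul_assoc, trace_mul_comm, Matrix.mul_assoc]
    exact h0
  have h2 : X * S = 0 := by
    have h3 := congrArg conjTranspose h1
    rw [conjTranspose_mul, conjTranspose_conjTranspose, conjTranspose_matSqrt h.posSemidef,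
      conjTranspose_zero] at h3
    rw [← matSqrt_mul_self h.posSemidef, ← Matrix.mul_assoc, h3, Matrix.zero_mul]
  rw [← h.mul_unit X hX, ← h.mul_inv, ← Matrix.mul_assoc, h2, Matrix.zero_mul]

lemma trace_projection_ne_zero {e : Matrix n n ℂ} (he : e ∈ 𝒩) (heh : eᴴ = e) (hee : e * e = e)
    (he0 : e ≠ 0) : (S * e).trace ≠ 0 := by
  intro h0
  refine he0 (h.eq_zero_of_trace he ?_)
  rw [heh, hee, h0]

lemma commute_inv {e : Matrix n n ℂ} (he : e ∈ 𝒩) (hc : e * S = S * e) : e * S' = S' * e := by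
  have h1 : S' * (e * S) * S' = S' * (S * e) * S' := by rw [hc]
  rw [← Matrix.mul_assoc S' S, h.inv_mul, h.unit_mul e he, Matrix.mul_assoc, Matrix.mul_assoc e,
    h.mul_inv, h.mul_unit e he] at h1
  exact h1.symm

/-- A projection commuting with `S` that is minimal among such elements of `𝒩` is minimal in `𝒩`:
otherwise the modular automorphism would have an eigenvector in `e 𝒩 e` orthogonal to `e`, which
would be a multiple of a unitary of `e 𝒩 e` that commutes with `S`. -/
lemma minimal_of_centralizer_minimal {e : Matrix n n ℂ} (he : e ∈ 𝒩) (heh : eᴴ = e)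
    (hee : e * e = e) (he0 : e ≠ 0) (hc : e * S = S * e)
    (hmin : ∀ X ∈ 𝒩, X * S = S * X → ∃ c : ℂ, e * X * e = c • e) :
    ∀ X ∈ 𝒩, ∃ c : ℂ, e * X * e = c • e := by
  have hSh := h.posSemidef.isHermitian.eq
  have hSe := h.trace_projection_ne_zero he heh hee he0
  have hc' := h.commute_inv he hc
  have htre : e.trace ≠ 0 := by
    intro h0
    refine he0 ?_
    rw [← trace_conjTranspose_mul_self_eq_zero_iff, heh, hee, h0]
  -- the part of `e 𝒩 e` that is orthogonal to `e` in the inner product `Tr S X† Y`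
  let 𝒦 : Submodule ℂ (Matrix n n ℂ) :=
    { carrier := {X | X ∈ 𝒩 ∧ e * X = X ∧ X * e = X ∧ (S * X).trace = 0}
      add_mem' := by
        rintro X Y ⟨h1, h2, h3, h4⟩ ⟨h1', h2', h3', h4'⟩
        refine ⟨𝒩.add_mem h1 h1', by rw [Matrix.mul_add, h2, h2'], by rw [Matrix.add_mul, h3, h3'],
          by rw [Matrix.mul_add, trace_add, h4, h4', add_zero]⟩
      zero_mem' := ⟨𝒩.zero_mem, by simp, by simp, by simp⟩
      smul_mem' := by
        rintro c X ⟨h1, h2, h3, h4⟩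
        exact ⟨𝒩.smul_mem c h1, by rw [Matrix.mul_smul, h2], by rw [Matrix.smul_mul, h3],
          by rw [Matrix.mul_smul, trace_smul, h4, smul_zero]⟩ }
  have hbot : 𝒦 = ⊥ := by
    by_contra hne
    have : Nontrivial 𝒦 := Submodule.nontrivial_iff_ne_bot.mpr hne
    let Δ₀ : Matrix n n ℂ →ₗ[ℂ] Matrix n n ℂ :=
      { toFun := fun X => S * X * S'
        map_add' := fun X Y => by rw [Matrix.mul_add, Matrix.add_mul]
        map_smul' := fun c X => by rw [Matrix.mul_smul, Matrix.smul_mul, RingHom.id_apply] }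
    have hΔ : ∀ X ∈ 𝒦, Δ₀ X ∈ 𝒦 := by
      rintro X ⟨h1, h2, h3, h4⟩
      refine ⟨h.modular_mem X h1, ?_, ?_, ?_⟩
      · change e * (S * X * S') = S * X * S'
        rw [← Matrix.mul_assoc, ← Matrix.mul_assoc, hc, Matrix.mul_assoc S, h2]
      · change S * X * S' * e = S * X * S'
        rw [Matrix.mul_assoc, ← hc', ← Matrix.mul_assoc, Matrix.mul_assoc S, h3]
      · change (S * (S * X * S')).trace = 0
        rw [← Matrix.mul_assoc, trace_mul_comm, ← Matrix.mul_assoc, ← Matrix.mul_assoc, h.inv_mul,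
          Matrix.mul_assoc, trace_mul_comm, Matrix.mul_assoc, h.mul_unit X h1, h4]
    -- an eigenvector `u` of the modular automorphism
    obtain ⟨μ, hμ⟩ := Module.End.exists_eigenvalue (Δ₀.restrict hΔ)
    obtain ⟨⟨u, hu𝒩, heu, hue, hSu⟩, hμu⟩ := hμ.exists_hasEigenvector
    have hu0 : u ≠ 0 := fun h0 => hμu.2 (Subtype.ext h0)
    have hΔu : S * u * S' = μ • u := congrArg Subtype.val hμu.apply_eq_smul
    have hSuμ : S * u = μ • (u * S) := by
      have h1 := congrArg (· * S) hΔu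
      simp only [Matrix.smul_mul] at h1
      rw [Matrix.mul_assoc, h.inv_mul, Matrix.mul_assoc, h.mul_unit u hu𝒩] at h1
      exact h1
    have hμ0 : μ ≠ 0 := by
      intro h0
      rw [h0, zero_smul] at hSuμ
      apply hu0
      rw [← h.unit_mul u hu𝒩, ← h.inv_mul, Matrix.mul_assoc, hSuμ, Matrix.mul_zero]
    have hμs : star μ ≠ 0 := star_ne_zero.mpr hμ0
    have huS : S * uᴴ = (star μ)⁻¹ • (uᴴ * S) := by
      have h1 := congrArg conjTranspose hSuμ
      rw [conjTranspose_mul, conjTranspose_smul, conjTranspose_mul, hSh] at h1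
      rw [h1, smul_smul, inv_mul_cancel₀ hμs, one_smul]
    -- `μ` is real, since `S uᴴ u` and `uᴴ u S` have the same nonzero trace; so `uᴴ u` and `u uᴴ`
    -- commute with `S` and are multiples of `e`
    have htr : (S * (uᴴ * u)).trace ≠ 0 := fun h0 => hu0 (h.eq_zero_of_trace hu𝒩 h0)
    have h1 : S * (uᴴ * u) = ((star μ)⁻¹ * μ) • (uᴴ * u * S) := by
      rw [← Matrix.mul_assoc, huS, Matrix.smul_mul, Matrix.mul_assoc, hSuμ, Matrix.mul_smul,
        smul_smul, Matrix.mul_assoc]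
    have hμreal : (star μ)⁻¹ * μ = 1 := by
      have h2 := congrArg trace h1
      rw [trace_smul, trace_mul_comm (uᴴ * u) S, smul_eq_mul] at h2
      exact (mul_eq_right₀ htr).mp h2.symm
    rw [hμreal, one_smul] at h1
    have h2 : S * (u * uᴴ) = u * uᴴ * S := by
      rw [← Matrix.mul_assoc, hSuμ, Matrix.smul_mul, Matrix.mul_assoc, huS, Matrix.mul_smul,
        smul_smul, mul_comm, hμreal, one_smul, Matrix.mul_assoc]
    have heuh : e * uᴴ = uᴴ := by
      have h3 := congrArg conjTranspose hue
      rwa [conjTranspose_mul, heh] at h3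
    have huhe : uᴴ * e = uᴴ := by
      have h3 := congrArg conjTranspose heu
      rwa [conjTranspose_mul, heh] at h3
    obtain ⟨c, hcu⟩ := hmin (uᴴ * u) (h.mul_mem _ (h.star_mem _ hu𝒩) _ hu𝒩) h1.symm
    obtain ⟨c', hcu'⟩ := hmin (u * uᴴ) (h.mul_mem _ hu𝒩 _ (h.star_mem _ hu𝒩)) h2.symm
    rw [← Matrix.mul_assoc, heuh, Matrix.mul_assoc, hue] at hcu
    rw [← Matrix.mul_assoc, heu, Matrix.mul_assoc, huhe] at hcu'
    have hcc : c = c' := by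
      have h3 := trace_mul_comm uᴴ u
      rw [hcu, hcu', trace_smul, trace_smul, smul_eq_mul, smul_eq_mul] at h3
      exact mul_right_cancel₀ htre h3
    have hc0 : c ≠ 0 := by
      intro h0
      rw [hcu, h0, zero_smul, Matrix.mul_zero, trace_zero] at htr
      exact htr rfl
    -- comparing `Tr S u uᴴ` with `Tr S uᴴ u` gives `μ = 1`: then `u` itself commutes with `S`, so
    -- it is a multiple of `e`, in contradiction to its orthogonality to `e`
    have hμ1 : μ = 1 := by
      have h3 : (S * (u * uᴴ)).trace = μ * (S * (uᴴ * u)).trace := by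
        rw [← Matrix.mul_assoc, hSuμ, Matrix.smul_mul, trace_smul, smul_eq_mul, trace_mul_comm,
          ← Matrix.mul_assoc, trace_mul_comm]
      rw [hcu, hcu', ← hcc, Matrix.mul_smul, trace_smul] at h3
      exact (mul_eq_right₀ (smul_ne_zero hc0 hSe)).mp h3.symm
    rw [hμ1, one_smul] at hSuμ
    obtain ⟨d, hd⟩ := hmin u hu𝒩 hSuμ.symm
    rw [heu, hue] at hd
    rw [hd, Matrix.mul_smul, trace_smul, smul_eq_mul, mul_eq_zero] at hSu
    rw [hSu.resolve_right hSe, zero_smul] at hd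
    exact hu0 hd
  intro X hX
  set x := e * X * e with hx
  have hx𝒩 : x ∈ 𝒩 := h.mul_mem _ (h.mul_mem _ he _ hX) _ he
  have hex : e * x = x := by rw [hx, ← Matrix.mul_assoc, ← Matrix.mul_assoc, hee]
  have hxe : x * e = x := by rw [hx, Matrix.mul_assoc, hee]
  refine ⟨(S * x).trace / (S * e).trace, ?_⟩
  have hmem : x - ((S * x).trace / (S * e).trace) • e ∈ 𝒦 := by
    refine ⟨𝒩.sub_mem hx𝒩 (𝒩.smul_mem _ he), ?_, ?_, ?_⟩
    · rw [Matrix.mul_sub, hex, Matrix.mul_smul, hee]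
    · rw [Matrix.sub_mul, hxe, Matrix.smul_mul, hee]
    · rw [Matrix.mul_sub, Matrix.mul_smul, trace_sub, trace_smul, smul_eq_mul,
        div_mul_cancel₀ _ hSe, sub_self]
  rw [hbot, Submodule.mem_bot, sub_eq_zero] at hmem
  exact hmem

/-- Every projection of `𝒩` that commutes with `S` is a sum of orthogonal minimal projections of
`𝒩` that commute with `S`. -/
lemma exists_minimal_family {p : Matrix n n ℂ} (hp : p ∈ 𝒩) (hph : pᴴ = p) (hpp : p * p = p)
    (hpc : p * S = S * p) :
    ∃ (ι : Type) (_ : Fintype ι) (_ : DecidableEq ι) (e : ι → Matrix n n ℂ),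
      (∀ i, e i ∈ 𝒩 ∧ (e i)ᴴ = e i ∧ e i * e i = e i ∧ e i ≠ 0 ∧ e i * S = S * e i ∧
        p * e i = e i ∧ ∀ X ∈ 𝒩, ∃ c : ℂ, e i * X * e i = c • e i) ∧
      (∀ i j, i ≠ j → e i * e j = 0) ∧ ∑ i, e i = p := by
  induction hr : p.rank using Nat.strong_induction_on generalizing p with
  | _ r ih =>
  by_cases hp0 : p = 0
  · exact ⟨PEmpty, inferInstance, inferInstance, PEmpty.elim, fun i => i.elim, fun i => i.elim,
      by rw [hp0]; rfl⟩
  -- the elements of `p 𝒩 p` that commute with `S`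
  let 𝒜 : Submodule ℂ (Matrix n n ℂ) :=
    { carrier := {X | X ∈ 𝒩 ∧ X * S = S * X ∧ p * X = X ∧ X * p = X}
      add_mem' := by
        rintro X Y ⟨h1, h2, h3, h4⟩ ⟨h1', h2', h3', h4'⟩
        exact ⟨𝒩.add_mem h1 h1', by rw [Matrix.mul_add, Matrix.add_mul, h2, h2'],
          by rw [Matrix.mul_add, h3, h3'], by rw [Matrix.add_mul, h4, h4']⟩
      zero_mem' := ⟨𝒩.zero_mem, by simp, by simp, by simp⟩
      smul_mem' := by
        rintro c X ⟨h1, h2, h3, h4⟩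
        exact ⟨𝒩.smul_mem c h1, by rw [Matrix.mul_smul, Matrix.smul_mul, h2],
          by rw [Matrix.mul_smul, h3], by rw [Matrix.smul_mul, h4]⟩ }
  have hSh := h.posSemidef.isHermitian.eq
  obtain ⟨e, ⟨he, hec, hpe, hep⟩, heh, hee, he0, hmin⟩ := exists_minimal_projection 𝒜
    (by
      rintro X ⟨h1, h2, h3, h4⟩ Y ⟨h1', h2', h3', h4'⟩
      refine ⟨h.mul_mem _ h1 _ h1', ?_, ?_, ?_⟩
      · rw [Matrix.mul_assoc, h2', ← Matrix.mul_assoc, h2, Matrix.mul_assoc]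
      · rw [← Matrix.mul_assoc, h3]
      · rw [Matrix.mul_assoc, h4'])
    (by
      rintro X ⟨h1, h2, h3, h4⟩
      refine ⟨h.star_mem _ h1, ?_, ?_, ?_⟩
      · have h5 := congrArg conjTranspose h2
        rw [conjTranspose_mul, conjTranspose_mul, hSh] at h5
        exact h5.symm
      · have h5 := congrArg conjTranspose h4
        rwa [conjTranspose_mul, hph] at h5
      · have h5 := congrArg conjTranspose h3
        rwa [conjTranspose_mul, hph] at h5)
    ⟨p, ⟨hp, hpc, hpp, hpp⟩, hp0⟩
  have hmin' : ∀ X ∈ 𝒩, ∃ c : ℂ, e * X * e = c • e := by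
    refine h.minimal_of_centralizer_minimal he heh hee he0 hec fun X hX hXc => ?_
    obtain ⟨c, hc⟩ := hmin (p * X * p) ⟨h.mul_mem _ (h.mul_mem _ hp _ hX) _ hp, by
      rw [Matrix.mul_assoc, hpc, ← Matrix.mul_assoc, Matrix.mul_assoc p, hXc, ← Matrix.mul_assoc,
        hpc, Matrix.mul_assoc S, Matrix.mul_assoc S], by
      rw [← Matrix.mul_assoc, ← Matrix.mul_assoc, hpp], by rw [Matrix.mul_assoc, hpp]⟩
    refine ⟨c, ?_⟩
    rw [← hc]
    calc e * X * e = (e * p) * X * (p * e) := by rw [hep, hpe]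
      _ = _ := by simp only [Matrix.mul_assoc]
  -- split off `e` from `p`
  have hq : p - e = (1 - e) * p := by rw [Matrix.sub_mul, Matrix.one_mul, hep]
  have hlt : (p - e).rank < r := by
    rw [← hr, hq]
    have hne : ∃ v, e *ᵥ v ≠ 0 := by
      by_contra! hall
      exact he0 (ext_of_mulVec_single fun j => by rw [hall, zero_mulVec])
    obtain ⟨v, hv⟩ := hne
    refine rank_mul_lt (v := e *ᵥ v) ?_ ?_
    · rw [← hq, sub_mulVec, mulVec_mulVec, mulVec_mulVec, hpe, hee, sub_self]
    · rw [mulVec_mulVec, hpe]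
      exact hv
  obtain ⟨ι, hι, hι', f, hf1, hf2, hf3⟩ := ih _ hlt (p := p - e) (𝒩.sub_mem hp he)
    (by rw [conjTranspose_sub, hph, heh])
    (by rw [Matrix.mul_sub, Matrix.sub_mul, Matrix.sub_mul, hpp, hep, hpe, hee, sub_self, sub_zero])
    (by rw [Matrix.sub_mul, Matrix.mul_sub, hpc, hec]) rfl
  have hef : ∀ i, e * f i = 0 := by
    intro i
    rw [← (hf1 i).2.2.2.2.2.1, ← Matrix.mul_assoc, Matrix.mul_sub, hep, hee, sub_self,
      Matrix.zero_mul]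
  have hfe : ∀ i, f i * e = 0 := by
    intro i
    have h1 := congrArg conjTranspose (hef i)
    rwa [conjTranspose_mul, heh, (hf1 i).2.1, conjTranspose_zero] at h1
  refine ⟨Option ι, inferInstance, inferInstance, fun i => i.elim e f, ?_, ?_, ?_⟩
  · rintro (_ | i)
    · exact ⟨he, heh, hee, he0, hec, hpe, hmin'⟩
    · obtain ⟨h1, h2, h3, h4, h5, h6, h7⟩ := hf1 i
      refine ⟨h1, h2, h3, h4, h5, ?_, h7⟩
      change p * f i = f i
      rw [Matrix.sub_mul, hef, sub_zero] at h6
      exact h6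
  · rintro (_ | i) (_ | j) hij
    · exact absurd rfl hij
    · exact hef j
    · exact hfe i
    · exact hf2 i j fun h' => hij (by rw [h'])
  · rw [Fintype.sum_option]
    change e + ∑ i, f i = p
    rw [hf3, add_sub_cancel]

end IsModularAlgebra

end MinimalProjections

/-! ### Matrix units scaled by the modular automorphism -/

section MatrixUnits

variable {n : Type} [Fintype n] [DecidableEq n]

lemma exists_pos_of_nonneg_ne_zero {z : ℂ} (h : 0 ≤ z) (h0 : z ≠ 0) : ∃ t : ℝ, 0 < t ∧ z = t := by
  have h1 : 0 < z := lt_of_le_of_ne h h0.symm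
  rw [Complex.lt_def] at h1
  exact ⟨z.re, h1.1, Complex.ext rfl h1.2.symm⟩

namespace IsModularAlgebra

variable {𝒩 : Submodule ℂ (Matrix n n ℂ)} {S S' P : Matrix n n ℂ}

/-- The nonzero corner `e 𝒩 f` between two minimal projections is spanned by a partial isometry,
and a positive `S` commuting with `e` and `f` scales that partial isometry. -/
lemma exists_partial_isometry (h : IsModularAlgebra 𝒩 S S' P) {e f X : Matrix n n ℂ} (he : e ∈ 𝒩)
    (heh : eᴴ = e) (hee : e * e = e) (hec : e * S = S * e)
    (hemin : ∀ X ∈ 𝒩, ∃ c : ℂ, e * X * e = c • e)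
    (hf : f ∈ 𝒩) (hfh : fᴴ = f) (hff : f * f = f) (hf0 : f ≠ 0) (hfc : f * S = S * f)
    (hfmin : ∀ X ∈ 𝒩, ∃ c : ℂ, f * X * f = c • f) (hX : X ∈ 𝒩) (hX0 : e * X * f ≠ 0) :
    ∃ v ∈ 𝒩, ∃ μ : ℝ, 0 < μ ∧ vᴴ * v = f ∧ v * vᴴ = e ∧ v * f = v ∧ e * v = v ∧
      S * v = (μ : ℂ) • (v * S) := by
  obtain ⟨x, hx⟩ : ∃ x, x = e * X * f := ⟨_, rfl⟩
  rw [← hx] at hX0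
  have hx𝒩 : x ∈ 𝒩 := hx ▸ h.mul_mem _ (h.mul_mem _ he _ hX) _ hf
  have hex : e * x = x := by rw [hx, ← Matrix.mul_assoc, ← Matrix.mul_assoc, hee]
  have hxf : x * f = x := by rw [hx, Matrix.mul_assoc, hff]
  have hfx : f * xᴴ = xᴴ := by
    have h1 := congrArg conjTranspose hxf
    rwa [conjTranspose_mul, hfh] at h1
  -- `xᴴ x` is a positive multiple `c` of `f`; then `v = x / √c` is the partial isometry
  obtain ⟨c, hc⟩ := hfmin (xᴴ * x) (h.mul_mem _ (h.star_mem _ hx𝒩) _ hx𝒩)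
  rw [← Matrix.mul_assoc, hfx, Matrix.mul_assoc, hxf] at hc
  have hxx0 : xᴴ * x ≠ 0 := fun h0 => hX0 (conjTranspose_mul_self_eq_zero.mp h0)
  have hftr : 0 ≤ f.trace := by
    have h1 := (posSemidef_conjTranspose_mul_self f).trace_nonneg
    rwa [hfh, hff] at h1
  have hftr0 : f.trace ≠ 0 := by
    intro h0
    refine hf0 ?_
    rw [← trace_conjTranspose_mul_self_eq_zero_iff, hfh, hff, h0]
  have hc0 : c ≠ 0 := by
    intro h0
    rw [hc, h0, zero_smul] at hxx0
    exact hxx0 rfl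
  have hcnn : 0 ≤ c := by
    have h1 := (posSemidef_conjTranspose_mul_self x).trace_nonneg
    rw [hc, trace_smul, smul_eq_mul] at h1
    obtain ⟨t, ht, htt⟩ := exists_pos_of_nonneg_ne_zero hftr hftr0
    rw [htt] at h1
    have h2 := mul_nonneg h1 (show (0 : ℂ) ≤ ((t⁻¹ : ℝ) : ℂ) from by
      exact_mod_cast (inv_pos.mpr ht).le)
    rwa [mul_assoc, ← Complex.ofReal_mul, mul_inv_cancel₀ ht.ne', Complex.ofReal_one, mul_one] at h2
  obtain ⟨t, ht, rfl⟩ := exists_pos_of_nonneg_ne_zero hcnn hc0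
  obtain ⟨s, hs⟩ : ∃ s : ℝ, s = (Real.sqrt t)⁻¹ := ⟨_, rfl⟩
  have hs0 : (s : ℂ) ≠ 0 := by
    rw [hs]
    exact_mod_cast (inv_pos.mpr (Real.sqrt_pos.mpr ht)).ne'
  have hst : (s : ℂ) * (s * t) = 1 := by
    rw [hs]
    norm_cast
    rw [← mul_assoc, ← _root_.mul_inv, Real.mul_self_sqrt ht.le, inv_mul_cancel₀ ht.ne']
  obtain ⟨v, hv⟩ : ∃ v, v = (s : ℂ) • x := ⟨_, rfl⟩
  have hv𝒩 : v ∈ 𝒩 := hv ▸ 𝒩.smul_mem _ hx𝒩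
  have hev : e * v = v := by rw [hv, Matrix.mul_smul, hex]
  have hvf : v * f = v := by rw [hv, Matrix.smul_mul, hxf]
  have hve : vᴴ * e = vᴴ := by
    have h1 := congrArg conjTranspose hev
    rwa [conjTranspose_mul, heh] at h1
  have hfv : f * vᴴ = vᴴ := by
    have h1 := congrArg conjTranspose hvf
    rwa [conjTranspose_mul, hfh] at h1
  have hvv : vᴴ * v = f := by
    rw [hv, conjTranspose_smul, Matrix.smul_mul, Matrix.mul_smul, hc, smul_smul, smul_smul,
      Complex.star_def, Complex.conj_ofReal, mul_assoc, hst, one_smul]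
  have hv0 : v ≠ 0 := hv ▸ smul_ne_zero hs0 hX0
  have hvv' : v * vᴴ = e := by
    obtain ⟨c', hc'⟩ := hemin (v * vᴴ) (h.mul_mem _ hv𝒩 _ (h.star_mem _ hv𝒩))
    rw [← Matrix.mul_assoc, hev, Matrix.mul_assoc, hve] at hc'
    -- `v vᴴ` is a multiple of `e` and a nonzero idempotent, hence equal to `e`
    have h1 : v * vᴴ * (v * vᴴ) = v * vᴴ := by
      rw [Matrix.mul_assoc, ← Matrix.mul_assoc vᴴ, hvv, hfv]
    have h2 : v * vᴴ ≠ 0 := fun h0 => hv0 (self_mul_conjTranspose_eq_zero.mp h0)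
    rw [hc', Matrix.smul_mul, Matrix.mul_smul, hee, smul_smul, ← sub_eq_zero, ← sub_smul] at h1
    rw [hc'] at h2
    have h3 : c' * c' - c' = 0 := (smul_eq_zero.mp h1).resolve_right fun h0 => h2 (by
      rw [h0, smul_zero])
    have h4 : c' ≠ 0 := fun h0 => h2 (by rw [h0, zero_smul])
    have h5 : c' = 1 := by
      have : c' * (c' - 1) = 0 := by rw [mul_sub, mul_one, h3]
      exact sub_eq_zero.mp ((mul_eq_zero.mp this).resolve_left h4)
    rw [hc', h5, one_smul]
  -- `S v S'` lies in the corner `e 𝒩 f`, hence is a multiple of `v`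
  obtain ⟨d, hd⟩ := hfmin (vᴴ * (S * v * S'))
    (h.mul_mem _ (h.star_mem _ hv𝒩) _ (h.modular_mem _ hv𝒩))
  have hfc' := h.commute_inv hf hfc
  have hSv : S * v = d • (v * S) := by
    have h1 : v * (f * (vᴴ * (S * v * S')) * f) = S * v * S' := by
      calc _ = v * f * vᴴ * (S * v) * (S' * f) := by simp only [Matrix.mul_assoc]
        _ = e * S * v * (S' * f) := by rw [hvf, hvv']; simp only [Matrix.mul_assoc]
        _ = S * (e * v) * (f * S') := by rw [hec, hfc']; simp only [Matrix.mul_assoc]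
        _ = S * (v * f) * S' := by rw [hev]; simp only [Matrix.mul_assoc]
        _ = _ := by rw [hvf]
    rw [hd, Matrix.mul_smul, hvf] at h1
    have h2 := congrArg (· * S) h1
    simp only [Matrix.smul_mul] at h2
    rw [h2, Matrix.mul_assoc, h.inv_mul, Matrix.mul_assoc, h.mul_unit v hv𝒩]
  -- the multiple is the ratio of `Tr S v vᴴ` and `Tr S vᴴ v`, hence positive
  have hpos : ∀ y ∈ 𝒩, y ≠ 0 → ∃ r : ℝ, 0 < r ∧ (S * (yᴴ * y)).trace = r := by
    intro y hy hy0
    refine exists_pos_of_nonneg_ne_zero ?_ fun h0 => hy0 (h.eq_zero_of_trace hy h0)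
    rw [← Matrix.mul_assoc, trace_mul_comm, ← Matrix.mul_assoc]
    exact (h.posSemidef.mul_mul_conjTranspose_same y).trace_nonneg
  obtain ⟨r, hr, hrr⟩ := hpos v hv𝒩 hv0
  obtain ⟨r', hr', hrr'⟩ := hpos vᴴ (h.star_mem _ hv𝒩) (by simpa using hv0)
  have hdr : (r' : ℂ) = d * r := by
    rw [← hrr', ← hrr, conjTranspose_conjTranspose, ← Matrix.mul_assoc, hSv, Matrix.smul_mul,
      trace_smul, smul_eq_mul, ← Matrix.mul_assoc, trace_mul_comm (S * vᴴ), Matrix.mul_assoc]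
  refine ⟨v, hv𝒩, r' / r, div_pos hr' hr, hvv, hvv', hvf, hev, ?_⟩
  rw [hSv]
  congr 1
  have : (r : ℂ) ≠ 0 := by exact_mod_cast hr.ne'
  rw [Complex.ofReal_div, hdr, mul_div_cancel_right₀ _ this]

/-- The algebra `𝒩` has a system of matrix units `v l x (v l y)ᴴ` that are scaled by the modular
automorphism; `v l x` maps the reference projection `e l` of the `l`-th simple summand to the `x`-th
minimal projection of that summand. -/
theorem exists_matrixUnits (h : IsModularAlgebra 𝒩 S S' P) :
    ∃ (N : ℕ) (d : Fin N → ℕ) (e : Fin N → Matrix n n ℂ) (v : ∀ l, Fin (d l) → Matrix n n ℂ)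
      (μ : ∀ l, Fin (d l) → ℝ),
      (∀ l, e l ∈ 𝒩 ∧ (e l)ᴴ = e l ∧ e l * e l = e l ∧ e l ≠ 0 ∧ e l * S = S * e l ∧
        ∀ X ∈ 𝒩, ∃ c : ℂ, e l * X * e l = c • e l) ∧
      (∀ l m, l ≠ m → ∀ X ∈ 𝒩, e l * X * e m = 0) ∧
      (∀ l x, v l x ∈ 𝒩 ∧ 0 < μ l x ∧ v l x * e l = v l x ∧ S * v l x = (μ l x : ℂ) • (v l x * S)) ∧
      (∀ l x y, (v l x)ᴴ * v l y = if x = y then e l else 0) ∧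
      (∀ l, 0 < d l) ∧ ∑ l, ∑ x, v l x * (v l x)ᴴ = P := by
  classical
  obtain ⟨ι, _, _, e, he, horth, hsum⟩ := h.exists_minimal_family h.unit_mem
    (by
      have h1 := h.unit_mul _ (h.star_mem _ h.unit_mem)
      have h2 := congrArg conjTranspose h1
      rw [conjTranspose_mul, conjTranspose_conjTranspose] at h2
      rw [← h1, h2])
    (h.unit_mul _ h.unit_mem)
    (by
      have h1 : P * S = S * P := by
        conv_lhs => rw [← h.mul_inv, Matrix.mul_assoc, h.inv_mul]
      exact h1)
  -- minimal projections are equivalent if the corner between them is nonzero; the classes index the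
  -- simple summands, and a representative of each class is its reference projection
  let rel : Setoid ι :=
    { r := fun i j => ∃ X ∈ 𝒩, e i * X * e j ≠ 0
      iseqv := by
        refine ⟨fun i => ⟨e i, (he i).1, ?_⟩, ?_, ?_⟩
        · rw [(he i).2.2.1, (he i).2.2.1]
          exact (he i).2.2.2.1
        · rintro i j ⟨X, hX, hX0⟩
          refine ⟨Xᴴ, h.star_mem _ hX, fun h0 => hX0 ?_⟩
          have h1 := congrArg conjTranspose h0
          rwa [conjTranspose_mul, conjTranspose_mul, conjTranspose_conjTranspose, (he i).2.1,
            (he j).2.1, conjTranspose_zero, ← Matrix.mul_assoc] at h1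
        · rintro i j k ⟨X, hX, hX0⟩ ⟨Y, hY, hY0⟩
          obtain ⟨h1, h2, h3, -, h4, -, h5⟩ := he i
          obtain ⟨h1', h2', h3', h0', h4', -, h5'⟩ := he j
          obtain ⟨v, hv, -, -, hvv, -, hvj, hiv, -⟩ :=
            h.exists_partial_isometry h1 h2 h3 h4 h5 h1' h2' h3' h0' h4' h5' hX hX0
          refine ⟨v * Y, h.mul_mem _ hv _ hY, fun h0 => hY0 ?_⟩
          rw [← Matrix.mul_assoc, hiv] at h0
          rw [← hvv, Matrix.mul_assoc vᴴ, Matrix.mul_assoc vᴴ, h0, Matrix.mul_zero] }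
  let L := Quotient rel
  have hunit : ∀ i : ι, ∃ v ∈ 𝒩, ∃ μ : ℝ, 0 < μ ∧ vᴴ * v = e (Quotient.mk rel i).out ∧
      v * vᴴ = e i ∧ v * e (Quotient.mk rel i).out = v ∧ e i * v = v ∧
      S * v = (μ : ℂ) • (v * S) := by
    intro i
    obtain ⟨X, hX, hX0⟩ : rel.r i (Quotient.mk rel i).out :=
      rel.iseqv.symm (Quotient.mk_out (s := rel) i)
    obtain ⟨h1, h2, h3, -, h4, -, h5⟩ := he i
    obtain ⟨h1', h2', h3', h0', h4', -, h5'⟩ := he (Quotient.mk rel i).out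
    exact h.exists_partial_isometry h1 h2 h3 h4 h5 h1' h2' h3' h0' h4' h5' hX hX0
  choose v hv μ hμ hvv hvv' hvr hiv hSv using hunit
  let q := (Fintype.equivFin L).symm
  let g : ∀ l : Fin (Fintype.card L), Fin (Fintype.card {i // Quotient.mk rel i = q l}) →
      {i // Quotient.mk rel i = q l} := fun l => (Fintype.equivFin _).symm
  refine ⟨Fintype.card L, fun l => Fintype.card {i // Quotient.mk rel i = q l},
    fun l => e (q l).out, fun l x => v (g l x), fun l x => μ (g l x), ?_, ?_, ?_, ?_, ?_, ?_⟩
  · intro l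
    obtain ⟨h1, h2, h3, h4, h5, -, h6⟩ := he (q l).out
    exact ⟨h1, h2, h3, h4, h5, h6⟩
  · intro l m hlm X hX
    by_contra h0
    refine hlm (q.injective ?_)
    have h1 : rel.r (q l).out (q m).out := ⟨X, hX, h0⟩
    rw [← (q l).out_eq, ← (q m).out_eq]
    exact Quotient.sound (s := rel) h1
  · intro l x
    refine ⟨hv _, hμ _, ?_, hSv _⟩
    have h1 := hvr (g l x)
    rwa [(g l x).2] at h1
  · intro l x y
    split_ifs with hxy
    · rw [hxy, hvv, (g l y).2]
    · have hne : (g l x : ι) ≠ g l y := fun h0 =>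
        hxy ((Fintype.equivFin _).symm.injective (Subtype.ext h0))
      change (v (g l x))ᴴ * v (g l y) = 0
      rw [← hiv (g l x), ← hiv (g l y), conjTranspose_mul, (he _).2.1, Matrix.mul_assoc,
        ← Matrix.mul_assoc (e _), horth _ _ hne, Matrix.zero_mul, Matrix.mul_zero]
  · intro l
    exact Fintype.card_pos_iff.mpr ⟨⟨(q l).out, (q l).out_eq⟩⟩
  · rw [← hsum, ← Fintype.sum_fiberwise (Quotient.mk rel), ← q.sum_comp]
    refine Finset.sum_congr rfl fun l _ => ?_
    rw [← (Fintype.equivFin {i // Quotient.mk rel i = q l}).symm.sum_comp]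
    exact Finset.sum_congr rfl fun x _ => hvv' _

end IsModularAlgebra

end MatrixUnits

/-! ### Product structure of the blocks of `ρ` -/

section Blocks

variable {a b : Type} [Fintype a] [DecidableEq a] [Fintype b] [DecidableEq b]

lemma mul_matInvSqrt_sq {n : Type} [Fintype n] [DecidableEq n] {M : Matrix n n ℂ}
    (hM : M.PosSemidef) : M * (matInvSqrt M * matInvSqrt M) = supportProj M := by
  calc _ = matSqrt M * (matSqrt M * matInvSqrt M) * matInvSqrt M := by
        conv_lhs => rw [← Matrix.mul_assoc]
        congr 1
        rw [← Matrix.mul_assoc, matSqrt_mul_self hM]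
    _ = _ := by
        rw [matSqrt_mul_matInvSqrt hM, matSqrt_mul_supportProj hM, matSqrt_mul_matInvSqrt hM]

lemma matInvSqrt_sq_mul {n : Type} [Fintype n] [DecidableEq n] {M : Matrix n n ℂ}
    (hM : M.PosSemidef) : matInvSqrt M * matInvSqrt M * M = supportProj M := by
  have h1 := congrArg conjTranspose (mul_matInvSqrt_sq hM)
  rwa [conjTranspose_mul, conjTranspose_mul, conjTranspose_matInvSqrt hM, hM.isHermitian.eq,
    conjTranspose_supportProj hM] at h1

variable {ρ Q : Matrix (a × b) (a × b) ℂ}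

lemma IsFactorization.isModularAlgebra (h : IsFactorization ρ Q) :
    IsModularAlgebra (partnerAlgebra ρ) (traceRight ρ)
      (matInvSqrt (traceRight ρ) * matInvSqrt (traceRight ρ)) (supportProj (traceRight ρ)) where
  posSemidef := posSemidef_traceRight h.posSemidef
  mul_inv := mul_matInvSqrt_sq (posSemidef_traceRight h.posSemidef)
  inv_mul := matInvSqrt_sq_mul (posSemidef_traceRight h.posSemidef)
  unit_mem := supportProj_mem_partnerAlgebra h.posSemidef
  unit_mul := fun _ hX => hX.1
  mul_unit := fun _ hX => hX.2.1
  mul_mem := fun _ hX _ hY => mul_mem_partnerAlgebra hX hY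
  star_mem := fun _ hX => h.conjTranspose_mem hX
  modular_mem := fun _ hX => h.modular_mem hX

/-- An operator on `A ⊗ B` is determined by its `A`-slices. -/
lemma eq_of_sliceA {M M' : Matrix (a × b) (a × b) ℂ} (h : ∀ Z, sliceA M Z = sliceA M' Z) :
    M = M' := by
  apply realign_injective
  refine ext_of_mulVec_single fun q => ?_
  ext ⟨i, j⟩
  obtain ⟨w, hw⟩ : ∃ w : b × b → ℂ, w = Pi.single q 1 := ⟨_, rfl⟩
  have h1 := congrFun (congrFun (h (Matrix.of fun x y => w (y, x))) i) j
  rw [sliceA_apply, sliceA_apply] at h1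
  rw [← hw]
  exact h1

/-- Operators with the same action on `Ψ Ψ†` have the same action on `Ψ`. -/
lemma mul_eq_mul_of_purification {n c : Type} [Fintype n] [Fintype c] {M X Y : Matrix n n ℂ}
    {Ψ : Matrix n c ℂ} (hΨ : M = Ψ * Ψᴴ) (h : X * M = Y * M) : X * Ψ = Y * Ψ := by
  rw [← sub_eq_zero, ← Matrix.sub_mul, ← self_mul_conjTranspose_eq_zero, conjTranspose_mul,
    Matrix.mul_assoc, ← Matrix.mul_assoc Ψ, ← hΨ, ← Matrix.mul_assoc, Matrix.sub_mul, h, sub_self,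
    Matrix.zero_mul]

/-- The partner of `X` reproduces the action of `X` on every purification of `ρ`. -/
lemma partner_spec_purification {c : Type} [Fintype c] {Ψ : Matrix (a × b) c ℂ} (hΨ : ρ = Ψ * Ψᴴ)
    {X : Matrix a a ℂ} (hX : X ∈ partnerAlgebra ρ) :
    (X ⊗ₖ (1 : Matrix b b ℂ)) * Ψ = ((1 : Matrix a a ℂ) ⊗ₖ partner ρ X) * Ψ :=
  mul_eq_mul_of_purification hΨ
    (partner_spec (hΨ ▸ posSemidef_self_mul_conjTranspose Ψ) hX)

lemma sliceA_sandwich (M : Matrix (a × b) (a × b) ℂ) (X X' : Matrix a a ℂ) (Z : Matrix b b ℂ) :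
    sliceA ((X ⊗ₖ (1 : Matrix b b ℂ)) * M * (X' ⊗ₖ (1 : Matrix b b ℂ))) Z =
      X * sliceA M Z * X' := by
  rw [sliceA, Matrix.mul_assoc, kron_one_comm_one_kron, ← Matrix.mul_assoc,
    Matrix.mul_assoc (X ⊗ₖ _), traceRight_mul_kron, traceRight_kron_mul, sliceA]

namespace IsFactorization

variable (h : IsFactorization ρ Q)
include h

/-- On eigenvectors of the modular automorphism the partner map respects adjoints up to a scalar. -/
lemma partner_conjTranspose {X : Matrix a a ℂ} (hX : X ∈ partnerAlgebra ρ) {μ : ℂ}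
    (hμ : traceRight ρ * X = μ • (X * traceRight ρ)) :
    (partner ρ Xᴴ)ᴴ = μ • partner ρ X := by
  rw [h.conjTranspose_partner (h.conjTranspose_mem hX), conjTranspose_conjTranspose, hμ,
    Matrix.smul_mul, Matrix.mul_assoc, mul_matInvSqrt_sq (posSemidef_traceRight h.posSemidef),
    hX.2.1, partner_smul]

/-- Since the slices of `ρ` come from the partner algebra, `ρ` has no corner where the algebra has
none. -/
lemma corner_eq_zero {e f : Matrix a a ℂ} (hf : f * traceRight ρ = traceRight ρ * f)
    (hef : ∀ X ∈ partnerAlgebra ρ, e * X * f = 0) :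
    (e ⊗ₖ (1 : Matrix b b ℂ)) * ρ * (f ⊗ₖ (1 : Matrix b b ℂ)) = 0 := by
  refine eq_of_sliceA fun Z => ?_
  obtain ⟨X, hX, hXZ⟩ := h.exists_sliceA_eq Z
  rw [sliceA_sandwich, hXZ, Matrix.mul_assoc, Matrix.mul_assoc, ← hf, ← Matrix.mul_assoc,
    ← Matrix.mul_assoc, hef X hX, Matrix.zero_mul]
  ext i j
  simp [sliceA, traceRight]

lemma partner_mul_traceLeft {e : Matrix a a ℂ} (he : e ∈ partnerAlgebra ρ) :
    partner ρ e * traceLeft ρ = traceLeft ((e ⊗ₖ (1 : Matrix b b ℂ)) * ρ) := by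
  rw [partner_spec h.posSemidef he, traceLeft_kron_mul]

/-- The corner of `ρ` at a minimal projection of the partner algebra is a product operator. -/
lemma corner_eq_kron {e : Matrix a a ℂ} (he : e ∈ partnerAlgebra ρ) (hee : e * e = e)
    (hec : e * traceRight ρ = traceRight ρ * e) (ht : (traceRight ρ * e).trace ≠ 0)
    (hmin : ∀ X ∈ partnerAlgebra ρ, ∃ c : ℂ, e * X * e = c • e) :
    (e ⊗ₖ (1 : Matrix b b ℂ)) * ρ * (e ⊗ₖ (1 : Matrix b b ℂ)) =
      (traceRight ρ * e).trace⁻¹ • ((e * traceRight ρ) ⊗ₖ (partner ρ e * traceLeft ρ)) := by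
  refine eq_of_sliceA fun Z => ?_
  obtain ⟨X, hX, hXZ⟩ := h.exists_sliceA_eq Z
  obtain ⟨c, hc⟩ := hmin X hX
  have h1 : e * sliceA ρ Z * e = c • (e * traceRight ρ) := by
    rw [hXZ, Matrix.mul_assoc, Matrix.mul_assoc, ← hec, ← Matrix.mul_assoc, ← Matrix.mul_assoc, hc,
      Matrix.smul_mul]
  have h2 : (partner ρ e * traceLeft ρ * Z).trace = c * (traceRight ρ * e).trace := by
    rw [h.partner_mul_traceLeft he, ← traceLeft_mul_kron, trace_traceLeft, ← trace_traceRight,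
      Matrix.mul_assoc, traceRight_kron_mul]
    change (e * sliceA ρ Z).trace = _
    have h3 := congrArg trace h1
    rw [trace_smul, smul_eq_mul, Matrix.mul_assoc, trace_mul_comm e (sliceA ρ Z * e),
      Matrix.mul_assoc, hee] at h3
    rw [trace_mul_comm (traceRight ρ), ← h3, trace_mul_comm]
  have h3 : ∀ (X : Matrix a a ℂ) (Y : Matrix b b ℂ), traceRight (X ⊗ₖ Y) = Y.trace • X := by
    intro X Y
    ext i j
    simp [traceRight, trace, ← Finset.mul_sum, mul_comm]
  rw [sliceA_sandwich, h1, sliceA, Matrix.smul_mul, ← mul_kronecker_mul, Matrix.mul_one]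
  have h4 : ∀ (r : ℂ) (M : Matrix (a × b) (a × b) ℂ), traceRight (r • M) = r • traceRight M := by
    intro r M
    ext i j
    simp [traceRight, Finset.mul_sum]
  rw [h4, h3, h2, smul_smul, mul_comm c, inv_mul_cancel_left₀ ht]

end IsFactorization

/-- A positive matrix that is invertible on the range of the projection `e` is diagonalized by an
isometry onto that range. -/
lemma exists_isometry_diagonal {n : Type} [Fintype n] [DecidableEq n] {M M' e : Matrix n n ℂ}
    (hM : M.PosSemidef) (heh : eᴴ = e) (heM : e * M = M) (hMe : M * M' = e) :
    ∃ (k : ℕ) (E : Matrix n (Fin k) ℂ) (s : Fin k → ℝ), (∀ i, 0 < s i) ∧ Eᴴ * E = 1 ∧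
      E * Eᴴ = e ∧ Eᴴ * M * E = diagonal fun i => (s i : ℂ) := by
  obtain ⟨U, d, hU, -, hd, hUM, -⟩ := exists_spectral_nonneg hM
  let g := (Fintype.equivFin {i // d i ≠ 0}).symm
  let E : Matrix n (Fin (Fintype.card {i // d i ≠ 0})) ℂ := U.submatrix id fun x => (g x : n)
  have hEE : Eᴴ * E = 1 := by
    have : Eᴴ * E = (Uᴴ * U).submatrix (fun x => (g x : n)) fun x => (g x : n) := by
      ext x y
      simp [E, Matrix.mul_apply]
    rw [this, hU]
    exact submatrix_one _ (Subtype.val_injective.comp g.injective)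
  have hME : M = E * diagonal (fun x => (d (g x) : ℂ)) * Eᴴ := by
    ext i j
    have h1 : ∀ {m : Type} [Fintype m] [DecidableEq m] (V : Matrix n m ℂ) (f : m → ℂ),
        (V * diagonal f * Vᴴ) i j = ∑ k, V i k * f k * star (V j k) := by
      intro m _ _ V f
      rw [Matrix.mul_apply]
      simp only [mul_diagonal, conjTranspose_apply]
    rw [hUM, h1, h1]
    refine (Fintype.sum_of_injective (fun x => (g x : n))
      (Subtype.val_injective.comp g.injective) _ _ (fun k hk => ?_) fun x => rfl).symm
    have : d k = 0 := by
      by_contra h0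
      exact hk ⟨g.symm ⟨k, h0⟩, by simp⟩
    rw [this, Complex.ofReal_zero, mul_zero, zero_mul]
  have hEM : Eᴴ * M = diagonal (fun x => (d (g x) : ℂ)) * Eᴴ := by
    conv_lhs => rw [hME, ← Matrix.mul_assoc, ← Matrix.mul_assoc, hEE, Matrix.one_mul]
  refine ⟨_, E, fun x => d (g x), fun x => lt_of_le_of_ne (hd _) (g x).2.symm, hEE, ?_, ?_⟩
  · have h1 : E * Eᴴ * M = M := by
      rw [Matrix.mul_assoc, hEM, ← Matrix.mul_assoc, ← hME]
    have h2 : E * Eᴴ * e = e := by rw [← hMe, ← Matrix.mul_assoc, h1]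
    have h3 : M * E * diagonal (fun x => (d (g x) : ℂ)⁻¹) = E := by
      conv_lhs => rw [hME]
      rw [Matrix.mul_assoc _ Eᴴ, hEE, Matrix.mul_one, Matrix.mul_assoc, diagonal_mul_diagonal]
      have : (fun x => (d (g x) : ℂ) * (d (g x) : ℂ)⁻¹) = fun _ => 1 := by
        ext x
        exact mul_inv_cancel₀ (by exact_mod_cast (g x).2)
      rw [this, diagonal_one, Matrix.mul_one]
    have h4 : e * E = E := by
      rw [← h3, ← Matrix.mul_assoc, ← Matrix.mul_assoc, heM]
    have h5 := congrArg conjTranspose h2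
    rw [conjTranspose_mul, conjTranspose_mul, conjTranspose_conjTranspose, heh, ← Matrix.mul_assoc,
      h4] at h5
    exact h5
  · rw [hEM, Matrix.mul_assoc, hEE, Matrix.mul_one]

end Blocks

/-! ### States with vanishing Markov gap are sums of triangle states -/

section Construction

variable {a b c : Type} [Fintype a] [DecidableEq a] [Fintype b] [DecidableEq b] [Fintype c]

/-- A tripartite vector as an operator from `C` to `A ⊗ B`. -/
def stateMatrix (ψ : (a × b) × c → ℂ) : Matrix (a × b) c ℂ := fun p k => ψ (p, k)

lemma marginalAB_eq (ψ : (a × b) × c → ℂ) : marginalAB ψ = stateMatrix ψ * (stateMatrix ψ)ᴴ := by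
  ext p q
  simp [marginalAB, traceRight, ketBra, vecMulVec, stateMatrix, Matrix.mul_apply]

lemma posSemidef_marginalAB (ψ : (a × b) × c → ℂ) : (marginalAB ψ).PosSemidef := by
  rw [marginalAB_eq]
  exact posSemidef_self_mul_conjTranspose _

lemma trace_marginalAB {ψ : (a × b) × c → ℂ} (hψ : IsUnitVector ψ) : (marginalAB ψ).trace = 1 := by
  classical
  rw [marginalAB, trace_traceRight, ← Complex.ofReal_one, ← hψ]
  simp [trace, ketBra, vecMulVec, Complex.mul_conj, Complex.normSq_eq_norm_sq]

/-- The normalized vector `∑ x, √(r x / t) |x x⟩`. -/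
def schmidtVector {d : ℕ} (r : Fin d → ℝ) (t : ℝ) : Fin d × Fin d → ℂ :=
  fun x => if x.1 = x.2 then ((Real.sqrt (r x.1) / Real.sqrt t : ℝ) : ℂ) else 0

lemma isUnitVector_schmidtVector {d : ℕ} {r : Fin d → ℝ} {t : ℝ} (hr : ∀ x, 0 ≤ r x) (ht : 0 < t)
    (h : ∑ x, r x = t) : IsUnitVector (schmidtVector r t) := by
  rw [IsUnitVector, Fintype.sum_prod_type]
  have : ∀ x y, ‖schmidtVector r t (x, y)‖ ^ 2 = if x = y then r x / t else 0 := by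
    intro x y
    rw [schmidtVector]
    by_cases hxy : x = y
    · rw [if_pos hxy, if_pos hxy, Complex.norm_real, Real.norm_eq_abs, sq_abs, div_pow,
        Real.sq_sqrt (hr x), Real.sq_sqrt ht.le]
    · simp [hxy]
  simp only [this, Finset.sum_ite_eq, Finset.mem_univ, if_true]
  rw [← Finset.sum_div, h, div_self ht.ne']

/-- Block isometries built from partial isometries `v l x` with common initial projections
`E l (E l)ᴴ`. -/
lemma isBlockDecomposition_of_partial_isometries {n : Type} [Fintype n] [DecidableEq n] {N : ℕ}
    {d k : Fin N → ℕ} {e : Fin N → Matrix n n ℂ} {v : ∀ l, Fin (d l) → Matrix n n ℂ}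
    {E : ∀ l, Matrix n (Fin (k l)) ℂ} (hE : ∀ l, (E l)ᴴ * E l = 1) (hE' : ∀ l, E l * (E l)ᴴ = e l)
    (hv : ∀ l x y, (v l x)ᴴ * v l y = if x = y then e l else 0)
    (hv' : ∀ l m, l ≠ m → ∀ x y, (v l x)ᴴ * v m y = 0) :
    IsBlockDecomposition d k
      (fun l => Matrix.of fun i (x : Fin (d l) × Fin (k l)) => (v l x.1 * E l) i x.2) := by
  have hmul : ∀ l m (x : Fin (d l) × Fin (k l)) (y : Fin (d m) × Fin (k m)),
      ((Matrix.of fun i (x : Fin (d l) × Fin (k l)) => (v l x.1 * E l) i x.2)ᴴ *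
        (Matrix.of fun i (x : Fin (d m) × Fin (k m)) => (v m x.1 * E m) i x.2)) x y =
      ((E l)ᴴ * ((v l x.1)ᴴ * v m y.1) * E m) x.2 y.2 := by
    intro l m x y
    have : (E l)ᴴ * ((v l x.1)ᴴ * v m y.1) * E m = (v l x.1 * E l)ᴴ * (v m y.1 * E m) := by
      rw [conjTranspose_mul]
      simp only [Matrix.mul_assoc]
    rw [this]
    rfl
  constructor
  · intro l
    ext x y
    rw [hmul, hv]
    split_ifs with hxy
    · rw [← hE', ← Matrix.mul_assoc, hE, Matrix.one_mul, hE, one_apply, one_apply]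
      simp [Prod.ext_iff, hxy]
    · rw [Matrix.mul_zero, Matrix.zero_mul, Matrix.zero_apply, one_apply_ne]
      exact fun h => hxy (congrArg Prod.fst h)
  · intro l m hlm
    ext x y
    rw [hmul, hv' l m hlm, Matrix.mul_zero, Matrix.zero_mul, Matrix.zero_apply, Matrix.zero_apply]

lemma IsBlockDecomposition.swap {n : Type} [Fintype n] {N : ℕ} {d k : Fin N → ℕ}
    {U : ∀ l, Matrix n (Fin (d l) × Fin (k l)) ℂ} (hU : IsBlockDecomposition d k U) :
    IsBlockDecomposition k d fun l => (U l).submatrix id Prod.swap := by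
  have h : ∀ l m, ((U l).submatrix id Prod.swap)ᴴ * (U m).submatrix id Prod.swap =
      ((U l)ᴴ * U m).submatrix Prod.swap (Prod.swap : Fin (k m) × Fin (d m) → _) := fun l m => rfl
  constructor
  · intro l
    rw [h, hU.1]
    exact submatrix_one _ Prod.swap_injective
  · intro l m hlm
    rw [h, hU.2 l m hlm]
    rfl

/-- A decomposition of a vector into blocks with orthogonal product structure exhibits it as a sum
of triangle states. The `C` isometries are the normalized block components of the vector. -/
lemma isSOTS_of_blocks {ψ : (a × b) × c → ℂ} {N : ℕ} {d k k' : Fin N → ℕ}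
    {μ : ∀ l, Fin (d l) → ℝ} {s : ∀ l, Fin (k l) → ℝ} {o : ∀ l, Fin (k' l) → ℝ} {t : Fin N → ℝ}
    {U : ∀ l, Matrix a (Fin (d l) × Fin (k l)) ℂ} {V : ∀ l, Matrix b (Fin (k' l) × Fin (d l)) ℂ}
    {G : ∀ l, Matrix (Fin (k l) × Fin (k' l)) c ℂ}
    (hd : ∀ l, 0 < d l) (hμ : ∀ l x, 0 < μ l x) (hs : ∀ l x, 0 < s l x) (ho : ∀ l x, 0 < o l x)
    (ht : ∀ l, 0 < t l) (hst : ∀ l, ∑ x, s l x = t l) (hot : ∀ l, ∑ x, o l x = t l)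
    (htot : ∑ l, (∑ x, μ l x) * t l = 1)
    (hU : IsBlockDecomposition d k U) (hV : IsBlockDecomposition k' d V)
    (hG : ∀ l, G l * (G l)ᴴ = diagonal fun z => ((s l z.1 * o l z.2 / t l : ℝ) : ℂ))
    (hG' : ∀ l m, l ≠ m → G l * (G m)ᴴ = 0)
    (hψ : ∀ i j m, ψ ((i, j), m) = ∑ l, ∑ x, ∑ z : Fin (k l) × Fin (k' l),
      (Real.sqrt (μ l x) : ℂ) * (U l i (x, z.1) * V l j (z.2, x) * G l z m)) :
    IsSOTS ψ := by
  have hM : ∀ l, 0 < ∑ x, μ l x := fun l =>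
    Finset.sum_pos (fun x _ => hμ l x) ⟨⟨0, hd l⟩, Finset.mem_univ _⟩
  -- the factor that normalizes the rows of `G l`
  let r : ∀ l, Fin (k l) × Fin (k' l) → ℝ := fun l z =>
    Real.sqrt (t l) / (Real.sqrt (s l z.1) * Real.sqrt (o l z.2))
  let W : ∀ l, Matrix c (Fin (k l) × Fin (k' l)) ℂ := fun l =>
    Matrix.of fun m z => (r l z : ℂ) * G l z m
  have hW : ∀ l m (z : Fin (k l) × Fin (k' l)) (z' : Fin (k m) × Fin (k' m)),
      ((W l)ᴴ * W m) z z' = (r l z * r m z' : ℂ) * (G m * (G l)ᴴ) z' z := by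
    intro l m z z'
    simp only [Matrix.mul_apply, conjTranspose_apply, W, of_apply, star_mul', Complex.star_def,
      Complex.conj_ofReal, Finset.mul_sum]
    exact Finset.sum_congr rfl fun _ _ => by ring
  refine ⟨N, fun l => (∑ x, μ l x) * t l, d, k, k', d, k, k', U, V, W,
    fun l => schmidtVector (μ l) (∑ x, μ l x), fun l => schmidtVector (o l) (t l),
    fun l => schmidtVector (s l) (t l), fun l => (mul_pos (hM l) (ht l)).le, htot, hU, hV,
    ⟨fun l => ?_, fun l m hlm => ?_⟩,
    fun l => isUnitVector_schmidtVector (fun x => (hμ l x).le) (hM l) rfl,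
    fun l => isUnitVector_schmidtVector (fun x => (ho l x).le) (ht l) (hot l),
    fun l => isUnitVector_schmidtVector (fun x => (hs l x).le) (ht l) (hst l), ?_⟩
  · ext z z'
    rw [hW, hG]
    by_cases hz : z' = z
    · subst hz
      rw [diagonal_apply_eq, one_apply_eq]
      have h1 : r l z' * r l z' * (s l z'.1 * o l z'.2 / t l) = 1 := by
        have h1 := Real.mul_self_sqrt (ht l).le
        have h2 := Real.mul_self_sqrt (hs l z'.1).le
        have h3 := Real.mul_self_sqrt (ho l z'.2).le
        have h4 := (ht l).ne'
        have h5 := (hs l z'.1).ne'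
        have h6 := (ho l z'.2).ne'
        change Real.sqrt (t l) / (Real.sqrt (s l z'.1) * Real.sqrt (o l z'.2)) *
          (Real.sqrt (t l) / (Real.sqrt (s l z'.1) * Real.sqrt (o l z'.2))) * _ = 1
        rw [div_mul_div_comm, h1, mul_mul_mul_comm, h2, h3]
        field_simp
      exact_mod_cast h1
    · rw [diagonal_apply_ne _ hz, one_apply_ne (Ne.symm hz), mul_zero]
  · ext z z'
    rw [hW, hG' m l (Ne.symm hlm), Matrix.zero_apply, Matrix.zero_apply, mul_zero]
  · intro i j m
    rw [hψ]
    refine Finset.sum_congr rfl fun l _ => ?_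
    -- the weight of the block and all normalization factors multiply to `√(μ l x)`
    have hcoef : ∀ x (z : Fin (k l) × Fin (k' l)),
        Real.sqrt ((∑ x, μ l x) * t l) * r l z * (Real.sqrt (μ l x) / Real.sqrt (∑ x, μ l x)) *
          (Real.sqrt (o l z.2) / Real.sqrt (t l)) * (Real.sqrt (s l z.1) / Real.sqrt (t l)) =
        Real.sqrt (μ l x) := by
      intro x z
      have h1 := (Real.sqrt_pos.mpr (hM l)).ne'
      have h2 := (Real.sqrt_pos.mpr (ht l)).ne'
      have h3 := (Real.sqrt_pos.mpr (hs l z.1)).ne'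
      have h4 := (Real.sqrt_pos.mpr (ho l z.2)).ne'
      rw [Real.sqrt_mul (hM l).le]
      simp only [r]
      field_simp
    -- Schmidt vectors are supported on the diagonal
    have hval : ∀ (x : Fin (d l) × Fin (k l)) (y : Fin (k' l) × Fin (d l))
        (z : Fin (k l) × Fin (k' l)),
        U l i x * V l j y * W l m z * (schmidtVector (μ l) (∑ x, μ l x) (x.1, y.2) *
          schmidtVector (o l) (t l) (y.1, z.2) * schmidtVector (s l) (t l) (z.1, x.2)) =
        if y = (z.2, x.1) then (if x.2 = z.1 then
          U l i x * V l j y * W l m z * ((Real.sqrt (μ l x.1) / Real.sqrt (∑ x, μ l x) : ℝ) *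
          (Real.sqrt (o l z.2) / Real.sqrt (t l) : ℝ) *
          (Real.sqrt (s l z.1) / Real.sqrt (t l) : ℝ)) else 0) else 0 := by
      rintro ⟨x, x'⟩ ⟨y, y'⟩ ⟨z, z'⟩
      simp only [schmidtVector, Prod.mk.injEq]
      by_cases h1 : x = y'
      · by_cases h2 : y = z'
        · by_cases h3 : z = x'
          · subst h1 h2 h3
            simp
          · simp [h3, Ne.symm h3]
        · simp [h2]
      · simp [h1, Ne.symm h1]
    simp only [hval]
    rw [Finset.mul_sum, Fintype.sum_prod_type]
    refine Finset.sum_congr rfl fun x _ => ?_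
    have hin : ∀ x' : Fin (k l), (∑ y : Fin (k' l) × Fin (d l), ∑ z : Fin (k l) × Fin (k' l),
        if y = (z.2, x) then (if x' = z.1 then
          U l i (x, x') * V l j y * W l m z * ((Real.sqrt (μ l x) / Real.sqrt (∑ x, μ l x) : ℝ) *
          (Real.sqrt (o l z.2) / Real.sqrt (t l) : ℝ) *
          (Real.sqrt (s l z.1) / Real.sqrt (t l) : ℝ)) else 0) else 0 : ℂ) =
        ∑ z : Fin (k l) × Fin (k' l), if x' = z.1 then
          U l i (x, x') * V l j (z.2, x) * W l m z *
          ((Real.sqrt (μ l x) / Real.sqrt (∑ x, μ l x) : ℝ) *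
          (Real.sqrt (o l z.2) / Real.sqrt (t l) : ℝ) *
          (Real.sqrt (s l z.1) / Real.sqrt (t l) : ℝ)) else 0 := by
      intro x'
      rw [Finset.sum_comm]
      simp only [Finset.sum_ite_eq', Finset.mem_univ, if_true]
    rw [Finset.sum_congr rfl fun x' _ => congrArg _ (hin x')]
    simp only [Finset.mul_sum]
    rw [Finset.sum_comm]
    refine Finset.sum_congr rfl fun z _ => ?_
    simp only [mul_ite, mul_zero, Finset.sum_ite_eq', Finset.mem_univ, if_true]
    have hc := congrArg Complex.ofReal (hcoef x z)
    push_cast at hc ⊢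
    simp only [W, of_apply]
    linear_combination (-(U l i (x, z.1) * V l j (z.2, x) * G l z m)) * hc

/-- A state with vanishing Markov gap is a sum of triangle states. The blocks are the simple
summands of the partner algebra of the marginal, `A₁` and `B₂` index its matrix units, `A₂` and `B₁`
index eigenvectors of the reduced states in the corner of a minimal projection. -/
theorem isSOTS_of_markovGap_eq_zero {ψ : (a × b) × c → ℂ} (hψ : IsUnitVector ψ)
    (hgap : markovGap (marginalAB ψ) = 0) : IsSOTS ψ := by
  obtain ⟨ρ, hρ⟩ : ∃ ρ, ρ = marginalAB ψ := ⟨_, rfl⟩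
  have htr : ρ.trace = 1 := hρ ▸ trace_marginalAB hψ
  have hpos : ρ.PosSemidef := hρ ▸ posSemidef_marginalAB ψ
  rw [← hρ] at hgap
  have hΨ : ρ = stateMatrix ψ * (stateMatrix ψ)ᴴ := hρ.trans (marginalAB_eq ψ)
  obtain ⟨Q, hQ1, hQ2, hQ3, hQ4, hQ5⟩ := exists_factorization hpos hgap
  have h : IsFactorization ρ Q := ⟨hpos, hQ1, hQ2, hQ3, hQ4, hQ5⟩
  have hA := posSemidef_traceRight hpos
  have hB := posSemidef_traceLeft hpos
  have hN := h.isModularAlgebra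
  obtain ⟨N, d, e, v, μ, he, hee, hv, hvv, hd, hsum⟩ := hN.exists_matrixUnits
  have hveq : ∀ l m, l ≠ m → ∀ x y, (v l x)ᴴ * v m y = 0 := by
    intro l m hlm x y
    rw [← (hv l x).2.2.1, ← (hv m y).2.2.1, conjTranspose_mul, (he l).2.1, Matrix.mul_assoc,
      ← Matrix.mul_assoc (v l x)ᴴ, ← Matrix.mul_assoc (e l)]
    exact hee l m hlm _ (mul_mem_partnerAlgebra (h.conjTranspose_mem (hv l x).1) (hv m y).1)
  have htl : ∀ l, ∃ t : ℝ, 0 < t ∧ (traceRight ρ * e l).trace = t := by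
    intro l
    obtain ⟨h1, h2, h3, h4, h5, -⟩ := he l
    refine exists_pos_of_nonneg_ne_zero ?_ (hN.trace_projection_ne_zero h1 h2 h3 h4)
    have h6 := (hA.mul_mul_conjTranspose_same (e l)).trace_nonneg
    rwa [h2, h5, Matrix.mul_assoc, h3] at h6
  choose t ht htt using htl
  -- the partner of a minimal projection
  obtain ⟨f, hf⟩ : ∃ f : Fin N → Matrix b b ℂ, f = fun l => partner ρ (e l) := ⟨_, rfl⟩
  have hfh : ∀ l, (f l)ᴴ = f l := by
    intro l
    have h1 := h.partner_conjTranspose (he l).1 (μ := 1) (by rw [one_smul, (he l).2.2.2.2.1])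
    rwa [(he l).2.1, one_smul, ← congrFun hf l] at h1
  have hff : ∀ l, f l * f l = f l := by
    intro l
    rw [hf, ← partner_mul hpos (he l).1 (he l).1, (he l).2.2.1]
  have hfB : ∀ l, f l * traceLeft ρ = traceLeft ρ * f l := by
    intro l
    have h1 : (f l * traceLeft ρ)ᴴ = f l * traceLeft ρ := by
      rw [hf, h.partner_mul_traceLeft (he l).1, conjTranspose_traceLeft, conjTranspose_mul,
        conjTranspose_kron_one, (he l).2.1, hpos.isHermitian.eq, traceLeft_kron_one_comm]
    rw [← h1, conjTranspose_mul, hfh, hB.isHermitian.eq]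
  -- `E l` and `F l` diagonalize `ρ_A` and `ρ_B` on the ranges of `e l` and `f l`
  have hEex := fun l => exists_isometry_diagonal (M := e l * traceRight ρ)
    (by
      have h1 := hA.mul_mul_conjTranspose_same (e l)
      rwa [(he l).2.1, Matrix.mul_assoc, ← (he l).2.2.2.2.1, ← Matrix.mul_assoc,
        (he l).2.2.1] at h1)
    (he l).2.1 (by rw [← Matrix.mul_assoc, (he l).2.2.1])
    (by rw [Matrix.mul_assoc, mul_matInvSqrt_sq hA, (he l).1.2.1])
  choose k E s hs hE1 hE2 hE3 using hEex
  have hFex := fun l => exists_isometry_diagonal (M := f l * traceLeft ρ)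
    (by
      have h1 := hB.mul_mul_conjTranspose_same (f l)
      rwa [hfh, Matrix.mul_assoc, ← hfB, ← Matrix.mul_assoc, hff] at h1)
    (hfh l) (by rw [← Matrix.mul_assoc, hff])
    (M' := matInvSqrt (traceLeft ρ) * matInvSqrt (traceLeft ρ))
    (by
      rw [Matrix.mul_assoc, mul_matInvSqrt_sq hB, hf]
      simp only [partner, Matrix.mul_assoc, matInvSqrt_mul_supportProj hB])
  choose k' F o ho hF1 hF2 hF3 using hFex
  have heE : ∀ l, e l * E l = E l := fun l => by
    rw [← hE2, Matrix.mul_assoc, hE1, Matrix.mul_one]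
  have hEe : ∀ l, (E l)ᴴ * e l = (E l)ᴴ := fun l => by
    rw [← hE2, ← Matrix.mul_assoc, hE1, Matrix.one_mul]
  -- the normalized partners of `v l x` adjoint are partial isometries on `B` with the same
  -- relations: the partner map reverses products, and the scalar it produces on adjoints is `μ l x`
  obtain ⟨w, hw⟩ : ∃ w : ∀ l, Fin (d l) → Matrix b b ℂ,
      w = fun l x => ((Real.sqrt (μ l x) : ℂ))⁻¹ • partner ρ (v l x)ᴴ := ⟨_, rfl⟩
  have hsq : ∀ l x, (Real.sqrt (μ l x) : ℂ) ≠ 0 := fun l x => by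
    exact_mod_cast (Real.sqrt_pos.mpr (hv l x).2.1).ne'
  have hww : ∀ l m x y, (w l x)ᴴ * w m y =
      ((Real.sqrt (μ l x) : ℂ)⁻¹ * ((Real.sqrt (μ m y) : ℂ)⁻¹ * μ l x)) •
        partner ρ ((v m y)ᴴ * v l x) := by
    intro l m x y
    have h1 := h.partner_conjTranspose (hv l x).1 (hv l x).2.2.2
    simp only [hw]
    rw [conjTranspose_smul, h1, star_inv₀, Complex.star_def, Complex.conj_ofReal, smul_mul_smul,
      Matrix.smul_mul, smul_smul, partner_mul hpos (h.conjTranspose_mem (hv m y).1) (hv l x).1]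
    congr 1
    ring
  have hp0 : partner ρ (0 : Matrix a a ℂ) = 0 := by
    have := partner_smul (ρ := ρ) 0 0
    rwa [zero_smul, zero_smul] at this
  have hU := isBlockDecomposition_of_partial_isometries hE1 hE2 hvv hveq
  have hV := isBlockDecomposition_of_partial_isometries (v := w) hF1 hF2
    (by
      intro l x y
      rw [hww, hvv]
      split_ifs with h1 h2 h2
      · subst h1
        have h3 : (Real.sqrt (μ l y) : ℂ) * Real.sqrt (μ l y) = μ l y := by
          exact_mod_cast Real.mul_self_sqrt (hv l y).2.1.le
        rw [← h3, inv_mul_cancel_left₀ (hsq l y), inv_mul_cancel₀ (hsq l y), one_smul, hf]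
      · exact absurd h1.symm h2
      · exact absurd h2.symm h1
      · rw [hp0, smul_zero])
    (by
      intro l m hlm x y
      rw [hww, hveq m l (Ne.symm hlm), hp0, smul_zero])
  have hVswap : IsBlockDecomposition k' d (fun l => Matrix.of fun j (y : Fin (k' l) × Fin (d l)) =>
      (w l y.2 * F l) j y.1) := hV.swap
  -- the components of `ψ` in the corners of the reference projections
  obtain ⟨G, hG⟩ : ∃ G : ∀ l, Matrix (Fin (k l) × Fin (k' l)) c ℂ,
      G = fun l => ((E l)ᴴ ⊗ₖ (F l)ᴴ) * stateMatrix ψ := ⟨_, rfl⟩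
  have hGG : ∀ l m, G l * (G m)ᴴ = ((E l)ᴴ ⊗ₖ (F l)ᴴ) *
      ((e l ⊗ₖ (1 : Matrix b b ℂ)) * ρ * (e m ⊗ₖ (1 : Matrix b b ℂ))) * (E m ⊗ₖ F m) := by
    intro l m
    have h1 : ((E l)ᴴ ⊗ₖ (F l)ᴴ) * (e l ⊗ₖ (1 : Matrix b b ℂ)) = (E l)ᴴ ⊗ₖ (F l)ᴴ := by
      rw [← mul_kronecker_mul, hEe, Matrix.mul_one]
    have h2 : (e m ⊗ₖ (1 : Matrix b b ℂ)) * (E m ⊗ₖ F m) = E m ⊗ₖ F m := by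
      rw [← mul_kronecker_mul, heE, Matrix.one_mul]
    rw [Matrix.mul_assoc, Matrix.mul_assoc _ _ (E m ⊗ₖ F m), h2, ← Matrix.mul_assoc,
      ← Matrix.mul_assoc, h1, hG, hΨ]
    simp only [conjTranspose_mul, conjTranspose_kronecker, conjTranspose_conjTranspose,
      Matrix.mul_assoc]
  refine isSOTS_of_blocks (μ := μ) (s := s) (o := o) (t := t) (G := G) hd (fun l x => (hv l x).2.1)
    hs ho ht ?_ ?_ ?_ hU hVswap ?_ ?_ ?_
  · intro l
    have h1 := congrArg trace (hE3 l)
    rw [trace_mul_comm, ← Matrix.mul_assoc, hE2, ← Matrix.mul_assoc, (he l).2.2.1, trace_mul_comm,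
      htt, trace_diagonal] at h1
    exact_mod_cast h1.symm
  · intro l
    have h1 := congrArg trace (hF3 l)
    rw [trace_mul_comm, ← Matrix.mul_assoc, hF2, ← Matrix.mul_assoc, hff, hf,
      h.partner_mul_traceLeft (he l).1, trace_traceLeft, ← trace_traceRight, traceRight_kron_mul,
      trace_mul_comm, htt, trace_diagonal] at h1
    exact_mod_cast h1.symm
  · have h1 : ∀ l x, (v l x * (v l x)ᴴ * traceRight ρ).trace = (μ l x * t l : ℝ) := by
      intro l x
      rw [Matrix.mul_assoc, trace_mul_comm, Matrix.mul_assoc, (hv l x).2.2.2, Matrix.mul_smul,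
        trace_smul, ← Matrix.mul_assoc, hvv, if_pos rfl, trace_mul_comm, htt, smul_eq_mul]
      push_cast
      rfl
    have h2 := congrArg trace (supportProj_mul hA)
    rw [trace_traceRight, htr, ← hsum, Finset.sum_mul, trace_sum] at h2
    simp only [Finset.sum_mul, trace_sum, h1] at h2
    simp only [Finset.sum_mul]
    exact_mod_cast h2
  · intro l
    rw [hGG, h.corner_eq_kron (he l).1 (he l).2.2.1 (he l).2.2.2.2.1
      (by rw [htt]; exact_mod_cast (ht l).ne') (he l).2.2.2.2.2, Matrix.mul_smul, Matrix.smul_mul,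
      ← mul_kronecker_mul, ← mul_kronecker_mul, hE3, ← congrFun hf l, hF3,
      diagonal_kronecker_diagonal, htt]
    ext z z'
    by_cases hz : z = z'
    · subst hz
      simp
      ring
    · simp [hz]
  · intro l m hlm
    rw [hGG, h.corner_eq_zero (he m).2.2.2.2.1 (hee l m hlm), Matrix.mul_zero, Matrix.zero_mul]
  · -- `v l x (v l x)ᴴ` applied to `ψ` is `v l x` on `A` and the partner of `(v l x)ᴴ` on `B`
    have hterm : ∀ l x, ((v l x * (v l x)ᴴ) ⊗ₖ (1 : Matrix b b ℂ)) * stateMatrix ψ =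
        (Real.sqrt (μ l x) : ℂ) • (((v l x * E l) ⊗ₖ (w l x * F l)) * G l) := by
      intro l x
      have h1 : partner ρ (v l x)ᴴ * f l = partner ρ (v l x)ᴴ := by
        have h2 := congrArg conjTranspose (hv l x).2.2.1
        rw [conjTranspose_mul, (he l).2.1] at h2
        rw [hf, ← partner_mul hpos (he l).1 (h.conjTranspose_mem (hv l x).1), h2]
      rw [hG, ← Matrix.mul_assoc, ← mul_kronecker_mul, Matrix.mul_assoc, hE2, (hv l x).2.2.1,
        Matrix.mul_assoc (w l x), hF2, hw, Matrix.smul_mul, h1, kronecker_smul, Matrix.smul_mul,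
        smul_smul, mul_inv_cancel₀ (hsq l x), one_smul, ← kron_one_mul_kron_one, Matrix.mul_assoc,
        partner_spec_purification hΨ (h.conjTranspose_mem (hv l x).1), ← Matrix.mul_assoc,
        ← mul_kronecker_mul, Matrix.mul_one, Matrix.one_mul]
    have hexp : stateMatrix ψ = ∑ l, ∑ x,
        (Real.sqrt (μ l x) : ℂ) • (((v l x * E l) ⊗ₖ (w l x * F l)) * G l) := by
      have h1 := mul_eq_mul_of_purification hΨ
        ((supportProj_traceRight_mul hpos).trans (Matrix.one_mul ρ).symm)
      rw [Matrix.one_mul, ← hsum] at h1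
      conv_lhs => rw [← h1]
      simp only [← hterm, ← Matrix.sum_mul]
      congr 1
      ext p q
      simp only [kroneckerMap_apply, Matrix.sum_apply, Finset.sum_mul]
    intro i j m
    have h1 := congrFun (congrFun hexp (i, j)) m
    change ψ ((i, j), m) = _ at h1
    rw [h1]
    simp only [Matrix.sum_apply, Matrix.smul_apply, Matrix.mul_apply, kroneckerMap_apply,
      smul_eq_mul, of_apply, Finset.mul_sum]

end Construction

/-! ### The Markov gap of a sum of triangle states -/

section BlockIsometries

variable {n : Type} [Fintype n] [DecidableEq n] {N : ℕ} {κ : Fin N → Type} [∀ l, Fintype (κ l)]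
  [∀ l, DecidableEq (κ l)]

lemma mul_diagonal_mul_conjTranspose_apply {r m : Type} [Fintype m] [DecidableEq m]
    (V : Matrix r m ℂ) (f : m → ℂ) (i j : r) :
    (V * diagonal f * Vᴴ) i j = ∑ k, V i k * f k * star (V j k) := by
  rw [Matrix.mul_apply]
  simp only [mul_diagonal, conjTranspose_apply]

lemma mul_diagonal_mul_transpose_apply {r r' m : Type} [Fintype m] [DecidableEq m]
    (V : Matrix r m ℂ) (W : Matrix r' m ℂ) (f : m → ℂ) (i : r) (j : r') :
    (V * diagonal f * Wᵀ) i j = ∑ k, V i k * f k * W j k := by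
  rw [Matrix.mul_apply]
  simp only [mul_diagonal, transpose_apply]

/-- Isometries with orthogonal ranges, joined to one isometry. -/
def joinBlocks (A : ∀ l, Matrix n (κ l) ℂ) : Matrix n (Σ l, κ l) ℂ :=
  Matrix.of fun i q => A q.1 i q.2

lemma joinBlocks_isometry {A : ∀ l, Matrix n (κ l) ℂ} (h1 : ∀ l, (A l)ᴴ * A l = 1)
    (h2 : ∀ l m, l ≠ m → (A l)ᴴ * A m = 0) : (joinBlocks A)ᴴ * joinBlocks A = 1 := by
  ext ⟨l, x⟩ ⟨m, y⟩
  have h3 : ((joinBlocks A)ᴴ * joinBlocks A) ⟨l, x⟩ ⟨m, y⟩ = ((A l)ᴴ * A m) x y := rfl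
  rw [h3]
  by_cases hlm : l = m
  · subst hlm
    rw [h1, one_apply, one_apply]
    simp
  · rw [h2 l m hlm, one_apply_ne (fun h => hlm (congrArg Sigma.fst h)), Matrix.zero_apply]

lemma joinBlocks_diagonal (A : ∀ l, Matrix n (κ l) ℂ) (f : ∀ l, κ l → ℂ) :
    joinBlocks A * diagonal (fun q : Σ l, κ l => f q.1 q.2) * (joinBlocks A)ᴴ =
      ∑ l, A l * diagonal (f l) * (A l)ᴴ := by
  ext i j
  rw [Matrix.sum_apply, mul_diagonal_mul_conjTranspose_apply, Fintype.sum_sigma]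
  simp only [mul_diagonal_mul_conjTranspose_apply, joinBlocks, of_apply]

/-- The entropy of an orthogonal sum of blocks with known eigenvalues. -/
lemma entropy_blocks {A : ∀ l, Matrix n (κ l) ℂ} (h1 : ∀ l, (A l)ᴴ * A l = 1)
    (h2 : ∀ l m, l ≠ m → (A l)ᴴ * A m = 0) (f : ∀ l, κ l → ℝ) :
    entropy (∑ l, A l * diagonal (fun x => (f l x : ℂ)) * (A l)ᴴ) =
      ∑ l, ∑ x, Real.negMulLog (f l x) := by
  rw [← joinBlocks_diagonal A fun l x => (f l x : ℂ),
    entropy_isometry_diagonal _ (joinBlocks_isometry h1 h2) fun q => f q.1 q.2, Fintype.sum_sigma]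

/-- The square root, from a spectral decomposition over an orthonormal family that need not be
complete. -/
lemma cfc_sqrt_isometry_diagonal {m : Type} [Fintype m] [DecidableEq m] {W : Matrix n m ℂ}
    (hW : Wᴴ * W = 1) {d : m → ℝ} (hd : ∀ i, 0 ≤ d i) :
    cfc Real.sqrt (W * diagonal (fun i => (d i : ℂ)) * Wᴴ) =
      W * diagonal (fun i => (Real.sqrt (d i) : ℂ)) * Wᴴ := by
  obtain ⟨S, hS⟩ : ∃ S, S = W * diagonal (fun i => (Real.sqrt (d i) : ℂ)) * Wᴴ := ⟨_, rfl⟩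
  have hSp : S.PosSemidef := by
    rw [hS]
    refine PosSemidef.mul_mul_conjTranspose_same (posSemidef_diagonal_iff.mpr fun i => ?_) W
    exact_mod_cast Real.sqrt_nonneg _
  have hSS : W * diagonal (fun i => (d i : ℂ)) * Wᴴ = S * S := by
    have h1 : S * S = W * (diagonal (fun i => (Real.sqrt (d i) : ℂ)) * (Wᴴ * W) *
        diagonal (fun i => (Real.sqrt (d i) : ℂ))) * Wᴴ := by
      rw [hS]
      simp only [Matrix.mul_assoc]
    rw [h1, hW, Matrix.mul_one, diagonal_mul_diagonal]
    congr 3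
    ext i
    exact_mod_cast (Real.mul_self_sqrt (hd i)).symm
  obtain ⟨U, e, hU, hU', he, hSU, -⟩ := exists_spectral_nonneg hSp
  rw [hSS, ← hS, cfc_eq_of_spectral (M := S * S) (e := fun i => e i * e i) hU' hU _ Real.sqrt]
  · conv_rhs => rw [hSU]
    congr 3
    ext i
    rw [Real.sqrt_mul_self (he i)]
  · conv_lhs => rw [hSU]
    rw [Matrix.mul_assoc, ← Matrix.mul_assoc Uᴴ, ← Matrix.mul_assoc Uᴴ, hU, Matrix.one_mul,
      ← Matrix.mul_assoc, Matrix.mul_assoc U, diagonal_mul_diagonal]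
    congr 3
    ext i
    push_cast
    rfl

/-- Squaring `∑ l, A l D l (W l)ᵀ` for block isometries `W l`. -/
lemma blocks_mul_conjTranspose {n' : Type} [Fintype n'] [DecidableEq n'] (A : ∀ l, Matrix n (κ l) ℂ)
    {W : ∀ l, Matrix n' (κ l) ℂ} (h1 : ∀ l, (W l)ᴴ * W l = 1)
    (h2 : ∀ l m, l ≠ m → (W l)ᴴ * W m = 0) {f : ∀ l, κ l → ℝ} (hf : ∀ l x, 0 ≤ f l x) :
    (∑ l, A l * diagonal (fun x => (Real.sqrt (f l x) : ℂ)) * (W l)ᵀ) *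
      (∑ l, A l * diagonal (fun x => (Real.sqrt (f l x) : ℂ)) * (W l)ᵀ)ᴴ =
    ∑ l, A l * diagonal (fun x => (f l x : ℂ)) * (A l)ᴴ := by
  obtain ⟨D, hD⟩ : ∃ D : Matrix (Σ l, κ l) (Σ l, κ l) ℂ,
    D = diagonal (fun q : Σ l, κ l => (Real.sqrt (f q.1 q.2) : ℂ)) := ⟨_, rfl⟩
  have h3 : ∑ l, A l * diagonal (fun x => (Real.sqrt (f l x) : ℂ)) * (W l)ᵀ =
      joinBlocks A * D * (joinBlocks W)ᵀ := by
    ext i j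
    rw [hD, Matrix.sum_apply, mul_diagonal_mul_transpose_apply, Fintype.sum_sigma]
    simp only [mul_diagonal_mul_transpose_apply, joinBlocks, of_apply]
  have h4 : (joinBlocks W)ᵀ * (joinBlocks W)ᵀᴴ = 1 := by
    have h5 : (joinBlocks W)ᵀᴴ = (joinBlocks W)ᴴᵀ := rfl
    rw [h5, ← transpose_mul, joinBlocks_isometry h1 h2, transpose_one]
  have h6 : D * Dᴴ = diagonal (fun q : Σ l, κ l => (f q.1 q.2 : ℂ)) := by
    rw [hD, (isHermitian_diagonal_ofReal _).eq, diagonal_mul_diagonal]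
    congr 1
    ext q
    exact_mod_cast Real.mul_self_sqrt (hf _ _)
  rw [h3, ← joinBlocks_diagonal, ← h6, conjTranspose_mul, conjTranspose_mul]
  calc _ = joinBlocks A * D * ((joinBlocks W)ᵀ * (joinBlocks W)ᵀᴴ) * Dᴴ * (joinBlocks A)ᴴ := by
        simp only [Matrix.mul_assoc]
    _ = _ := by rw [h4, Matrix.mul_one]; simp only [Matrix.mul_assoc]

end BlockIsometries

section Entropies

/-- The entropy of a product distribution, scaled by `p`. -/
lemma sum_negMulLog_mul {ι κ : Type} [Fintype ι] [Fintype κ] {p : ℝ} {f : ι → ℝ} {g : κ → ℝ}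
    (hf : ∑ i, f i = 1) (hg : ∑ j, g j = 1) :
    ∑ z : ι × κ, Real.negMulLog (p * (f z.1 * g z.2)) = Real.negMulLog p +
      p * ((∑ i, Real.negMulLog (f i)) + ∑ j, Real.negMulLog (g j)) := by
  rw [Fintype.sum_prod_type]
  simp only [Real.negMulLog_mul, mul_add, Finset.sum_add_distrib]
  have h1 : ∑ i, ∑ j, f i * g j * Real.negMulLog p = Real.negMulLog p := by
    simp only [← Finset.sum_mul, ← Finset.mul_sum, hf, hg, mul_one, one_mul]
  have h2 : ∑ i, ∑ j, p * (g j * Real.negMulLog (f i)) = p * ∑ i, Real.negMulLog (f i) := by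
    simp only [← Finset.sum_mul, ← Finset.mul_sum, hg, one_mul]
  have h3 : ∑ i, ∑ j, p * (f i * Real.negMulLog (g j)) = p * ∑ j, Real.negMulLog (g j) := by
    simp only [← Finset.sum_mul, ← Finset.mul_sum, hf, one_mul]
  rw [h1, h2, h3]

end Entropies

section TriangleForm

variable {a b : Type} [Fintype a] [DecidableEq a] [Fintype b] [DecidableEq b]

/-- The isometry `|s⟩|t⟩ ↦ ∑ x, √(μ x) |x s⟩ |t x⟩`. -/
def schmidtIsometry {d : ℕ} (k k' : ℕ) (μ : Fin d → ℝ) :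
    Matrix ((Fin d × Fin k) × (Fin k' × Fin d)) (Fin k × Fin k') ℂ :=
  fun w z => if w.1.1 = w.2.2 ∧ w.1.2 = z.1 ∧ w.2.1 = z.2 then (Real.sqrt (μ w.1.1) : ℂ) else 0

/-- The isometry `|x⟩|y⟩ ↦ ∑ s, √(α s) |x s⟩ |y s⟩`. -/
def pairIsometry (d : ℕ) {k : ℕ} (α : Fin k → ℝ) :
    Matrix ((Fin d × Fin k) × (Fin d × Fin k)) (Fin d × Fin d) ℂ :=
  fun w z => if w.1.2 = w.2.2 ∧ w.1.1 = z.1 ∧ w.2.1 = z.2 then (Real.sqrt (α w.1.2) : ℂ) else 0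

lemma schmidtIsometry_isometry {d k k' : ℕ} {μ : Fin d → ℝ} (hμ : ∀ x, 0 ≤ μ x)
    (h1 : ∑ x, μ x = 1) :
    (schmidtIsometry k k' μ)ᴴ * schmidtIsometry k k' μ = 1 := by
  ext ⟨s, t⟩ ⟨s', t'⟩
  have h2 : ∀ x s'' t'' y, star (schmidtIsometry k k' μ ((x, s''), (t'', y)) (s, t)) *
      schmidtIsometry k k' μ ((x, s''), (t'', y)) (s', t') =
      if x = y then (if s'' = s then (if t'' = t then
        (if s = s' ∧ t = t' then (μ x : ℂ) else 0) else 0) else 0) else 0 := by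
    intro x s'' t'' y
    simp only [schmidtIsometry]
    by_cases h3 : x = y <;> by_cases h4 : s'' = s <;> by_cases h5 : t'' = t <;>
      by_cases h6 : s = s' ∧ t = t'
    · obtain ⟨h6, h7⟩ := h6
      subst h4 h5 h6 h7 h3
      simp
      exact_mod_cast Real.mul_self_sqrt (hμ x)
    all_goals aesop
  have h3 : (∑ x, (μ x : ℂ)) = 1 := by exact_mod_cast h1
  simp only [Matrix.mul_apply, conjTranspose_apply, Fintype.sum_prod_type, h2, Finset.sum_ite_eq,
    Finset.sum_ite_eq', Finset.mem_univ, if_true, Finset.sum_ite_irrel, Finset.sum_const_zero, h3,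
    one_apply, Prod.mk.injEq]

lemma pairIsometry_isometry {d k : ℕ} {α : Fin k → ℝ} (hα : ∀ x, 0 ≤ α x)
    (h1 : ∑ x, α x = 1) :
    (pairIsometry d α)ᴴ * pairIsometry d α = 1 := by
  ext ⟨x, y⟩ ⟨x', y'⟩
  have h2 : ∀ x'' s y'' t, star (pairIsometry d α ((x'', s), (y'', t)) (x, y)) *
      pairIsometry d α ((x'', s), (y'', t)) (x', y') =
      if s = t then (if x'' = x then (if y'' = y then
        (if x = x' ∧ y = y' then (α s : ℂ) else 0) else 0) else 0) else 0 := by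
    intro x'' s y'' t
    simp only [pairIsometry]
    by_cases h3 : s = t <;> by_cases h4 : x'' = x <;> by_cases h5 : y'' = y <;>
      by_cases h6 : x = x' ∧ y = y'
    · obtain ⟨h6, h7⟩ := h6
      subst h4 h5 h6 h7 h3
      simp
      exact_mod_cast Real.mul_self_sqrt (hα s)
    all_goals aesop
  have h3 : (∑ s, (α s : ℂ)) = 1 := by exact_mod_cast h1
  simp only [Matrix.mul_apply, conjTranspose_apply, Fintype.sum_prod_type, h2, Finset.sum_ite_eq,
    Finset.sum_ite_eq', Finset.mem_univ, if_true, Finset.sum_ite_irrel, Finset.sum_const_zero, h3,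
    one_apply, Prod.mk.injEq]

/-- Normal form of the marginals of sums of triangle states, in terms of Schmidt coefficients `μ l`
of the states `ψ^l_{A₁B₂}` and eigenvalues `α l`, `β l` of the reduced states of `A₂` and `B₁`. -/
structure IsTriangleMixture (ρ : Matrix (a × b) (a × b) ℂ) {N : ℕ} (d k k' : Fin N → ℕ)
    (p : Fin N → ℝ) (μ : ∀ l, Fin (d l) → ℝ) (α : ∀ l, Fin (k l) → ℝ) (β : ∀ l, Fin (k' l) → ℝ)
    (A : ∀ l, Matrix a (Fin (d l) × Fin (k l)) ℂ) (B : ∀ l, Matrix b (Fin (k' l) × Fin (d l)) ℂ) :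
    Prop where
  p_nonneg : ∀ l, 0 ≤ p l
  p_sum : ∑ l, p l = 1
  μ_pos : ∀ l x, 0 < μ l x
  μ_sum : ∀ l, ∑ x, μ l x = 1
  α_nonneg : ∀ l x, 0 ≤ α l x
  α_sum : ∀ l, ∑ x, α l x = 1
  β_nonneg : ∀ l x, 0 ≤ β l x
  β_sum : ∀ l, ∑ x, β l x = 1
  blockA : IsBlockDecomposition d k A
  blockB : IsBlockDecomposition k' d B
  eq : ρ = ∑ l, ((A l ⊗ₖ B l) * schmidtIsometry (k l) (k' l) (μ l)) *
    diagonal (fun z : Fin (k l) × Fin (k' l) => ((p l * (α l z.1 * β l z.2) : ℝ) : ℂ)) *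
    ((A l ⊗ₖ B l) * schmidtIsometry (k l) (k' l) (μ l))ᴴ

lemma traceRight_isometry {m m' : Type} [Fintype m] [DecidableEq m] [Fintype m'] [DecidableEq m']
    {B : Matrix b m' ℂ} (hB : Bᴴ * B = 1) (A : Matrix a m ℂ) (T : Matrix (m × m') (m × m') ℂ) :
    traceRight ((A ⊗ₖ B) * T * (A ⊗ₖ B)ᴴ) = A * traceRight T * Aᴴ := by
  ext i j
  have hB' : ∀ y y', ∑ k, B k y * star (B k y') = if y' = y then 1 else 0 := by
    intro y y'
    rw [← one_apply, ← hB, Matrix.mul_apply]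
    exact Finset.sum_congr rfl fun _ _ => mul_comm _ _
  calc _ = ∑ q : m × m', ∑ p : m × m', A i p.1 * T p q * star (A j q.1) *
        ∑ k, B k p.2 * star (B k q.2) := by
        simp only [traceRight, Matrix.mul_apply, kroneckerMap_apply, conjTranspose_apply,
          star_mul', Finset.sum_mul, Finset.mul_sum]
        rw [Finset.sum_comm]
        refine Finset.sum_congr rfl fun q _ => ?_
        rw [Finset.sum_comm]
        exact Finset.sum_congr rfl fun p _ => Finset.sum_congr rfl fun k _ => by ring
    _ = _ := by
        simp only [hB', traceRight, Matrix.mul_apply, Fintype.sum_prod_type, mul_ite, mul_one,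
          mul_zero, Finset.sum_ite_eq, Finset.mem_univ, if_true, conjTranspose_apply,
          Finset.sum_mul, Finset.mul_sum]
        refine Finset.sum_congr rfl fun x _ => ?_
        rw [Finset.sum_comm]

lemma traceLeft_isometry {m m' : Type} [Fintype m] [DecidableEq m] [Fintype m'] [DecidableEq m']
    {A : Matrix a m ℂ} (hA : Aᴴ * A = 1) (B : Matrix b m' ℂ) (T : Matrix (m × m') (m × m') ℂ) :
    traceLeft ((A ⊗ₖ B) * T * (A ⊗ₖ B)ᴴ) = B * traceLeft T * Bᴴ := by
  ext i j
  have hA' : ∀ y y', ∑ k, A k y * star (A k y') = if y' = y then 1 else 0 := by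
    intro y y'
    rw [← one_apply, ← hA, Matrix.mul_apply]
    exact Finset.sum_congr rfl fun _ _ => mul_comm _ _
  calc _ = ∑ q : m × m', ∑ p : m × m', B i p.2 * T p q * star (B j q.2) *
        ∑ k, A k p.1 * star (A k q.1) := by
        simp only [traceLeft, Matrix.mul_apply, kroneckerMap_apply, conjTranspose_apply,
          star_mul', Finset.sum_mul, Finset.mul_sum]
        rw [Finset.sum_comm]
        refine Finset.sum_congr rfl fun q _ => ?_
        rw [Finset.sum_comm]
        exact Finset.sum_congr rfl fun p _ => Finset.sum_congr rfl fun k _ => by ring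
    _ = _ := by
        simp only [hA', traceLeft, Matrix.mul_apply, Fintype.sum_prod_type_right, mul_ite, mul_one,
          mul_zero, Finset.sum_ite_eq, Finset.mem_univ, if_true, conjTranspose_apply,
          Finset.sum_mul, Finset.mul_sum]
        refine Finset.sum_congr rfl fun x _ => ?_
        rw [Finset.sum_comm]

lemma realign_kron_conj {m m' : Type} [Fintype m] [DecidableEq m] [Fintype m'] [DecidableEq m']
    (A : Matrix a m ℂ) (B : Matrix b m' ℂ) (T : Matrix (m × m') (m × m') ℂ) :
    realign ((A ⊗ₖ B) * T * (A ⊗ₖ B)ᴴ) =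
      (A ⊗ₖ A.map star) * realign T * (B ⊗ₖ B.map star)ᵀ := by
  ext ⟨i, i'⟩ ⟨j, j'⟩
  calc _ = ∑ x', ∑ y', ∑ x, ∑ y, A i x * star (A i' x') * T (x, y) (x', y') *
        (B j y * star (B j' y')) := by
        simp only [realign, Matrix.mul_apply, kroneckerMap_apply, conjTranspose_apply,
          star_mul', Finset.sum_mul, Fintype.sum_prod_type]
        exact Finset.sum_congr rfl fun _ _ => Finset.sum_congr rfl fun _ _ =>
          Finset.sum_congr rfl fun _ _ => Finset.sum_congr rfl fun _ _ => by ring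
    _ = ∑ y, ∑ y', ∑ x, ∑ x', A i x * star (A i' x') * T (x, y) (x', y') *
        (B j y * star (B j' y')) := by
        rw [Finset.sum_comm]
        conv_rhs => rw [Finset.sum_comm]
        refine Finset.sum_congr rfl fun y' _ => ?_
        rw [Finset.sum_congr rfl fun x' _ => Finset.sum_comm, Finset.sum_comm]
        exact Finset.sum_congr rfl fun y _ => Finset.sum_comm
    _ = _ := by
        simp only [realign, Matrix.mul_apply, kroneckerMap_apply, transpose_apply, map_apply,
          Finset.sum_mul, Fintype.sum_prod_type]

lemma conj_pair_mul {n m m' r r' : Type} [Fintype n] [Fintype m] [Fintype m'] [Fintype r]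
    [Fintype r'] (A : Matrix n m ℂ) (A' : Matrix n m' ℂ) (R : Matrix (m × m) r ℂ)
    (R' : Matrix (m' × m') r' ℂ) :
    ((A ⊗ₖ A.map star) * R)ᴴ * ((A' ⊗ₖ A'.map star) * R') =
      Rᴴ * ((Aᴴ * A') ⊗ₖ ((Aᴴ * A').map star)) * R' := by
  have h1 : (A.map star)ᴴ * A'.map star = (Aᴴ * A').map star := by
    ext i j
    simp [Matrix.mul_apply]
  rw [conjTranspose_mul, Matrix.mul_assoc, ← Matrix.mul_assoc (_ ⊗ₖ _)ᴴ,
    conjTranspose_kronecker, ← mul_kronecker_mul, ← Matrix.mul_assoc, h1]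

section SchmidtDiagonal

variable {d k k' : ℕ} {μ : Fin d → ℝ} {α : Fin k → ℝ} {β : Fin k' → ℝ} {p : ℝ}

lemma schmidtIsometry_conj_apply (f : Fin k × Fin k' → ℂ)
    (w w' : (Fin d × Fin k) × (Fin k' × Fin d)) :
    (schmidtIsometry k k' μ * diagonal f * (schmidtIsometry k k' μ)ᴴ) w w' =
      if w.1.1 = w.2.2 ∧ w'.1.1 = w'.2.2 ∧ w.1.2 = w'.1.2 ∧ w.2.1 = w'.2.1 then
        (Real.sqrt (μ w.1.1) : ℂ) * f (w.1.2, w.2.1) * Real.sqrt (μ w'.1.1) else 0 := by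
  rw [Matrix.mul_apply, Finset.sum_eq_single (w.1.2, w.2.1)]
  · simp only [mul_diagonal, conjTranspose_apply, schmidtIsometry, and_true]
    split_ifs <;> simp_all
  · intro z _ hz
    have : ¬ (w.1.1 = w.2.2 ∧ w.1.2 = z.1 ∧ w.2.1 = z.2) := fun h =>
      hz (Prod.ext h.2.1.symm h.2.2.symm)
    simp only [mul_diagonal, schmidtIsometry, if_neg this, zero_mul]
  · intro h
    exact absurd (Finset.mem_univ _) h

lemma traceRight_schmidtIsometry (hμ : ∀ x, 0 ≤ μ x) (hβ : ∑ x, β x = 1) :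
    traceRight (schmidtIsometry k k' μ * diagonal (fun z : Fin k × Fin k' =>
      ((p * (α z.1 * β z.2) : ℝ) : ℂ)) * (schmidtIsometry k k' μ)ᴴ) =
      diagonal fun z : Fin d × Fin k => ((p * (μ z.1 * α z.2) : ℝ) : ℂ) := by
  ext ⟨x, s⟩ ⟨x', s'⟩
  have h1 : ∀ t y, (if x = y ∧ x' = y ∧ s = s' ∧ True then (Real.sqrt (μ x) : ℂ) *
      ((p * (α s * β t) : ℝ) : ℂ) * Real.sqrt (μ x') else 0) =
      if x = y then (if x = x' ∧ s = s' then (β t : ℂ) * ((p * (μ x * α s) : ℝ) : ℂ) else 0)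
        else 0 := by
    intro t y
    by_cases h2 : x = y
    · by_cases h3 : x = x' ∧ s = s'
      · obtain ⟨h3, h4⟩ := h3
        subst h2 h3 h4
        have h5 : (Real.sqrt (μ x) : ℂ) * Real.sqrt (μ x) = μ x := by
          exact_mod_cast Real.mul_self_sqrt (hμ x)
        simp only [and_self, if_true]
        push_cast
        linear_combination (p * α s * β t : ℂ) * h5
      · rw [if_pos h2, if_neg h3, if_neg fun h => h3 ⟨h2.trans h.2.1.symm, h.2.2.1⟩]
    · rw [if_neg h2, if_neg fun h => h2 h.1]
  have h3 : (∑ s, (β s : ℂ)) = 1 := by exact_mod_cast hβ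
  simp only [traceRight, schmidtIsometry_conj_apply, Fintype.sum_prod_type]
  simp only [h1, Finset.sum_ite_eq, Finset.mem_univ, if_true, Finset.sum_ite_irrel,
    Finset.sum_const_zero, ← Finset.sum_mul, h3, one_mul, diagonal_apply, Prod.mk.injEq]

lemma traceLeft_schmidtIsometry (hμ : ∀ x, 0 ≤ μ x) (hα : ∑ x, α x = 1) :
    traceLeft (schmidtIsometry k k' μ * diagonal (fun z : Fin k × Fin k' =>
      ((p * (α z.1 * β z.2) : ℝ) : ℂ)) * (schmidtIsometry k k' μ)ᴴ) =
      diagonal fun z : Fin k' × Fin d => ((p * (β z.1 * μ z.2) : ℝ) : ℂ) := by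
  ext ⟨t, y⟩ ⟨t', y'⟩
  have h1 : ∀ x s, (if x = y ∧ x = y' ∧ True ∧ t = t' then (Real.sqrt (μ x) : ℂ) *
      ((p * (α s * β t) : ℝ) : ℂ) * Real.sqrt (μ x) else 0) =
      if x = y then (if t = t' ∧ y = y' then (α s : ℂ) * ((p * (β t * μ y) : ℝ) : ℂ) else 0)
        else 0 := by
    intro x s
    by_cases h2 : x = y
    · by_cases h3 : t = t' ∧ y = y'
      · obtain ⟨h3, h4⟩ := h3
        subst h2 h3 h4
        have h5 : (Real.sqrt (μ x) : ℂ) * Real.sqrt (μ x) = μ x := by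
          exact_mod_cast Real.mul_self_sqrt (hμ x)
        simp only [and_self, if_true]
        push_cast
        linear_combination (p * α s * β t : ℂ) * h5
      · rw [if_pos h2, if_neg h3, if_neg fun h => h3 ⟨h.2.2.2, h2.symm.trans h.2.1⟩]
    · rw [if_neg h2, if_neg fun h => h2 h.1]
  have h3 : (∑ s, (α s : ℂ)) = 1 := by exact_mod_cast hα
  simp only [traceLeft, schmidtIsometry_conj_apply, Fintype.sum_prod_type_right]
  simp only [h1, Finset.sum_ite_eq', Finset.mem_univ, if_true, Finset.sum_ite_irrel,
    Finset.sum_const_zero, ← Finset.sum_mul, h3, one_mul, diagonal_apply, Prod.mk.injEq]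

/-- The operator Schmidt decomposition of the square root of a single block. In the canonical
purification the correlations of `A₂` and of `B₁` are local to `A Ā` and to `B B̄`, and `A Ā` shares
with `B B̄` two copies of the state of `A₁ B₂`. -/
lemma realign_schmidtIsometry (hp : 0 ≤ p) (hμ : ∀ x, 0 ≤ μ x) (hα : ∀ x, 0 ≤ α x) :
    realign (schmidtIsometry k k' μ * diagonal (fun z : Fin k × Fin k' =>
      (Real.sqrt (p * (α z.1 * β z.2)) : ℂ)) * (schmidtIsometry k k' μ)ᴴ) =
    pairIsometry d α * diagonal (fun z : Fin d × Fin d => (Real.sqrt (p * (μ z.1 * μ z.2)) : ℂ)) *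
      ((pairIsometry d β).submatrix (Prod.map Prod.swap Prod.swap) id)ᵀ := by
  ext ⟨⟨x, s⟩, ⟨x', s'⟩⟩ ⟨⟨t, y⟩, ⟨t', y'⟩⟩
  rw [realign, schmidtIsometry_conj_apply, mul_diagonal_mul_transpose_apply,
    Finset.sum_eq_single (x, x')]
  · simp only [pairIsometry, submatrix_apply, Prod.map, Prod.swap, id, and_true]
    by_cases h1 : x = y ∧ x' = y' ∧ s = s' ∧ t = t'
    · obtain ⟨h1, h2, h3, h4⟩ := h1
      subst h1 h2 h3 h4
      simp only [and_self, if_true]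
      rw [Real.sqrt_mul hp, Real.sqrt_mul hp, Real.sqrt_mul (hα s), Real.sqrt_mul (hμ x)]
      push_cast
      ring
    · rw [if_neg h1]
      by_cases h2 : s = s'
      · rw [if_neg (c := t = t' ∧ _) fun h => h1 ⟨h.2.1.symm, h.2.2.symm, h2, h.1⟩, mul_zero]
      · rw [if_neg h2, zero_mul, zero_mul]
  · intro z _ hz
    have : ¬ (s = s' ∧ x = z.1 ∧ x' = z.2) := fun h => hz (Prod.ext h.2.1.symm h.2.2.symm)
    simp only [pairIsometry, if_neg this, zero_mul]
  · intro h
    exact absurd (Finset.mem_univ _) h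

end SchmidtDiagonal

namespace IsTriangleMixture

variable {ρ : Matrix (a × b) (a × b) ℂ} {N : ℕ} {d k k' : Fin N → ℕ}
    {p : Fin N → ℝ} {μ : ∀ l, Fin (d l) → ℝ} {α : ∀ l, Fin (k l) → ℝ} {β : ∀ l, Fin (k' l) → ℝ}
    {A : ∀ l, Matrix a (Fin (d l) × Fin (k l)) ℂ} {B : ∀ l, Matrix b (Fin (k' l) × Fin (d l)) ℂ}
    (h : IsTriangleMixture ρ d k k' p μ α β A B)
include h

lemma isometry (l : Fin N) : ((A l ⊗ₖ B l) * schmidtIsometry (k l) (k' l) (μ l))ᴴ *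
    ((A l ⊗ₖ B l) * schmidtIsometry (k l) (k' l) (μ l)) = 1 := by
  rw [conjTranspose_mul, Matrix.mul_assoc, ← Matrix.mul_assoc (A l ⊗ₖ B l)ᴴ,
    conjTranspose_kronecker, ← mul_kronecker_mul, h.blockA.1, h.blockB.1, one_kronecker_one,
    Matrix.one_mul, schmidtIsometry_isometry (fun x => (h.μ_pos l x).le) (h.μ_sum l)]

lemma orthogonal (l m : Fin N) (hlm : l ≠ m) :
    ((A l ⊗ₖ B l) * schmidtIsometry (k l) (k' l) (μ l))ᴴ *
    ((A m ⊗ₖ B m) * schmidtIsometry (k m) (k' m) (μ m)) = 0 := by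
  rw [conjTranspose_mul, Matrix.mul_assoc, ← Matrix.mul_assoc (A l ⊗ₖ B l)ᴴ,
    conjTranspose_kronecker, ← mul_kronecker_mul, h.blockA.2 l m hlm, zero_kronecker,
    Matrix.zero_mul, Matrix.mul_zero]

lemma entropy_eq : entropy ρ = ∑ l, (Real.negMulLog (p l) +
    p l * ((∑ i, Real.negMulLog (α l i)) + ∑ j, Real.negMulLog (β l j))) := by
  rw [h.eq, entropy_blocks h.isometry h.orthogonal fun l z => p l * (α l z.1 * β l z.2)]
  exact Finset.sum_congr rfl fun l _ => sum_negMulLog_mul (h.α_sum l) (h.β_sum l)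

lemma traceRight_eq : traceRight ρ = ∑ l, A l *
    diagonal (fun z : Fin _ × Fin _ => ((p l * (μ l z.1 * α l z.2) : ℝ) : ℂ)) * (A l)ᴴ := by
  have hsum : ∀ M : Fin N → Matrix (a × b) (a × b) ℂ,
      traceRight (∑ l, M l) = ∑ l, traceRight (M l) := by
    intro M
    ext i j
    simp only [traceRight, Matrix.sum_apply]
    exact Finset.sum_comm
  rw [h.eq, hsum]
  refine Finset.sum_congr rfl fun l _ => ?_
  rw [← traceRight_schmidtIsometry (fun x => (h.μ_pos l x).le) (h.β_sum l),
    ← traceRight_isometry (h.blockB.1 l), conjTranspose_mul]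
  simp only [Matrix.mul_assoc]

lemma traceLeft_eq : traceLeft ρ = ∑ l, B l *
    diagonal (fun z : Fin _ × Fin _ => ((p l * (β l z.1 * μ l z.2) : ℝ) : ℂ)) * (B l)ᴴ := by
  have hsum : ∀ M : Fin N → Matrix (a × b) (a × b) ℂ,
      traceLeft (∑ l, M l) = ∑ l, traceLeft (M l) := by
    intro M
    ext i j
    simp only [traceLeft, Matrix.sum_apply]
    exact Finset.sum_comm
  rw [h.eq, hsum]
  refine Finset.sum_congr rfl fun l _ => ?_
  rw [← traceLeft_schmidtIsometry (fun x => (h.μ_pos l x).le) (h.α_sum l),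
    ← traceLeft_isometry (h.blockA.1 l), conjTranspose_mul]
  simp only [Matrix.mul_assoc]

lemma cfc_sqrt_eq : cfc Real.sqrt ρ = ∑ l, ((A l ⊗ₖ B l) * schmidtIsometry (k l) (k' l) (μ l)) *
    diagonal (fun z : Fin _ × Fin _ => (Real.sqrt (p l * (α l z.1 * β l z.2)) : ℂ)) *
    ((A l ⊗ₖ B l) * schmidtIsometry (k l) (k' l) (μ l))ᴴ := by
  rw [h.eq, ← joinBlocks_diagonal (fun l => (A l ⊗ₖ B l) * schmidtIsometry (k l) (k' l) (μ l))
    fun l z => ((p l * (α l z.1 * β l z.2) : ℝ) : ℂ),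
    cfc_sqrt_isometry_diagonal (joinBlocks_isometry h.isometry h.orthogonal)
      (d := fun q : Σ l, Fin (k l) × Fin (k' l) => p q.1 * (α q.1 q.2.1 * β q.1 q.2.2))
      (fun q => mul_nonneg (h.p_nonneg _) (mul_nonneg (h.α_nonneg _ _) (h.β_nonneg _ _))),
    joinBlocks_diagonal (fun l => (A l ⊗ₖ B l) * schmidtIsometry (k l) (k' l) (μ l))
      fun l z => (Real.sqrt (p l * (α l z.1 * β l z.2)) : ℂ)]

/-- The reduced state of `A Ā` in the canonical purification. -/
lemma realign_mul_eq : realign (cfc Real.sqrt ρ) * (realign (cfc Real.sqrt ρ))ᴴ =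
    ∑ l, ((A l ⊗ₖ (A l).map star) * pairIsometry (d l) (α l)) *
      diagonal (fun z : Fin (d l) × Fin (d l) => ((p l * (μ l z.1 * μ l z.2) : ℝ) : ℂ)) *
      ((A l ⊗ₖ (A l).map star) * pairIsometry (d l) (α l))ᴴ := by
  have h1 : realign (cfc Real.sqrt ρ) = ∑ l,
      ((A l ⊗ₖ (A l).map star) * pairIsometry (d l) (α l)) *
      diagonal (fun z : Fin (d l) × Fin (d l) => (Real.sqrt (p l * (μ l z.1 * μ l z.2)) : ℂ)) *
      ((B l ⊗ₖ (B l).map star) *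
        (pairIsometry (d l) (β l)).submatrix (Prod.map Prod.swap Prod.swap) id)ᵀ := by
    have hsum : ∀ M : Fin N → Matrix (a × b) (a × b) ℂ,
        realign (∑ l, M l) = ∑ l, realign (M l) := by
      intro M
      ext i j
      simp only [realign, Matrix.sum_apply]
    rw [h.cfc_sqrt_eq, hsum]
    refine Finset.sum_congr rfl fun l _ => ?_
    have h2 := realign_schmidtIsometry (β := β l) (h.p_nonneg l) (fun x => (h.μ_pos l x).le)
      (h.α_nonneg l)
    calc _ = realign ((A l ⊗ₖ B l) * (schmidtIsometry (k l) (k' l) (μ l) *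
          diagonal (fun z : Fin _ × Fin _ => (Real.sqrt (p l * (α l z.1 * β l z.2)) : ℂ)) *
          (schmidtIsometry (k l) (k' l) (μ l))ᴴ) * (A l ⊗ₖ B l)ᴴ) := by
          rw [conjTranspose_mul]
          simp only [Matrix.mul_assoc]
      _ = _ := by
          rw [realign_kron_conj, h2, transpose_mul]
          simp only [Matrix.mul_assoc]
  rw [h1]
  refine blocks_mul_conjTranspose _ (fun l => ?_) (fun l m hlm => ?_)
    (f := fun l (z : Fin (d l) × Fin (d l)) => p l * (μ l z.1 * μ l z.2)) fun l z =>
      mul_nonneg (h.p_nonneg l) (mul_nonneg (h.μ_pos l _).le (h.μ_pos l _).le)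
  · rw [conj_pair_mul, h.blockB.1, Matrix.map_one _ (star_zero _) (star_one _), one_kronecker_one,
      Matrix.mul_one]
    have h2 : ∀ R : Matrix ((Fin (d l) × Fin (k' l)) × (Fin (d l) × Fin (k' l)))
        (Fin (d l) × Fin (d l)) ℂ,
        (R.submatrix (Prod.map Prod.swap Prod.swap) id)ᴴ *
          R.submatrix (Prod.map (Prod.swap : Fin (k' l) × Fin (d l) → _) Prod.swap) id =
        Rᴴ * R := by
      intro R
      ext z z'
      simp only [Matrix.mul_apply, conjTranspose_apply, submatrix_apply, id]
      exact Equiv.sum_comp ((Equiv.prodComm _ _).prodCongr (Equiv.prodComm _ _))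
        fun w => star (R w z) * R w z'
    rw [h2, pairIsometry_isometry (h.β_nonneg l) (h.β_sum l)]
  · rw [conj_pair_mul, h.blockB.2 l m hlm, zero_kronecker, Matrix.mul_zero, Matrix.zero_mul]

/-- The Markov gap vanishes. -/
theorem markovGap_eq_zero : markovGap ρ = 0 := by
  have hR : reflectedEntropy ρ = ∑ l, (Real.negMulLog (p l) +
      p l * ((∑ i, Real.negMulLog (μ l i)) + ∑ j, Real.negMulLog (μ l j))) := by
    rw [reflectedEntropy, traceRight_ketBra_canonicalPurification, h.realign_mul_eq,
      entropy_blocks ?_ ?_ fun l (z : Fin (d l) × Fin (d l)) => p l * (μ l z.1 * μ l z.2)]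
    · exact Finset.sum_congr rfl fun l _ => sum_negMulLog_mul (h.μ_sum l) (h.μ_sum l)
    · intro l
      rw [conj_pair_mul, h.blockA.1]
      have : (1 : Matrix (Fin (d l) × Fin (k l)) (Fin (d l) × Fin (k l)) ℂ).map star = 1 := by
        rw [Matrix.map_one _ (star_zero _) (star_one _)]
      rw [this, one_kronecker_one, Matrix.mul_one,
        pairIsometry_isometry (h.α_nonneg l) (h.α_sum l)]
    · intro l m hlm
      rw [conj_pair_mul, h.blockA.2 l m hlm, zero_kronecker, Matrix.mul_zero,
        Matrix.zero_mul]
  have hSA : entropy (traceRight ρ) = ∑ l, (Real.negMulLog (p l) +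
      p l * ((∑ i, Real.negMulLog (μ l i)) + ∑ j, Real.negMulLog (α l j))) := by
    rw [h.traceRight_eq, entropy_blocks h.blockA.1 h.blockA.2 fun l z => p l * (μ l z.1 * α l z.2)]
    exact Finset.sum_congr rfl fun l _ => sum_negMulLog_mul (h.μ_sum l) (h.α_sum l)
  have hSB : entropy (traceLeft ρ) = ∑ l, (Real.negMulLog (p l) +
      p l * ((∑ i, Real.negMulLog (β l i)) + ∑ j, Real.negMulLog (μ l j))) := by
    rw [h.traceLeft_eq, entropy_blocks h.blockB.1 h.blockB.2 fun l z => p l * (β l z.1 * μ l z.2)]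
    exact Finset.sum_congr rfl fun l _ => sum_negMulLog_mul (h.β_sum l) (h.μ_sum l)
  rw [markovGap, mutualInfo, hR, hSA, hSB, h.entropy_eq, ← Finset.sum_add_distrib,
    ← Finset.sum_sub_distrib, ← Finset.sum_sub_distrib]
  exact Finset.sum_eq_zero fun l _ => by ring

end IsTriangleMixture

end TriangleForm

/-! ### Normal form of the marginals of sums of triangle states -/

section NormalForm

variable {m n : Type} [Fintype m] [DecidableEq m] [Fintype n] [DecidableEq n]

lemma trace_isometry_diagonal {k : Type} [Fintype k] [DecidableEq k] {E : Matrix m k ℂ}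
    (hE : Eᴴ * E = 1) (f : k → ℂ) : (E * diagonal f * Eᴴ).trace = ∑ i, f i := by
  rw [trace_mul_comm, ← Matrix.mul_assoc, hE, Matrix.one_mul, trace_diagonal]

/-- Schmidt decomposition. -/
lemma exists_schmidt {Ω : Matrix m n ℂ} (hΩ : (Ω * Ωᴴ).trace = 1) :
    ∃ (d : ℕ) (X : Matrix m (Fin d) ℂ) (Y : Matrix n (Fin d) ℂ) (μ : Fin d → ℝ),
      (∀ x, 0 < μ x) ∧ ∑ x, μ x = 1 ∧ Xᴴ * X = 1 ∧ Yᴴ * Y = 1 ∧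
      Ω = X * diagonal (fun x => (Real.sqrt (μ x) : ℂ)) * Yᵀ := by
  have hM := posSemidef_self_mul_conjTranspose Ω
  obtain ⟨d, X, μ, hμ, hX, hX', hd⟩ := exists_isometry_diagonal hM (conjTranspose_supportProj hM)
    (supportProj_mul hM) (mul_matInvSqrt_sq hM)
  have hsupp : supportProj (Ω * Ωᴴ) * Ω = Ω := by
    have h1 := congrArg conjTranspose (mul_supportProj_conjTranspose_mul_self Ωᴴ)
    rwa [conjTranspose_mul, conjTranspose_conjTranspose, conjTranspose_supportProj hM] at h1
  have hsq : ∀ x, (Real.sqrt (μ x) : ℂ) ≠ 0 := fun x => by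
    exact_mod_cast (Real.sqrt_pos.mpr (hμ x)).ne'
  obtain ⟨D, hD⟩ : ∃ D, D = diagonal fun x => (Real.sqrt (μ x) : ℂ)⁻¹ := ⟨_, rfl⟩
  have hDh : Dᴴ = D := by
    rw [hD, diagonal_conjTranspose]
    congr 1
    ext x
    simp
  have hsum : (∑ x, (μ x : ℂ)) = 1 := by
    rw [← trace_diagonal, ← hd, trace_mul_comm, ← Matrix.mul_assoc, hX', supportProj_mul hM, hΩ]
  refine ⟨d, X, (D * Xᴴ * Ω)ᵀ, μ, hμ, by exact_mod_cast hsum, hX, ?_, ?_⟩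
  · have h1 : (D * Xᴴ * Ω)ᵀᴴ * (D * Xᴴ * Ω)ᵀ = ((D * Xᴴ * Ω) * (D * Xᴴ * Ω)ᴴ)ᵀ := by
      rw [transpose_mul (D * Xᴴ * Ω)]
      rfl
    have h2 : D * Xᴴ * Ω * (D * Xᴴ * Ω)ᴴ = D * (Xᴴ * (Ω * Ωᴴ) * X) * D := by
      rw [conjTranspose_mul, conjTranspose_mul, conjTranspose_conjTranspose, hDh]
      simp only [Matrix.mul_assoc]
    rw [h1, h2, hd, hD, diagonal_mul_diagonal, diagonal_mul_diagonal]
    have h3 : ∀ x, (Real.sqrt (μ x) : ℂ)⁻¹ * (μ x : ℂ) * (Real.sqrt (μ x) : ℂ)⁻¹ = 1 := by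
      intro x
      have h4 : (Real.sqrt (μ x) : ℂ) * Real.sqrt (μ x) = μ x := by
        exact_mod_cast Real.mul_self_sqrt (hμ x).le
      rw [← h4, inv_mul_cancel_left₀ (hsq x), mul_inv_cancel₀ (hsq x)]
    simp only [h3, diagonal_one, transpose_one]
  · rw [transpose_transpose, ← Matrix.mul_assoc, ← Matrix.mul_assoc, Matrix.mul_assoc X, hD,
      diagonal_mul_diagonal]
    simp only [mul_inv_cancel₀ (hsq _), diagonal_one, Matrix.mul_one]
    rw [hX', hsupp]

lemma IsBlockDecomposition.mul {N : ℕ} {d₁ d₂ k₁ k₂ : Fin N → ℕ}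
    {U : ∀ l, Matrix n (Fin (d₁ l) × Fin (d₂ l)) ℂ} (hU : IsBlockDecomposition d₁ d₂ U)
    {R : ∀ l, Matrix (Fin (d₁ l) × Fin (d₂ l)) (Fin (k₁ l) × Fin (k₂ l)) ℂ}
    (hR : ∀ l, (R l)ᴴ * R l = 1) : IsBlockDecomposition k₁ k₂ fun l => U l * R l := by
  have h : ∀ l m, (U l * R l)ᴴ * (U m * R m) = (R l)ᴴ * ((U l)ᴴ * U m) * R m := fun l m => by
    rw [conjTranspose_mul]
    simp only [Matrix.mul_assoc]
  constructor
  · intro l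
    rw [h, hU.1, Matrix.mul_one, hR]
  · intro l m hlm
    rw [h, hU.2 l m hlm, Matrix.mul_zero, Matrix.zero_mul]

lemma kron_isometry {m' n' : Type} [Fintype m'] [DecidableEq m'] [Fintype n'] [DecidableEq n']
    {X : Matrix m m' ℂ} {Y : Matrix n n' ℂ} (hX : Xᴴ * X = 1) (hY : Yᴴ * Y = 1) :
    (X ⊗ₖ Y)ᴴ * (X ⊗ₖ Y) = 1 := by
  rw [conjTranspose_kronecker, ← mul_kronecker_mul, hX, hY, one_kronecker_one]

lemma kron_mul_schmidtIsometry_apply {m₁ m₂ n₁ n₂ : Type} {d k k' : ℕ} (X : Matrix m₁ (Fin d) ℂ)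
    (Z : Matrix m₂ (Fin k) ℂ) (Z' : Matrix n₁ (Fin k') ℂ) (Y : Matrix n₂ (Fin d) ℂ)
    (μ : Fin d → ℝ) (i₁ : m₁) (i₂ : m₂) (j₁ : n₁) (j₂ : n₂) (s : Fin k) (t : Fin k') :
    (((X ⊗ₖ Z) ⊗ₖ (Z' ⊗ₖ Y)) * schmidtIsometry k k' μ) ((i₁, i₂), (j₁, j₂)) (s, t) =
      (X * diagonal (fun x => (Real.sqrt (μ x) : ℂ)) * Yᵀ) i₁ j₂ * Z i₂ s * Z' j₁ t := by
  have h1 : ∀ x s' t' y, X i₁ x * Z i₂ s' * (Z' j₁ t' * Y j₂ y) *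
      schmidtIsometry k k' μ ((x, s'), (t', y)) (s, t) =
      if x = y then (if s' = s then (if t' = t then
        X i₁ x * Real.sqrt (μ x) * Y j₂ x * Z i₂ s * Z' j₁ t else 0) else 0) else 0 := by
    intro x s' t' y
    simp only [schmidtIsometry]
    by_cases h2 : x = y
    · by_cases h3 : s' = s
      · by_cases h4 : t' = t
        · subst h2 h3 h4
          simp only [and_self, if_true]
          ring
        · simp [h4]
      · simp [h3]
    · simp [h2]
  rw [Matrix.mul_apply, mul_diagonal_mul_transpose_apply]
  simp only [kroneckerMap_apply, Fintype.sum_prod_type, h1, Finset.sum_ite_eq, Finset.sum_ite_eq',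
    Finset.mem_univ, if_true, Finset.sum_ite_irrel, Finset.sum_const_zero, Finset.sum_mul]

/-- Marginals of sums of triangle states, after Schmidt decompositions of the states `ψ^l_{A₁B₂}`
and spectral decompositions of the reduced states on `A₂` and `B₁`. -/
theorem IsSOTS.exists_isTriangleMixture {a b c : Type} [Fintype a] [DecidableEq a] [Fintype b]
    [DecidableEq b] [Fintype c] {ψ : (a × b) × c → ℂ} (hψ : IsSOTS ψ) :
    ∃ (N : ℕ) (d k k' : Fin N → ℕ) (p : Fin N → ℝ) (μ : ∀ l, Fin (d l) → ℝ)
      (α : ∀ l, Fin (k l) → ℝ) (β : ∀ l, Fin (k' l) → ℝ)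
      (A : ∀ l, Matrix a (Fin (d l) × Fin (k l)) ℂ) (B : ∀ l, Matrix b (Fin (k' l) × Fin (d l)) ℂ),
      IsTriangleMixture (marginalAB ψ) d k k' p μ α β A B := by
  classical
  obtain ⟨N, p, a₁, a₂, b₁, b₂, c₁, c₂, U, V, W, ψAB, ψBC, ψCA, hp, hp1, hU, hV, hW, hAB, hBC, hCA,
    hψ⟩ := hψ
  have hunit : ∀ {m n : Type} [Fintype m] [Fintype n] (φ : m × n → ℂ) (_ : IsUnitVector φ),
      ((Matrix.of fun x y => φ (x, y)) * (Matrix.of fun x y => φ (x, y))ᴴ : Matrix m m ℂ).trace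
        = 1 := by
    intro m n _ _ φ hφ
    rw [IsUnitVector, Fintype.sum_prod_type] at hφ
    simp only [trace, Matrix.diag_apply, Matrix.mul_apply, conjTranspose_apply, of_apply,
      Complex.star_def, Complex.mul_conj, Complex.normSq_eq_norm_sq]
    exact_mod_cast hφ
  have hswap : ∀ {m n : Type} [Fintype m] [Fintype n] (φ : m × n → ℂ) (_ : IsUnitVector φ),
      IsUnitVector fun x : n × m => φ (x.2, x.1) := by
    intro m n _ _ φ hφ
    rw [IsUnitVector] at hφ ⊢
    rw [← hφ]
    exact Equiv.sum_comp (Equiv.prodComm n m) fun x => ‖φ x‖ ^ 2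
  choose d X Y μ hμ hμ1 hX hY hXY using fun l => exists_schmidt (hunit (ψAB l) (hAB l))
  have hΓ := fun l => hunit _ (hswap _ (hCA l))
  have hΘ := fun l => hunit _ (hBC l)
  -- on `A₂` and `B₁` only the reduced states of `ψ^l_{C₁A₂}` and `ψ^l_{B₁C₂}` matter
  obtain ⟨Γ, hΓe⟩ : ∃ Γ : ∀ l, Matrix (Fin (a₂ l)) (Fin (c₁ l)) ℂ,
    Γ = fun l => Matrix.of fun x z => ψCA l (z, x) := ⟨_, rfl⟩
  obtain ⟨Θ, hΘe⟩ : ∃ Θ : ∀ l, Matrix (Fin (b₁ l)) (Fin (c₂ l)) ℂ,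
    Θ = fun l => Matrix.of fun y z => ψBC l (y, z) := ⟨_, rfl⟩
  choose Z α hZ hZ' hα hZα _ using fun l =>
    exists_spectral_nonneg (posSemidef_self_mul_conjTranspose (Γ l))
  choose Z' β hZ2 hZ2' hβ hZβ _ using fun l =>
    exists_spectral_nonneg (posSemidef_self_mul_conjTranspose (Θ l))
  refine ⟨N, d, a₂, b₁, p, μ, α, β, fun l => U l * (X l ⊗ₖ Z l), fun l => V l * (Z' l ⊗ₖ Y l),
    hp, hp1, hμ, hμ1, hα, fun l => ?_, hβ, fun l => ?_, hU.mul fun l => kron_isometry (hX l) (hZ l),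
    hV.mul fun l => kron_isometry (hZ2 l) (hY l), ?_⟩
  · have h1 : (Γ l * (Γ l)ᴴ).trace = 1 := by rw [hΓe]; exact hΓ l
    rw [hZα, trace_isometry_diagonal (hZ l)] at h1
    exact_mod_cast h1
  · have h1 : (Θ l * (Θ l)ᴴ).trace = 1 := by rw [hΘe]; exact hΘ l
    rw [hZβ, trace_isometry_diagonal (hZ2 l)] at h1
    exact_mod_cast h1
  obtain ⟨T, hT⟩ : ∃ T : ∀ l, Matrix ((Fin (a₁ l) × Fin (a₂ l)) × (Fin (b₁ l) × Fin (b₂ l)))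
      (Fin (c₁ l) × Fin (c₂ l)) ℂ, T = fun l => Matrix.of fun w z =>
        ψAB l (w.1.1, w.2.2) * ψBC l (w.2.1, z.2) * ψCA l (z.1, w.1.2) := ⟨_, rfl⟩
  -- the isometries `W l` drop out when `C` is traced out
  have hΨ : stateMatrix ψ = ∑ l, ((U l ⊗ₖ V l) * T l) *
      diagonal (fun _ : Fin (c₁ l) × Fin (c₂ l) => (Real.sqrt (p l) : ℂ)) * (W l)ᵀ := by
    ext ⟨i, j⟩ m
    rw [stateMatrix, hψ, Matrix.sum_apply]
    refine Finset.sum_congr rfl fun l _ => ?_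
    have hUV : ∀ z, ((U l ⊗ₖ V l) * T l) (i, j) z = ∑ x, ∑ y, U l i x * V l j y *
        (ψAB l (x.1, y.2) * ψBC l (y.1, z.2) * ψCA l (z.1, x.2)) := by
      intro z
      rw [Matrix.mul_apply, Fintype.sum_prod_type, hT]
      rfl
    rw [mul_diagonal_mul_transpose_apply]
    simp only [hUV, Finset.sum_mul, Finset.mul_sum]
    conv_rhs => rw [Finset.sum_comm]
    refine Finset.sum_congr rfl fun x _ => ?_
    conv_rhs => rw [Finset.sum_comm]
    exact Finset.sum_congr rfl fun _ _ => Finset.sum_congr rfl fun _ _ => by ring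
  rw [marginalAB_eq, hΨ, blocks_mul_conjTranspose _ hW.1 hW.2 (f := fun l _ => p l) fun l _ => hp l]
  refine Finset.sum_congr rfl fun l _ => ?_
  have hterm : T l * diagonal (fun _ : Fin (c₁ l) × Fin (c₂ l) => (p l : ℂ)) * (T l)ᴴ =
      (((X l ⊗ₖ Z l) ⊗ₖ (Z' l ⊗ₖ Y l)) * schmidtIsometry (a₂ l) (b₁ l) (μ l)) *
      diagonal (fun z : Fin _ × Fin _ => ((p l * (α l z.1 * β l z.2) : ℝ) : ℂ)) *
      (((X l ⊗ₖ Z l) ⊗ₖ (Z' l ⊗ₖ Y l)) * schmidtIsometry (a₂ l) (b₁ l) (μ l))ᴴ := by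
    ext ⟨⟨x, x'⟩, ⟨y, y'⟩⟩ ⟨⟨r, r'⟩, ⟨q, q'⟩⟩
    have h1 := congrFun (congrFun (hZα l) x') r'
    have h2 := congrFun (congrFun (hZβ l) y) q
    rw [mul_diagonal_mul_conjTranspose_apply] at h1 h2
    rw [mul_diagonal_mul_conjTranspose_apply, mul_diagonal_mul_conjTranspose_apply]
    simp only [Fintype.sum_prod_type, kron_mul_schmidtIsometry_apply, ← hXY]
    calc _ = (p l : ℂ) * (ψAB l (x, y') * star (ψAB l (r, q'))) * (Γ l * (Γ l)ᴴ) x' r' *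
          (Θ l * (Θ l)ᴴ) y q := by
          rw [hT, hΓe, hΘe]
          simp only [of_apply, Matrix.mul_apply, conjTranspose_apply, Finset.sum_mul,
            Finset.mul_sum, star_mul']
          rw [Finset.sum_comm]
          exact Finset.sum_congr rfl fun _ _ => Finset.sum_congr rfl fun _ _ => by ring
      _ = _ := by
          rw [h1, h2]
          simp only [of_apply, Finset.sum_mul, Finset.mul_sum, star_mul']
          rw [Finset.sum_comm]
          refine Finset.sum_congr rfl fun _ _ => Finset.sum_congr rfl fun _ _ => ?_
          push_cast
          ring
  calc _ = (U l ⊗ₖ V l) *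
        (T l * diagonal (fun _ : Fin (c₁ l) × Fin (c₂ l) => (p l : ℂ)) * (T l)ᴴ) *
        (U l ⊗ₖ V l)ᴴ := by
        rw [conjTranspose_mul]
        simp only [Matrix.mul_assoc]
    _ = _ := by
        rw [hterm, mul_kronecker_mul]
        simp only [conjTranspose_mul, Matrix.mul_assoc]

end NormalForm

/-! ### Tensor powers -/

section TensorPower

variable {ι : Type} [Fintype ι] [DecidableEq ι] {a b a' b' a'' b'' : Type}

/-- Tensor products of matrices over the index set `ι`. -/
def tensorMat (K : ι → Matrix a a' ℂ) : Matrix (ι → a) (ι → a') ℂ :=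
  fun x y => ∏ i, K i (x i) (y i)

/-- Tensor products of bipartite operators, with all `A` systems collected before all `B`
systems. -/
def tensorOp (M : ι → Matrix (a × b) (a' × b') ℂ) :
    Matrix ((ι → a) × (ι → b)) ((ι → a') × (ι → b')) ℂ :=
  fun x y => ∏ i, M i (x.1 i, x.2 i) (y.1 i, y.2 i)

lemma sum_prod_apply {R : Type} [CommSemiring R] [Fintype a] (F : ι → a → R) :
    ∑ x : ι → a, ∏ i, F i (x i) = ∏ i, ∑ y, F i y := by
  classical
  rw [Finset.prod_univ_sum, Fintype.piFinset_univ]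

lemma sum_prod_apply_pair {R : Type} [CommSemiring R] [Fintype a] [Fintype b]
    (F : ι → a × b → R) :
    ∑ x : (ι → a) × (ι → b), ∏ i, F i (x.1 i, x.2 i) = ∏ i, ∑ y, F i y := by
  rw [← sum_prod_apply, ← (Equiv.arrowProdEquivProdArrow ι (fun _ => a) fun _ => b).sum_comp]
  rfl

lemma tensorMat_mul [Fintype a'] (K : ι → Matrix a a' ℂ) (K' : ι → Matrix a' a'' ℂ) :
    tensorMat K * tensorMat K' = tensorMat fun i => K i * K' i := by
  ext x y
  simp only [tensorMat, Matrix.mul_apply, ← Finset.prod_mul_distrib]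
  exact sum_prod_apply fun i j => K i (x i) j * K' i j (y i)

lemma conjTranspose_tensorMat (K : ι → Matrix a a' ℂ) :
    (tensorMat K)ᴴ = tensorMat fun i => (K i)ᴴ := by
  ext x y
  simp [tensorMat, conjTranspose_apply]

lemma tensorMat_one [DecidableEq a] : tensorMat (fun _ : ι => (1 : Matrix a a ℂ)) = 1 := by
  ext x y
  rw [tensorMat]
  by_cases h : x = y
  · subst h
    simp
  · rw [one_apply_ne h]
    obtain ⟨i, hi⟩ := Function.ne_iff.mp h
    exact Finset.prod_eq_zero (Finset.mem_univ i) (one_apply_ne hi)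

/-- Measuring every tensor factor by itself is a measurement. -/
lemma sum_tensorMat_kraus {κ : Type} [Fintype κ] [Fintype a] [Fintype a'] [DecidableEq a']
    {K : κ → Matrix a a' ℂ} (hK : ∑ k, (K k)ᴴ * K k = 1) :
    ∑ f : ι → κ, (tensorMat fun i => K (f i))ᴴ * tensorMat (fun i => K (f i)) = 1 := by
  simp only [conjTranspose_tensorMat, tensorMat_mul]
  rw [← tensorMat_one]
  ext x y
  rw [Matrix.sum_apply]
  simp only [tensorMat, ← hK, Matrix.sum_apply]
  exact sum_prod_apply fun i k => ((K k)ᴴ * K k) (x i) (y i)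

lemma tensorMat_kronecker (K : ι → Matrix a a' ℂ) (L : ι → Matrix b b' ℂ) :
    tensorMat K ⊗ₖ tensorMat L = tensorOp fun i => K i ⊗ₖ L i := by
  ext x y
  simp only [tensorMat, tensorOp, kroneckerMap_apply, Finset.prod_mul_distrib]

lemma tensorOp_mul [Fintype a'] [Fintype b'] (M : ι → Matrix (a × b) (a' × b') ℂ)
    (M' : ι → Matrix (a' × b') (a'' × b'') ℂ) :
    tensorOp M * tensorOp M' = tensorOp fun i => M i * M' i := by
  ext x y
  simp only [tensorOp, Matrix.mul_apply, ← Finset.prod_mul_distrib]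
  exact sum_prod_apply_pair fun i p => M i (x.1 i, x.2 i) p * M' i p (y.1 i, y.2 i)

lemma conjTranspose_tensorOp (M : ι → Matrix (a × b) (a' × b') ℂ) :
    (tensorOp M)ᴴ = tensorOp fun i => (M i)ᴴ := by
  ext x y
  simp [tensorOp, conjTranspose_apply]

lemma copies_eq (ρ : Matrix (a × b) (a × b) ℂ) (n : ℕ) : copies ρ n = tensorOp fun _ => ρ := rfl

end TensorPower

/-! ### Keeping some of the qubits -/

section Discard

variable {n m r : ℕ}

/-- Qubits on `n` positions from qubits on `m` selected positions and on the `r` other positions. -/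
def glue (E : Fin m ⊕ Fin r ≃ Fin n) (x : Fin m → Fin 2) (u : Fin r → Fin 2) : Fin n → Fin 2 :=
  fun i => Sum.elim x u (E.symm i)

/-- The Kraus operator that keeps the selected qubits and finds the others in the basis state
`u`. -/
def discard (E : Fin m ⊕ Fin r ≃ Fin n) (u : Fin r → Fin 2) :
    Matrix (Fin m → Fin 2) (Fin n → Fin 2) ℂ :=
  fun x y => if y = glue E x u then 1 else 0

/-- Splitting bit strings into selected and other positions. -/
def glueEquiv (E : Fin m ⊕ Fin r ≃ Fin n) :
    (Fin m → Fin 2) × (Fin r → Fin 2) ≃ (Fin n → Fin 2) :=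
  (Equiv.sumArrowEquivProdArrow (Fin m) (Fin r) (Fin 2)).symm.trans
    (Equiv.arrowCongr E (Equiv.refl _))

lemma glueEquiv_apply (E : Fin m ⊕ Fin r ≃ Fin n) (x : Fin m → Fin 2) (u : Fin r → Fin 2) :
    glueEquiv E (x, u) = glue E x u := rfl

lemma sum_discard_kraus (E : Fin m ⊕ Fin r ≃ Fin n) :
    ∑ u, (discard E u)ᴴ * discard E u = 1 := by
  ext y y'
  simp only [Matrix.sum_apply, Matrix.mul_apply, conjTranspose_apply]
  rw [Finset.sum_comm, ← Fintype.sum_prod_type'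
    (f := fun x u => star (discard E u x y) * discard E u x y')]
  have h : ∀ z : (Fin m → Fin 2) × (Fin r → Fin 2),
      star (discard E z.2 z.1 y) * discard E z.2 z.1 y' =
        (fun t => (if y = t then (1 : ℂ) else 0) * if y' = t then 1 else 0) (glueEquiv E z) := by
    rintro ⟨x, u⟩
    by_cases hy : y = glueEquiv E (x, u) <;> by_cases hy' : y' = glueEquiv E (x, u) <;>
      simp [discard, ← glueEquiv_apply, hy, hy']
  rw [Finset.sum_congr rfl fun z _ => h z,
    (glueEquiv E).sum_comp fun t => (if y = t then (1 : ℂ) else 0) * if y' = t then 1 else 0]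
  simp [one_apply]

lemma discard_conj_apply (E : Fin m ⊕ Fin r ≃ Fin n) (u v : Fin r → Fin 2)
    (X : Matrix ((Fin n → Fin 2) × (Fin n → Fin 2)) ((Fin n → Fin 2) × (Fin n → Fin 2)) ℂ)
    (x y : (Fin m → Fin 2) × (Fin m → Fin 2)) :
    ((discard E u ⊗ₖ discard E v) * X * (discard E u ⊗ₖ discard E v)ᴴ) x y =
      X (glue E x.1 u, glue E x.2 v) (glue E y.1 u, glue E y.2 v) := by
  have h : ∀ x p : (_ → _) × (_ → _), (discard E u ⊗ₖ discard E v) x p =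
      if p = (glue E x.1 u, glue E x.2 v) then 1 else 0 := by
    intro x p
    simp only [kroneckerMap_apply, discard, Prod.ext_iff]
    split_ifs <;> simp_all
  simp only [Matrix.mul_apply, conjTranspose_apply, h, ite_mul, one_mul, zero_mul,
    Finset.sum_ite_eq', Finset.mem_univ, if_true, apply_ite star, star_one, star_zero, mul_ite,
    mul_one, mul_zero]

/-- The Bell pair, i.e. the single factor in `bellPairs`. -/
def bellPair : Fin 2 × Fin 2 → ℂ := fun x => if x.1 = x.2 then ((Real.sqrt 2)⁻¹ : ℂ) else 0

/-- Keeping the selected qubits of a product operator, with the fidelity with Bell pairs on the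
selected positions. -/
lemma sum_discard_bell (E : Fin m ⊕ Fin r ≃ Fin n)
    (M : Fin n → Matrix (Fin 2 × Fin 2) (Fin 2 × Fin 2) ℂ) :
    ∑ u, ∑ v, star (bellPairs m) ⬝ᵥ
      (((discard E u ⊗ₖ discard E v) * tensorOp M * (discard E u ⊗ₖ discard E v)ᴴ) *ᵥ
        bellPairs m) =
    (∏ j, star bellPair ⬝ᵥ (M (E (Sum.inl j)) *ᵥ bellPair)) *
      ∏ j, (M (E (Sum.inr j))).trace := by
  have h1 : ∀ (u v : Fin r → Fin 2) (x y : (Fin m → Fin 2) × (Fin m → Fin 2)),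
      tensorOp M (glue E x.1 u, glue E x.2 v) (glue E y.1 u, glue E y.2 v) =
      (∏ j, M (E (Sum.inl j)) (x.1 j, x.2 j) (y.1 j, y.2 j)) *
        ∏ j, M (E (Sum.inr j)) (u j, v j) (u j, v j) := by
    intro u v x y
    rw [tensorOp, ← E.prod_comp, Fintype.prod_sum_type]
    simp [glue]
  have h2 : ∏ j, (M (E (Sum.inr j))).trace =
      ∑ z : (Fin r → Fin 2) × (Fin r → Fin 2),
        ∏ j, M (E (Sum.inr j)) (z.1 j, z.2 j) (z.1 j, z.2 j) :=
    (sum_prod_apply_pair fun j p => M (E (Sum.inr j)) p p).symm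
  have h3 : ∏ j, star bellPair ⬝ᵥ (M (E (Sum.inl j)) *ᵥ bellPair) =
      ∑ x : (Fin m → Fin 2) × (Fin m → Fin 2), ∑ y : (Fin m → Fin 2) × (Fin m → Fin 2),
        star (bellPairs m x) * ((∏ j, M (E (Sum.inl j)) (x.1 j, x.2 j) (y.1 j, y.2 j)) *
          bellPairs m y) := by
    simp only [dotProduct, mulVec]
    rw [← sum_prod_apply_pair fun j p => star bellPair p * ∑ q, M (E (Sum.inl j)) p q * bellPair q]
    refine Finset.sum_congr rfl fun x _ => ?_
    rw [Finset.prod_mul_distrib, ← Finset.mul_sum]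
    congr 1
    · simp only [bellPairs, star_prod]
      rfl
    · rw [← sum_prod_apply_pair
        fun j q => M (E (Sum.inl j)) (x.1 j, x.2 j) q * bellPair q]
      refine Finset.sum_congr rfl fun y _ => ?_
      rw [Finset.prod_mul_distrib]
      rfl
  rw [h2, h3, Finset.mul_sum, Fintype.sum_prod_type]
  refine Finset.sum_congr rfl fun u _ => Finset.sum_congr rfl fun v _ => ?_
  simp only [dotProduct, mulVec, discard_conj_apply, h1, Finset.sum_mul, Finset.mul_sum,
    Pi.star_apply]
  exact Finset.sum_congr rfl fun x _ => Finset.sum_congr rfl fun y _ => by ring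

/-- A selection of `m` out of `n` positions that stays within `S` if `S` is large enough. -/
lemma exists_select_equiv (hmn : m ≤ n) (S : Finset (Fin n)) :
    ∃ E : Fin m ⊕ Fin (n - m) ≃ Fin n, m ≤ S.card → ∀ j, E (Sum.inl j) ∈ S := by
  classical
  obtain ⟨e, he, heS⟩ : ∃ e : Fin m → Fin n, Function.Injective e ∧
      (m ≤ S.card → ∀ j, e j ∈ S) := by
    by_cases h : m ≤ S.card
    · exact ⟨S.orderEmbOfCardLe h, (S.orderEmbOfCardLe h).injective,
        fun _ j => S.orderEmbOfCardLe_mem h j⟩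
    · exact ⟨Fin.castLE hmn, Fin.castLE_injective hmn, fun h' => absurd h' h⟩
  let E₀ : Fin m ⊕ ↑(Set.range e)ᶜ ≃ Fin n :=
    (Equiv.sumCongr (Equiv.ofInjective e he) (Equiv.refl _)).trans (Equiv.Set.sumCompl _)
  have hcard : Fintype.card ↑(Set.range e)ᶜ = n - m := by
    have h1 := Fintype.card_congr E₀
    rw [Fintype.card_sum, Fintype.card_fin, Fintype.card_fin] at h1
    omega
  refine ⟨(Equiv.sumCongr (Equiv.refl _) (Fintype.equivFinOfCardEq hcard).symm).trans E₀,
    fun h j => ?_⟩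
  exact heS h j

end Discard

/-! ### Distillation by local filtering -/

section Counting

variable {Ω : Type} [Fintype Ω] [DecidableEq Ω]

/-- Independent trials with law `w`; those with outcome `o` succeed. If `m` of the trials are
selected, successful ones whenever there are at least `m` of these, then replacing the weights of
the selected trials by smaller ones that agree at `o` loses only the probability of having fewer
than `m` successes, for which a Chernoff bound is used. -/
lemma sum_selected_bounds {n m r : ℕ} {w β : Ω → ℝ} {q : ℝ} {o : Ω}
    (hβ : ∀ y, 0 ≤ β y) (hβw : ∀ y, β y ≤ w y) (hw : ∑ y, w y = 1) (hβo : β o = w o)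
    (hq : w o = q) (E : (Fin n → Ω) → Fin m ⊕ Fin r ≃ Fin n)
    (hE : ∀ x : Fin n → Ω, m ≤ (Finset.univ.filter fun i => x i = o).card →
      ∀ j, x (E x (Sum.inl j)) = o) :
    1 - 2 ^ m * (1 - q / 2) ^ n ≤
      ∑ x : Fin n → Ω, (∏ j, β (x (E x (Sum.inl j)))) * ∏ j, w (x (E x (Sum.inr j))) ∧
    ∑ x : Fin n → Ω, (∏ j, β (x (E x (Sum.inl j)))) * ∏ j, w (x (E x (Sum.inr j))) ≤ 1 := by
  have hw0 : ∀ y, 0 ≤ w y := fun y => (hβ y).trans (hβw y)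
  have hsplit : ∀ x : Fin n → Ω, ∏ i, w (x i) =
      (∏ j, w (x (E x (Sum.inl j)))) * ∏ j, w (x (E x (Sum.inr j))) := fun x => by
    rw [← (E x).prod_comp, Fintype.prod_sum_type]
  have hone : ∑ x : Fin n → Ω, ∏ i, w (x i) = 1 := by
    rw [sum_prod_apply fun _ y => w y]
    simp [hw]
  -- the expectation of `(1 / 2) ^ (number of successes)`
  have hhalf : ∑ x : Fin n → Ω,
      (∏ i, w (x i)) * (1 / 2) ^ (Finset.univ.filter fun i => x i = o).card =
        (1 - q / 2) ^ n := by
    have h1 : ∀ x : Fin n → Ω,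
        (∏ i, w (x i)) * (1 / 2) ^ (Finset.univ.filter fun i => x i = o).card =
          ∏ i, w (x i) * if x i = o then 1 / 2 else 1 := fun x => by
      rw [Finset.prod_mul_distrib, Finset.prod_ite, Finset.prod_const, Finset.prod_const_one,
        mul_one]
    have h2 : ∑ y, (w y * if y = o then 1 / 2 else 1) = 1 - q / 2 := by
      have h3 : ∀ y, (w y * if y = o then (1 / 2 : ℝ) else 1) =
          w y - if y = o then w y / 2 else 0 := fun y => by
        split_ifs <;> ring
      rw [Finset.sum_congr rfl fun y _ => h3 y, Finset.sum_sub_distrib, hw]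
      simp [hq]
    rw [Finset.sum_congr rfl fun x _ => h1 x,
      sum_prod_apply fun _ y => w y * if y = o then 1 / 2 else 1, h2]
    simp
  constructor
  · refine le_of_eq_of_le (b := ∑ x : Fin n → Ω, (∏ i, w (x i) - 2 ^ m * ((∏ i, w (x i)) *
      (1 / 2) ^ (Finset.univ.filter fun i => x i = o).card))) ?_
      (Finset.sum_le_sum fun x _ => ?_)
    · rw [Finset.sum_sub_distrib, ← Finset.mul_sum, hone, hhalf]
    set c := (Finset.univ.filter fun i => x i = o).card with hc
    have hP : 0 ≤ ∏ i, w (x i) := Finset.prod_nonneg fun i _ => hw0 _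
    by_cases hm : m ≤ c
    · have h1 : ∏ j, β (x (E x (Sum.inl j))) = ∏ j, w (x (E x (Sum.inl j))) :=
        Finset.prod_congr rfl fun j _ => by rw [hE x hm j, hβo]
      rw [h1, ← hsplit]
      have h2 : 0 ≤ (2 : ℝ) ^ m * ((∏ i, w (x i)) * (1 / 2) ^ c) := by positivity
      linarith
    · -- with fewer than `m` successes the lower bound is trivial
      have h1 : (1 : ℝ) ≤ 2 ^ m * (1 / 2) ^ c := by
        rw [one_div, inv_pow, ← div_eq_mul_inv, one_le_div (by positivity)]
        exact pow_le_pow_right₀ (by norm_num) (not_le.mp hm).le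
      have h2 : 0 ≤ (∏ j, β (x (E x (Sum.inl j)))) * ∏ j, w (x (E x (Sum.inr j))) :=
        mul_nonneg (Finset.prod_nonneg fun j _ => hβ _) (Finset.prod_nonneg fun j _ => hw0 _)
      nlinarith
  · rw [← hone]
    refine Finset.sum_le_sum fun x _ => ?_
    rw [hsplit]
    exact mul_le_mul_of_nonneg_right
      (Finset.prod_le_prod (fun j _ => hβ _) fun j _ => hβw _)
      (Finset.prod_nonneg fun j _ => hw0 _)

end Counting

lemma dotProduct_bellPair : star bellPair ⬝ᵥ bellPair = 1 := by
  have h : ((Real.sqrt 2 : ℝ) : ℂ) * (Real.sqrt 2 : ℝ) = 2 := by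
    rw [← Complex.ofReal_mul, Real.mul_self_sqrt (by norm_num)]
    norm_num
  have h0 : ((Real.sqrt 2 : ℝ) : ℂ) ≠ 0 := by
    intro h0
    rw [h0] at h
    norm_num at h
  simp [dotProduct, bellPair, Fintype.sum_prod_type]
  field_simp
  rw [sq, h]

/-- The weight of a pure state in a positive operator is at most the trace. -/
lemma dotProduct_mulVec_le_trace {x : Type} [Fintype x] [DecidableEq x] {M : Matrix x x ℂ}
    (hM : M.PosSemidef) {v : x → ℂ} (hv : star v ⬝ᵥ v = 1) : star v ⬝ᵥ (M *ᵥ v) ≤ M.trace := by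
  have hP : (1 - ketBra v) * (1 - ketBra v) = 1 - ketBra v := by
    have : ketBra v * ketBra v = ketBra v := by
      rw [ketBra, vecMulVec_mul_vecMulVec, hv, one_smul]
    rw [mul_sub, sub_mul, sub_mul, this]
    simp
  have hPh : (1 - ketBra v)ᴴ = 1 - ketBra v := by
    rw [conjTranspose_sub, conjTranspose_one, ketBra, conjTranspose_vecMulVec, star_star]
  have h := (hM.mul_mul_conjTranspose_same (1 - ketBra v)).trace_nonneg
  rw [hPh, trace_mul_cycle, hP, sub_mul, one_mul, trace_sub, ketBra, vecMulVec_mul,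
    trace_vecMulVec] at h
  rw [dotProduct_mulVec, dotProduct_comm]
  exact sub_nonneg.mp h

section Filter

variable {a b : Type} [Fintype a] [DecidableEq a] [Fintype b] [DecidableEq b]
  {κ κ' : Type} [Fintype κ] [DecidableEq κ] [Fintype κ'] [DecidableEq κ']

/-- Both parties measure every copy with the Kraus operators `K` and `L`; then they keep those
`m` pairs of qubits that `E` selects for the observed outcomes, and measure and discard the other
ones. The selection depends on the outcomes of both parties, which they have communicated. -/
def filterProtocol {n m r : ℕ} (K : κ → Matrix (Fin 2) a ℂ) (L : κ' → Matrix (Fin 2) b ℂ)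
    (E : (Fin n → κ) → (Fin n → κ') → Fin m ⊕ Fin r ≃ Fin n)
    (X : Matrix ((Fin n → a) × (Fin n → b)) ((Fin n → a) × (Fin n → b)) ℂ) :
    Matrix ((Fin m → Fin 2) × (Fin m → Fin 2)) ((Fin m → Fin 2) × (Fin m → Fin 2)) ℂ :=
  ∑ f : Fin n → κ, ∑ g : Fin n → κ', ∑ u, ∑ v,
    ((1 : Matrix (Fin m → Fin 2) (Fin m → Fin 2) ℂ) ⊗ₖ discard (E f g) v) *
      ((discard (E f g) u ⊗ₖ (1 : Matrix (Fin n → Fin 2) (Fin n → Fin 2) ℂ)) *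
        (((1 : Matrix (Fin n → Fin 2) (Fin n → Fin 2) ℂ) ⊗ₖ tensorMat fun i => L (g i)) *
          (((tensorMat fun i => K (f i)) ⊗ₖ (1 : Matrix (Fin n → b) (Fin n → b) ℂ)) * X *
            ((tensorMat fun i => K (f i)) ⊗ₖ (1 : Matrix (Fin n → b) (Fin n → b) ℂ))ᴴ) *
          ((1 : Matrix (Fin n → Fin 2) (Fin n → Fin 2) ℂ) ⊗ₖ tensorMat fun i => L (g i))ᴴ) *
        (discard (E f g) u ⊗ₖ (1 : Matrix (Fin n → Fin 2) (Fin n → Fin 2) ℂ))ᴴ) *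
      ((1 : Matrix (Fin m → Fin 2) (Fin m → Fin 2) ℂ) ⊗ₖ discard (E f g) v)ᴴ

lemma isLOCC_filterProtocol {n m r : ℕ} {K : κ → Matrix (Fin 2) a ℂ} {L : κ' → Matrix (Fin 2) b ℂ}
    (hK : ∑ k, (K k)ᴴ * K k = 1) (hL : ∑ k, (L k)ᴴ * L k = 1)
    (E : (Fin n → κ) → (Fin n → κ') → Fin m ⊕ Fin r ≃ Fin n) :
    IsLOCC (filterProtocol K L E) :=
  IsLOCC.alice (fun _ => Fin n → Fin 2) (fun f : Fin n → κ => tensorMat fun i => K (f i))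
    (sum_tensorMat_kraus hK) _ fun f =>
  IsLOCC.bob (fun _ => Fin n → Fin 2) (fun g : Fin n → κ' => tensorMat fun i => L (g i))
    (sum_tensorMat_kraus hL) _ fun g =>
  IsLOCC.alice (fun _ => Fin m → Fin 2) (fun u => discard (E f g) u)
    (sum_discard_kraus (E f g)) _ fun _ =>
  IsLOCC.bob (fun _ => Fin m → Fin 2) (fun v => discard (E f g) v)
    (sum_discard_kraus (E f g)) _ fun _ => IsLOCC.stop_here

lemma filterProtocol_copies {n m r : ℕ} (K : κ → Matrix (Fin 2) a ℂ) (L : κ' → Matrix (Fin 2) b ℂ)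
    (E : (Fin n → κ) → (Fin n → κ') → Fin m ⊕ Fin r ≃ Fin n) (ρ : Matrix (a × b) (a × b) ℂ) :
    filterProtocol K L E (copies ρ n) =
      ∑ f : Fin n → κ, ∑ g : Fin n → κ', ∑ u, ∑ v,
        (discard (E f g) u ⊗ₖ discard (E f g) v) *
          tensorOp (fun i => (K (f i) ⊗ₖ L (g i)) * ρ * (K (f i) ⊗ₖ L (g i))ᴴ) *
          (discard (E f g) u ⊗ₖ discard (E f g) v)ᴴ := by
  refine Finset.sum_congr rfl fun f _ => Finset.sum_congr rfl fun g _ =>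
    Finset.sum_congr rfl fun u _ => Finset.sum_congr rfl fun v _ => ?_
  have h1 : (discard (E f g) u ⊗ₖ discard (E f g) v) =
      ((1 : Matrix (Fin m → Fin 2) (Fin m → Fin 2) ℂ) ⊗ₖ discard (E f g) v) *
        (discard (E f g) u ⊗ₖ (1 : Matrix (Fin n → Fin 2) (Fin n → Fin 2) ℂ)) := by
    rw [← mul_kronecker_mul, Matrix.one_mul, Matrix.mul_one]
  have h2 : (tensorOp fun i => K (f i) ⊗ₖ L (g i)) =
      ((1 : Matrix (Fin n → Fin 2) (Fin n → Fin 2) ℂ) ⊗ₖ tensorMat fun i => L (g i)) *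
        ((tensorMat fun i => K (f i)) ⊗ₖ (1 : Matrix (Fin n → b) (Fin n → b) ℂ)) := by
    rw [← mul_kronecker_mul, Matrix.one_mul, Matrix.mul_one, tensorMat_kronecker]
  rw [← tensorOp_mul, ← tensorOp_mul, ← conjTranspose_tensorOp, h2, h1, copies_eq]
  simp only [conjTranspose_mul, Matrix.mul_assoc]

/-- If measurements by the two parties can turn `ρ` into a Bell pair with positive probability `q`,
then doing so on many copies and discarding the failures distills Bell pairs at a positive rate. -/
theorem isDistillable_of_filter {ρ : Matrix (a × b) (a × b) ℂ} (hρ : IsDensity ρ)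
    {K : κ → Matrix (Fin 2) a ℂ} {L : κ' → Matrix (Fin 2) b ℂ}
    (hK : ∑ k, (K k)ᴴ * K k = 1) (hL : ∑ k, (L k)ᴴ * L k = 1) {q : ℝ} (hq : 0 < q)
    (s : κ) (t : κ')
    (h : (K s ⊗ₖ L t) * ρ * (K s ⊗ₖ L t)ᴴ = (q : ℂ) • ketBra bellPair) :
    IsDistillable ρ := by
  set τ : κ × κ' → Matrix (Fin 2 × Fin 2) (Fin 2 × Fin 2) ℂ :=
    fun y => (K y.1 ⊗ₖ L y.2) * ρ * (K y.1 ⊗ₖ L y.2)ᴴ with hτ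
  have hpos : ∀ y, (τ y).PosSemidef := fun y => hρ.1.mul_mul_conjTranspose_same _
  -- for each pair of outcomes, its probability `w` and the part `β` of it found in the Bell state
  set β : κ × κ' → ℝ := fun y => (star bellPair ⬝ᵥ (τ y *ᵥ bellPair)).re with hβ
  set w : κ × κ' → ℝ := fun y => (τ y).trace.re with hw
  have hβ0 : ∀ y, 0 ≤ star bellPair ⬝ᵥ (τ y *ᵥ bellPair) := fun y =>
    (hpos y).dotProduct_mulVec_nonneg _
  have hβc : ∀ y, star bellPair ⬝ᵥ (τ y *ᵥ bellPair) = (β y : ℂ) := fun y =>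
    (Complex.eq_re_of_ofReal_le (hβ0 y) : _)
  have hwc : ∀ y, (τ y).trace = (w y : ℂ) := fun y =>
    (Complex.eq_re_of_ofReal_le (hpos y).trace_nonneg : _)
  have hβw : ∀ y, β y ≤ w y := fun y => by
    have := dotProduct_mulVec_le_trace (hpos y) dotProduct_bellPair
    rw [hβc, hwc] at this
    exact_mod_cast this
  have hsum : ∑ y, w y = 1 := by
    have h1 : ∑ y : κ × κ', (K y.1 ⊗ₖ L y.2)ᴴ * (K y.1 ⊗ₖ L y.2) = 1 := by
      simp only [conjTranspose_kronecker, ← mul_kronecker_mul]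
      rw [Fintype.sum_prod_type, ← one_kronecker_one, ← hK, ← hL]
      ext i j
      simp only [Matrix.sum_apply, kroneckerMap_apply, Finset.sum_mul, Finset.mul_sum]
      exact Finset.sum_comm
    have h2 : ∑ y, (τ y).trace = 1 := by
      rw [← hρ.2, ← Matrix.one_mul ρ, ← h1, Finset.sum_mul, trace_sum]
      exact Finset.sum_congr rfl fun y _ => by rw [hτ, trace_mul_cycle]
    rw [Finset.sum_congr rfl fun y _ => hwc y] at h2
    exact_mod_cast h2
  have hwo : w (s, t) = q := by
    have : (τ (s, t)).trace = q := by
      change ((K s ⊗ₖ L t) * ρ * (K s ⊗ₖ L t)ᴴ).trace = _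
      rw [h, trace_smul, ketBra, trace_vecMulVec, dotProduct_comm, dotProduct_bellPair]
      simp
    rw [hwc] at this
    exact_mod_cast this
  have hβo : β (s, t) = w (s, t) := by
    have : star bellPair ⬝ᵥ (τ (s, t) *ᵥ bellPair) = q := by
      change star bellPair ⬝ᵥ (((K s ⊗ₖ L t) * ρ * (K s ⊗ₖ L t)ᴴ) *ᵥ bellPair) = _
      rw [h, smul_mulVec, dotProduct_smul, ketBra, vecMulVec_mulVec, dotProduct_smul,
        dotProduct_bellPair]
      simp
    rw [hβc] at this
    rw [hwo]
    exact_mod_cast this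
  have hq1 : q ≤ 1 := by
    rw [← hsum, ← hwo]
    exact Finset.single_le_sum (fun y _ => (by
      have := hβ0 y
      rw [hβc] at this
      exact (by exact_mod_cast this : (0 : ℝ) ≤ β y).trans (hβw y))) (Finset.mem_univ _)
  -- with `m = n / k` pairs from `n` copies, the failure probability is at most
  -- `2 ^ m * (1 - q / 2) ^ n ≤ (2 * (1 - q / 2) ^ k) ^ m`, which tends to zero for this `k`
  obtain ⟨k, hk⟩ : ∃ k : ℕ, (1 - q / 2) ^ k < 1 / 2 :=
    exists_pow_lt_of_lt_one (by norm_num) (by linarith)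
  have hk0 : 0 < k := by
    rcases Nat.eq_zero_or_pos k with h0 | h0
    · rw [h0] at hk
      norm_num at hk
    · exact h0
  have hsel : ∀ (n : ℕ) (x : Fin n → κ × κ'), ∃ E : Fin (n / k) ⊕ Fin (n - n / k) ≃ Fin n,
      n / k ≤ (Finset.univ.filter fun i => x i = (s, t)).card → ∀ j, x (E (Sum.inl j)) = (s, t) :=
    fun n x => by
      obtain ⟨E, hE⟩ := exists_select_equiv (Nat.div_le_self n k)
        (Finset.univ.filter fun i => x i = (s, t))
      exact ⟨E, fun h j => by simpa using hE h j⟩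
  choose E hE using hsel
  have hfid : ∀ n, fidelityWith (bellPairs (n / k))
      (filterProtocol K L (fun f g => E n fun i => (f i, g i)) (copies ρ n)) =
      ∑ x : Fin n → κ × κ', (∏ j, β (x (E n x (Sum.inl j)))) *
        ∏ j, w (x (E n x (Sum.inr j))) := by
    intro n
    rw [fidelityWith, filterProtocol_copies]
    simp only [sum_mulVec, dotProduct_sum]
    rw [← (Equiv.arrowProdEquivProdArrow (Fin n) (fun _ => κ) fun _ => κ').symm.sum_comp,
      Fintype.sum_prod_type, Complex.re_sum]
    refine Finset.sum_congr rfl fun f _ => ?_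
    rw [Complex.re_sum]
    refine Finset.sum_congr rfl fun g _ => ?_
    rw [sum_discard_bell (E n fun i => (f i, g i)) fun i => τ (f i, g i)]
    simp only [hβc, hwc]
    rw [← Complex.ofReal_prod, ← Complex.ofReal_prod, ← Complex.ofReal_mul, Complex.ofReal_re]
    rfl
  have hbounds := fun n => sum_selected_bounds
    (fun y => (by
      have := hβ0 y
      rw [hβc] at this
      exact_mod_cast this : 0 ≤ β y)) hβw hsum hβo hwo (E n) (hE n)
  refine ⟨1 / (2 * k), by positivity, fun n => n / k,
    fun n => filterProtocol K L fun f g => E n fun i => (f i, g i),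
    fun n => isLOCC_filterProtocol hK hL _, ?_, ?_⟩
  · filter_upwards [Filter.eventually_ge_atTop k] with n hn
    have h1 : 1 ≤ n / k := (Nat.one_le_div_iff hk0).mpr hn
    have h2 : n < k * (n / k + 1) := Nat.lt_mul_div_succ n hk0
    have h3 : (n : ℝ) ≤ k * ((n / k : ℕ) + 1) := by exact_mod_cast h2.le
    have h4 : (1 : ℝ) ≤ (n / k : ℕ) := by exact_mod_cast h1
    have h5 : (0 : ℝ) < k := by exact_mod_cast hk0
    rw [one_div, inv_mul_le_iff₀ (by positivity)]
    nlinarith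
  · simp only [hfid]
    have h0 : 0 ≤ 1 - q / 2 := by linarith
    have hlim : Filter.Tendsto (fun n : ℕ => 1 - (2 * (1 - q / 2) ^ k) ^ (n / k))
        Filter.atTop (𝓝 1) := by
      have h1 := (tendsto_pow_atTop_nhds_zero_of_lt_one
        (r := 2 * (1 - q / 2) ^ k) (by positivity) (by linarith)).comp
        (Nat.tendsto_div_const_atTop hk0.ne')
      simpa using h1.const_sub 1
    refine tendsto_of_tendsto_of_tendsto_of_le_of_le hlim tendsto_const_nhds
      (fun n => le_trans ?_ (hbounds n).1) fun n => (hbounds n).2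
    have h1 : (1 - q / 2) ^ n ≤ (1 - q / 2) ^ (k * (n / k)) :=
      pow_le_pow_of_le_one h0 (by linarith) (Nat.mul_div_le n k)
    rw [mul_pow, ← pow_mul]
    have h2 : (0 : ℝ) ≤ 2 ^ (n / k) := by positivity
    have h3 := mul_le_mul_of_nonneg_left h1 h2
    show 1 - 2 ^ (n / k) * (1 - q / 2) ^ (k * (n / k)) ≤ 1 - 2 ^ (n / k) * (1 - q / 2) ^ n
    linarith

end Filter

/-! ### Entangled triangle mixtures are distillable -/

section Kraus

variable {a : Type} [Fintype a] [DecidableEq a]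

/-- A contraction is one of the Kraus operators of a measurement: the other ones are the rows of
`√(1 - K† K)`, with the first basis vector as output. -/
lemma exists_kraus_completion {K : Matrix (Fin 2) a ℂ} (hK : (1 - Kᴴ * K).PosSemidef) :
    ∃ F : Option a → Matrix (Fin 2) a ℂ, F none = K ∧ ∑ i, (F i)ᴴ * F i = 1 := by
  have hR : (matSqrt (1 - Kᴴ * K))ᴴ * matSqrt (1 - Kᴴ * K) = 1 - Kᴴ * K := by
    rw [conjTranspose_matSqrt hK, matSqrt_mul_self hK]
  obtain ⟨R, hR'⟩ : ∃ R, R = matSqrt (1 - Kᴴ * K) := ⟨_, rfl⟩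
  rw [← hR'] at hR
  refine ⟨fun o => o.elim K fun i => Matrix.of fun j x => if j = 0 then R i x else 0, rfl, ?_⟩
  rw [Fintype.sum_option]
  have h1 : ∑ i : a, (Matrix.of fun (j : Fin 2) x => if j = 0 then R i x else 0)ᴴ *
      (Matrix.of fun (j : Fin 2) x => if j = 0 then R i x else 0) = Rᴴ * R := by
    ext x y
    simp [Matrix.sum_apply, Matrix.mul_apply, conjTranspose_apply]
  exact (congrArg (Kᴴ * K + ·) (h1.trans hR)).trans (add_sub_cancel _ _)

lemma posSemidef_one_sub_of_isometry {V : Matrix a (Fin 2) ℂ} (hV : Vᴴ * V = 1) {c : Fin 2 → ℝ}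
    (hc : ∀ i, 0 ≤ c i) (hc1 : ∀ i, c i ≤ 1) :
    (1 - (diagonal (fun i => (c i : ℂ)) * Vᴴ)ᴴ *
      (diagonal (fun i => (c i : ℂ)) * Vᴴ)).PosSemidef := by
  have h1 : (1 - V * Vᴴ).PosSemidef := by
    have h2 : 1 - V * Vᴴ = (1 - V * Vᴴ)ᴴ * (1 - V * Vᴴ) := by
      rw [conjTranspose_sub, conjTranspose_one, conjTranspose_mul, conjTranspose_conjTranspose,
        mul_sub, sub_mul, sub_mul, Matrix.mul_assoc V Vᴴ (V * Vᴴ), ← Matrix.mul_assoc Vᴴ V Vᴴ, hV]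
      simp
    rw [h2]
    exact posSemidef_conjTranspose_mul_self _
  have h3 : (V * diagonal (fun i => ((1 - c i * c i : ℝ) : ℂ)) * Vᴴ).PosSemidef := by
    refine PosSemidef.mul_mul_conjTranspose_same (posSemidef_diagonal_iff.mpr fun i => ?_) V
    have : (0 : ℝ) ≤ 1 - c i * c i := by nlinarith [hc i, hc1 i]
    exact_mod_cast this
  have h4 : diagonal (fun i => ((1 - c i * c i : ℝ) : ℂ)) =
      1 - diagonal (fun i => (c i : ℂ)) * diagonal (fun i => (c i : ℂ)) := by
    rw [diagonal_mul_diagonal, ← diagonal_one, diagonal_sub]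
    congr 1
    ext i
    push_cast
    rfl
  convert h1.add h3 using 1
  rw [h4, conjTranspose_mul, conjTranspose_conjTranspose, (isHermitian_diagonal_ofReal _).eq]
  simp only [Matrix.mul_sub, Matrix.sub_mul, Matrix.mul_one, Matrix.mul_assoc]
  abel

end Kraus

variable {a b : Type} [Fintype a] [DecidableEq a] [Fintype b] [DecidableEq b]

lemma isDensity_isometry_diagonal {d k : ℕ} {A : Matrix a (Fin d × Fin k) ℂ} (hA : Aᴴ * A = 1)
    {f : Fin d → ℝ} {g : Fin k → ℝ} (hf : ∀ i, 0 ≤ f i) (hg : ∀ i, 0 ≤ g i)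
    (hf1 : ∑ i, f i = 1) (hg1 : ∑ i, g i = 1) :
    IsDensity (A * diagonal (fun z : Fin d × Fin k => ((f z.1 * g z.2 : ℝ) : ℂ)) * Aᴴ) := by
  constructor
  · refine PosSemidef.mul_mul_conjTranspose_same (posSemidef_diagonal_iff.mpr fun z => ?_) A
    exact_mod_cast mul_nonneg (hf z.1) (hg z.2)
  · rw [trace_mul_cycle, hA, Matrix.one_mul, trace_diagonal, ← Complex.ofReal_sum,
      Fintype.sum_prod_type]
    simp only [← Finset.mul_sum, hg1, mul_one, hf1, Complex.ofReal_one]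

lemma schmidtIsometry_conj_of_subsingleton {d k k' : ℕ} [Subsingleton (Fin d)] {μ : Fin d → ℝ}
    (h1 : ∑ x, μ x = 1) (p : ℝ) (α : Fin k → ℝ) (β : Fin k' → ℝ) :
    schmidtIsometry k k' μ * diagonal (fun z : Fin k × Fin k' => ((p * (α z.1 * β z.2) : ℝ) : ℂ)) *
        (schmidtIsometry k k' μ)ᴴ =
      (p : ℂ) • (diagonal (fun z : Fin d × Fin k => ((μ z.1 * α z.2 : ℝ) : ℂ)) ⊗ₖ
        diagonal (fun z : Fin k' × Fin d => ((β z.1 * μ z.2 : ℝ) : ℂ))) := by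
  have hμ : ∀ x, μ x = 1 := fun x => by
    rw [← h1, Fintype.sum_subsingleton _ x]
  ext ⟨⟨x, s⟩, ⟨t, y⟩⟩ ⟨⟨x', s'⟩, ⟨t', y'⟩⟩
  obtain rfl := Subsingleton.elim x y
  obtain rfl := Subsingleton.elim x x'
  obtain rfl := Subsingleton.elim x y'
  rw [schmidtIsometry_conj_apply]
  simp only [hμ, Matrix.smul_apply, kroneckerMap_apply, diagonal_apply, Prod.mk.injEq, true_and,
    and_true]
  by_cases h2 : s = s' <;> by_cases h3 : t = t' <;> simp [h2, h3]

namespace IsTriangleMixture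

variable {ρ : Matrix (a × b) (a × b) ℂ} {N : ℕ} {d k k' : Fin N → ℕ} {p : Fin N → ℝ}
  {μ : ∀ l, Fin (d l) → ℝ} {α : ∀ l, Fin (k l) → ℝ} {β : ∀ l, Fin (k' l) → ℝ}
  {A : ∀ l, Matrix a (Fin (d l) × Fin (k l)) ℂ} {B : ∀ l, Matrix b (Fin (k' l) × Fin (d l)) ℂ}

/-- Without entanglement in the states `ψ^l_{A₁B₂}` the marginal is a mixture of product states. -/
lemma isSeparable (h : IsTriangleMixture ρ d k k' p μ α β A B) (hd : ∀ l, 0 < p l → d l ≤ 1) :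
    IsSeparable ρ := by
  refine ⟨N, p,
    fun l => A l *
      diagonal (fun z : Fin (d l) × Fin (k l) => ((μ l z.1 * α l z.2 : ℝ) : ℂ)) * (A l)ᴴ,
    fun l => B l *
      diagonal (fun z : Fin (k' l) × Fin (d l) => ((β l z.1 * μ l z.2 : ℝ) : ℂ)) * (B l)ᴴ,
    h.p_nonneg, h.p_sum,
    fun l => isDensity_isometry_diagonal (h.blockA.1 l) (fun x => (h.μ_pos l x).le) (h.α_nonneg l)
      (h.μ_sum l) (h.α_sum l),
    fun l => isDensity_isometry_diagonal (h.blockB.1 l) (h.β_nonneg l) (fun x => (h.μ_pos l x).le)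
      (h.β_sum l) (h.μ_sum l), ?_⟩
  conv_lhs => rw [h.eq]
  refine Finset.sum_congr rfl fun l _ => ?_
  rcases (h.p_nonneg l).eq_or_lt with hp | hp
  · simp [← hp]
  · have : Subsingleton (Fin (d l)) := Fin.subsingleton_iff_le_one.mpr (hd l hp)
    have h2 := schmidtIsometry_conj_of_subsingleton (h.μ_sum l) (p l) (α l) (β l)
    calc _ = (A l ⊗ₖ B l) * (schmidtIsometry (k l) (k' l) (μ l) *
          diagonal (fun z : Fin (k l) × Fin (k' l) => ((p l * (α l z.1 * β l z.2) : ℝ) : ℂ)) *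
          (schmidtIsometry (k l) (k' l) (μ l))ᴴ) * (A l ⊗ₖ B l)ᴴ := by
          rw [conjTranspose_mul]
          simp only [Matrix.mul_assoc]
      _ = (p l : ℂ) • ((A l *
            diagonal (fun z : Fin (d l) × Fin (k l) => ((μ l z.1 * α l z.2 : ℝ) : ℂ)) * (A l)ᴴ) ⊗ₖ
          (B l *
            diagonal (fun z : Fin (k' l) × Fin (d l) => ((β l z.1 * μ l z.2 : ℝ) : ℂ)) *
            (B l)ᴴ)) := by
          rw [h2, mul_kronecker_mul, mul_kronecker_mul, conjTranspose_kronecker, Matrix.mul_smul,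
            Matrix.smul_mul]

/-- Filtering: projecting on two Schmidt vectors of `ψ^l_{A₁B₂}`, on fixed eigenvectors in `A₂` and
`B₁`, and equalizing the two Schmidt coefficients on the side of `A` leaves a Bell pair. To equalize
them, each Schmidt vector is weighted by the coefficient of the other one, whose index is `i + 1` in
`Fin 2`. -/
lemma filter_eq (h : IsTriangleMixture ρ d k k' p μ α β A B) (l : Fin N) {x : Fin 2 → Fin (d l)}
    (hx : Function.Injective x) (s : Fin (k l)) (t : Fin (k' l)) :
    (((diagonal (fun i => (Real.sqrt (μ l (x (i + 1))) : ℂ)) : Matrix (Fin 2) (Fin 2) ℂ) *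
        ((A l).submatrix id fun i => (x i, s))ᴴ) ⊗ₖ
      ((diagonal (fun _ => ((1 : ℝ) : ℂ)) : Matrix (Fin 2) (Fin 2) ℂ) *
        ((B l).submatrix id fun i => (t, x i))ᴴ)) * ρ *
    (((diagonal (fun i => (Real.sqrt (μ l (x (i + 1))) : ℂ)) : Matrix (Fin 2) (Fin 2) ℂ) *
        ((A l).submatrix id fun i => (x i, s))ᴴ) ⊗ₖ
      ((diagonal (fun _ => ((1 : ℝ) : ℂ)) : Matrix (Fin 2) (Fin 2) ℂ) *
        ((B l).submatrix id fun i => (t, x i))ᴴ))ᴴ =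
    ((2 * (μ l (x 0) * μ l (x 1) * (p l * (α l s * β l t))) : ℝ) : ℂ) • ketBra bellPair := by
  obtain ⟨C, hC⟩ : ∃ C, C = diagonal (fun i => (Real.sqrt (μ l (x (i + 1))) : ℂ)) := ⟨_, rfl⟩
  obtain ⟨V, hV⟩ : ∃ V, V = ((A l).submatrix id fun i => (x i, s)) := ⟨_, rfl⟩
  obtain ⟨W, hW⟩ : ∃ W, W = ((B l).submatrix id fun i => (t, x i)) := ⟨_, rfl⟩
  obtain ⟨T, hT⟩ : ∃ T : ∀ m, Matrix _ _ ℂ, T = fun m => schmidtIsometry (k m) (k' m) (μ m) *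
    diagonal (fun z : Fin (k m) × Fin (k' m) => ((p m * (α m z.1 * β m z.2) : ℝ) : ℂ)) *
    (schmidtIsometry (k m) (k' m) (μ m))ᴴ := ⟨_, rfl⟩
  have hone : diagonal (fun _ : Fin 2 => ((1 : ℝ) : ℂ)) = 1 := by simp
  have hρ : ρ = ∑ m, (A m ⊗ₖ B m) * T m * (A m ⊗ₖ B m)ᴴ := by
    conv_lhs => rw [h.eq]
    refine Finset.sum_congr rfl fun m _ => ?_
    rw [hT, conjTranspose_mul]
    simp only [Matrix.mul_assoc]
  have hsum : ((C * Vᴴ) ⊗ₖ Wᴴ) * ρ * ((C * Vᴴ) ⊗ₖ Wᴴ)ᴴ =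
      ∑ m, ((C * (Vᴴ * A m)) ⊗ₖ (Wᴴ * B m)) * T m * ((C * (Vᴴ * A m)) ⊗ₖ (Wᴴ * B m))ᴴ := by
    rw [hρ, Matrix.mul_sum, Matrix.sum_mul]
    refine Finset.sum_congr rfl fun m _ => ?_
    rw [← Matrix.mul_assoc C, mul_kronecker_mul (C * Vᴴ), conjTranspose_mul]
    simp only [Matrix.mul_assoc]
  -- the projections select the block `l`
  have hzero : ∀ m, m ≠ l → Vᴴ * A m = 0 := fun m hm => by
    ext i j
    rw [hV]
    exact congrFun (congrFun (h.blockA.2 l m hm.symm) (x i, s)) j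
  have hVA : Vᴴ * A l = (1 : Matrix (Fin (d l) × Fin (k l)) _ ℂ).submatrix
      (fun i => (x i, s)) id := by
    ext i j
    rw [hV]
    exact congrFun (congrFun (h.blockA.1 l) (x i, s)) j
  have hWB : Wᴴ * B l = (1 : Matrix (Fin (k' l) × Fin (d l)) _ ℂ).submatrix
      (fun i => (t, x i)) id := by
    ext i j
    rw [hW]
    exact congrFun (congrFun (h.blockB.1 l) (t, x i)) j
  have hsub : ∀ (i : Fin 2 × Fin 2) q, ((C * (Vᴴ * A l)) ⊗ₖ (Wᴴ * B l)) i q =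
      if q = ((x i.1, s), (t, x i.2)) then (Real.sqrt (μ l (x (i.1 + 1))) : ℂ) else 0 := by
    rintro ⟨i, j⟩ ⟨q, q'⟩
    rw [kroneckerMap_apply, hVA, hWB, hC, diagonal_mul]
    simp only [submatrix_apply, id, one_apply, Prod.mk.injEq, eq_comm (a := q), eq_comm (a := q')]
    split_ifs <;> simp_all
  -- the equalized coefficient
  have hcoef : ∀ i : Fin 2, Real.sqrt (μ l (x (i + 1))) * Real.sqrt (μ l (x i)) =
      Real.sqrt (μ l (x 0) * μ l (x 1)) := fun i => by
    rw [← Real.sqrt_mul (h.μ_pos l _).le]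
    fin_cases i
    · rw [mul_comm]
      rfl
    · rfl
  have hs : Real.sqrt (μ l (x 0) * μ l (x 1)) * Real.sqrt (μ l (x 0) * μ l (x 1)) =
      μ l (x 0) * μ l (x 1) :=
    Real.mul_self_sqrt (mul_nonneg (h.μ_pos l _).le (h.μ_pos l _).le)
  rw [hone, Matrix.one_mul, ← hC, ← hV, ← hW, hsum, Finset.sum_eq_single l
    (fun m _ hm => by rw [hzero m hm, Matrix.mul_zero, zero_kronecker]; simp)
    (fun hl => absurd (Finset.mem_univ l) hl)]
  ext i j
  have hentry : (((C * (Vᴴ * A l)) ⊗ₖ (Wᴴ * B l)) * T l * ((C * (Vᴴ * A l)) ⊗ₖ (Wᴴ * B l))ᴴ) i j =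
      (Real.sqrt (μ l (x (i.1 + 1))) : ℂ) *
        T l ((x i.1, s), (t, x i.2)) ((x j.1, s), (t, x j.2)) *
        Real.sqrt (μ l (x (j.1 + 1))) := by
    simp only [Matrix.mul_apply, conjTranspose_apply, hsub, ite_mul, zero_mul, Finset.sum_ite_eq',
      Finset.mem_univ, if_true, apply_ite star, star_zero, mul_ite, mul_zero]
    congr 1
    exact Complex.conj_ofReal _
  have h2 : ((Real.sqrt 2 : ℝ) : ℂ)⁻¹ * ((Real.sqrt 2 : ℝ) : ℂ)⁻¹ = 2⁻¹ := by
    rw [← mul_inv, ← Complex.ofReal_mul, Real.mul_self_sqrt (by norm_num)]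
    norm_num
  rw [hentry, congrFun hT l, schmidtIsometry_conj_apply, Matrix.smul_apply, ketBra, vecMulVec_apply,
    Pi.star_apply]
  simp only [bellPair, hx.eq_iff, and_true]
  by_cases hi : i.1 = i.2 <;> by_cases hj : j.1 = j.2
  · rw [if_pos ⟨hi, hj⟩, if_pos hi, if_pos hj, star_inv₀]
    have h3 : star ((Real.sqrt 2 : ℝ) : ℂ) = (Real.sqrt 2 : ℝ) := Complex.conj_ofReal _
    rw [h3, h2]
    have h4 : Real.sqrt (μ l (x (i.1 + 1))) * (Real.sqrt (μ l (x i.1)) * (p l * (α l s * β l t)) *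
        Real.sqrt (μ l (x j.1))) * Real.sqrt (μ l (x (j.1 + 1))) =
        μ l (x 0) * μ l (x 1) * (p l * (α l s * β l t)) := by
      calc _ = (Real.sqrt (μ l (x (i.1 + 1))) * Real.sqrt (μ l (x i.1))) *
            (Real.sqrt (μ l (x (j.1 + 1))) * Real.sqrt (μ l (x j.1))) *
            (p l * (α l s * β l t)) := by ring
        _ = _ := by rw [hcoef, hcoef, hs]
    rw [← Complex.ofReal_mul, ← Complex.ofReal_mul, ← Complex.ofReal_mul, ← Complex.ofReal_mul, h4,
      smul_eq_mul, Complex.ofReal_mul 2]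
    push_cast
    ring
  all_goals simp [hi, hj]

/-- Entangled triangle mixtures are distillable. -/
theorem isDistillable (h : IsTriangleMixture ρ d k k' p μ α β A B) (hρ : IsEntangled ρ) :
    IsDistillable ρ := by
  obtain ⟨l, hp, hd⟩ : ∃ l, 0 < p l ∧ 1 < d l := by
    by_contra! hcon
    exact hρ.2 (h.isSeparable hcon)
  have hpos : ∀ {n : ℕ} {f : Fin n → ℝ}, (∀ i, 0 ≤ f i) → ∑ i, f i = 1 → ∃ i, 0 < f i :=
    fun hf h1 => by
      by_contra! hcon
      rw [Finset.sum_eq_zero fun i _ => le_antisymm (hcon i) (hf i)] at h1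
      exact zero_ne_one h1
  obtain ⟨s, hs⟩ := hpos (h.α_nonneg l) (h.α_sum l)
  obtain ⟨t, ht⟩ := hpos (h.β_nonneg l) (h.β_sum l)
  obtain ⟨x, hx⟩ : ∃ x : Fin 2 → Fin (d l), Function.Injective x :=
    ⟨Fin.castLE hd, Fin.castLE_injective hd⟩
  have hμ1 : ∀ y, μ l y ≤ 1 := fun y => by
    rw [← h.μ_sum l]
    exact Finset.single_le_sum (fun z _ => (h.μ_pos l z).le) (Finset.mem_univ y)
  have hsub : ∀ {n : Type} [Fintype n] [DecidableEq n] {n' : Type} [Fintype n'] [DecidableEq n']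
      {M : Matrix n n' ℂ}, Mᴴ * M = 1 → ∀ e : Fin 2 → n', Function.Injective e →
      (M.submatrix id e)ᴴ * M.submatrix id e = 1 := by
    intro n _ _ n' _ _ M hM e he
    rw [conjTranspose_submatrix, ← submatrix_mul _ _ _ _ _ Function.bijective_id, hM,
      submatrix_one _ he]
  obtain ⟨F, hF, hF1⟩ := exists_kraus_completion (posSemidef_one_sub_of_isometry
    (hsub (h.blockA.1 l) (fun i => (x i, s)) fun i j hij => hx (congrArg Prod.fst hij))
    (c := fun i => Real.sqrt (μ l (x (i + 1)))) (fun _ => Real.sqrt_nonneg _)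
    fun _ => Real.sqrt_le_one.mpr (hμ1 _))
  obtain ⟨G, hG, hG1⟩ := exists_kraus_completion (posSemidef_one_sub_of_isometry
    (hsub (h.blockB.1 l) (fun i => (t, x i)) fun i j hij => hx (congrArg Prod.snd hij))
    (c := fun _ => 1) (fun _ => zero_le_one) fun _ => le_rfl)
  have hq : 0 < 2 * (μ l (x 0) * μ l (x 1) * (p l * (α l s * β l t))) := by
    have := h.μ_pos l (x 0)
    have := h.μ_pos l (x 1)
    positivity
  refine isDistillable_of_filter hρ.1 hF1 hG1 hq none none ?_
  rw [hF, hG]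
  exact h.filter_eq l hx s t

end IsTriangleMixture

/-! ### Bound entanglement and sums of triangle states -/

section Purification

variable {a b : Type} [Fintype a] [DecidableEq a] [Fintype b] [DecidableEq b]

lemma IsDensity.exists_purification {ρ : Matrix (a × b) (a × b) ℂ} (hρ : IsDensity ρ) :
    ∃ ψ : (a × b) × (a × b) → ℂ, IsUnitVector ψ ∧ marginalAB ψ = ρ := by
  have h : marginalAB (fun z : (a × b) × (a × b) => matSqrt ρ z.1 z.2) = ρ := by
    rw [marginalAB_eq]
    change matSqrt ρ * (matSqrt ρ)ᴴ = ρ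
    rw [conjTranspose_matSqrt hρ.1, matSqrt_mul_self hρ.1]
  refine ⟨_, ?_, h⟩
  have h1 := hρ.2
  rw [← h, marginalAB, trace_traceRight] at h1
  have h2 : (∑ z : (a × b) × (a × b), ‖matSqrt ρ z.1 z.2‖ ^ 2 : ℝ) = (1 : ℂ) := by
    rw [← h1]
    simp [trace, ketBra, vecMulVec, Complex.mul_conj, Complex.normSq_eq_norm_sq]
  rw [IsUnitVector]
  exact_mod_cast h2

theorem IsSOTS.isDistillable {c : Type} [Fintype c] {ψ : (a × b) × c → ℂ} (h : IsSOTS ψ)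
    (hent : IsEntangled (marginalAB ψ)) : IsDistillable (marginalAB ψ) := by
  obtain ⟨N, d, k, k', p, μ, α, β, A, B, hT⟩ := h.exists_isTriangleMixture
  exact hT.isDistillable hent

theorem isSOTS_iff_markovGap_eq_zero {c : Type} [Fintype c] {ψ : (a × b) × c → ℂ}
    (hψ : IsUnitVector ψ) : IsSOTS ψ ↔ markovGap (marginalAB ψ) = 0 := by
  refine ⟨fun h => ?_, isSOTS_of_markovGap_eq_zero hψ⟩
  obtain ⟨N, d, k, k', p, μ, α, β, A, B, hT⟩ := h.exists_isTriangleMixture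
  exact hT.markovGap_eq_zero

theorem IsBoundEntangled.markovGap_pos {ρ : Matrix (a × b) (a × b) ℂ} (h : IsBoundEntangled ρ) :
    0 < markovGap ρ := by
  obtain ⟨ψ, hψ, rfl⟩ := h.1.1.exists_purification
  refine (markovGap_nonneg_and_sylvester h.1.1.1).1.lt_of_ne' fun h0 => ?_
  exact h.2 ((isSOTS_of_markovGap_eq_zero hψ h0).isDistillable h.1)

end Purification

end Quantum

end

theorem mainTheorem3 {a b : Type} [Fintype a] [DecidableEq a] [Fintype b] [DecidableEq b] :
    (∀ (c : Type) [Fintype c] (ψ : (a × b) × c → ℂ), Quantum.IsUnitVector ψ →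
      (Quantum.IsSOTS ψ ↔ Quantum.markovGap (Quantum.marginalAB ψ) = 0) ∧
      (Quantum.IsSOTS ψ →
        (Quantum.IsEntangled (Quantum.marginalAB ψ) →
          Quantum.IsDistillable (Quantum.marginalAB ψ)) ∧
        ¬ Quantum.IsBoundEntangled (Quantum.marginalAB ψ))) ∧
    (∀ ρ : Matrix (a × b) (a × b) ℂ, Quantum.IsBoundEntangled ρ → 0 < Quantum.markovGap ρ) :=
  ⟨fun _ _ _ hψ => ⟨Quantum.isSOTS_iff_markovGap_eq_zero hψ, fun h =>
    ⟨h.isDistillable, fun hb => hb.2 (h.isDistillable hb.1)⟩⟩, fun _ h => h.markovGap_pos⟩
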